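/- \textbf{Conventions.} All dg-algebras are associative, graded over $\mathbb Z$ (over the ground ring $\mathbb Z$), with differential of degree $+1$. A \emph{Hirsch algebra} is a dg-algebra $A$ with multilinear operations $E_{p,q}:A^{\otimes p}\otimes A^{\otimes q}\to A$ of degree $1-p-q$ ($p,q\ge 0$, $p+q\ge 1$) such that $E_{1,0}=E_{0,1}=\mathrm{Id}$, $E_{p,0}=E_{0,p}=0$ for $p>1$, and, for homogeneous $a_i,b_j$, \begin{align*} dE_{p,q}(a_1,\dots,a_p;b_1,\dots,b_q)=&\sum_{i=1}^{p}(-1)^{\epsilon^a_{i-1}}E_{p,q}(\dots,da_i,\dots;b_1,\dots,b_q)+\sum_{j=1}^{q}(-1)^{\epsilon^a_p+\epsilon^b_{j-1}}E_{p,q}(a_1,\dots,a_p;\dots,db_j,\dots)\\ &+\sum_{1\le i<p}(-1)^{\epsilon^a_i}E_{p-1,q}(\dots,a_ia_{i+1},\dots;b_1,\dots,b_q)+\sum_{1\le j<q}(-1)^{\epsilon^a_p+\epsilon^b_j}E_{p,q-1}(a_1,\dots,a_p;\dots,b_jb_{j+1},\dots)\\ &+\sum_{\substack{0\le i\le p,\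 0\le j\le q\\ (i,j)\ne(0,0),(p,q)}}(-1)^{\epsilon_{i,j}}E_{i,j}(a_1,\dots,a_i;b_1,\dots,b_j)\cdot E_{p-i,q-j}(a_{i+1},\dots,a_p;b_{j+1},\dots,b_q), \end{align*} where $\epsilon^x_i=|x_1|+\dots+|x_i|+i$ and $\epsilon_{i,j}=\epsilon^a_i+\epsilon^b_j+(\epsilon^a_i+\epsilon^a_p)\epsilon^b_j+1$. A \emph{map of Hirsch algebras} is a degree-preserving ring homomorphism that commutes with $d$ and all $E_{p,q}$. A \emph{twisting sequence} in $A$ is a sequence $x_\bullet=(x_3,x_5,\dots)$, $x_{2n+1}\in A^{2n+1}$, with $dx_{2n+1}+\sum_{i+j=n,\ i,j\ge1}x_{2i+1}x_{2j+1}=0$ for all $n\ge 1$. Two twisting sequences $x_\bullet,y_\bullet$ are \emph{homotopic} if there are $h_{2n}\in A^{2n}$ ($n\ge1$) with $y_{2n+1}-x_{2n+1}+dh_{2n}+\sum_{i+j=n,\ i,j\ge1}(y_{2j+1}h_{2i}-h_{2i}x_{2j+1})=0$ for all $n\ge1$; $ts(A)$ is the set of homotopy classes. Let $A$ be a Hirsch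 $\mathbb Q$-algebra and $a\in A^{2n+1}$, $n\ge1$, a cocycle. In $BA=\bigoplus_{k\ge0}A^{\otimes k}$, with words $[b_1|\cdots|b_k]$, left multiplication by $[a]$ is $$\mu([a],[b_1|\cdots|b_k])=\sum_{0\le i\le j\le k}[b_1|\cdots|b_i|E_{1,j-i}(a;b_{i+1},\dots,b_j)|b_{j+1}|\cdots|b_k].$$ Put $a_0=[\,]$, $a_m=\mu([a],a_{m-1})$. The \emph{Kraines construction} $K(a)$ is the sequence for which $K(a)_{2nm+1}$ is the component in $A^{\otimes 1}=A$ of $a_m/m!$ ($m\ge1$), and all other terms are $0$. If $A$ is an arbitrary Hirsch algebra, $A_{\mathbb Q}=A\otimes\mathbb Q$ is a Hirsch $\mathbb Q$-algebra, and for a cocycle $a\in A^{2n+1}$ we write $K(a)$ for the Kraines construction on the image of $a$ in $A_{\mathbb Q}$. \textbf{Theorem.} There are maps $F_n: ts(A)\to H^{2n+1}(A)\otimes\mathbb Q$ ($n\ge1$), defined for every Hirsch algebra $A$ and natural for maps of Hirsch algebras $f:A\to B$, that is, $F_n(f(x_\bullet))=f_*F_n(x_\bullet)$, with the following properties. \begin{enumerate}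 \item If $x_{2i+1}=0$ for all $i<n$, then $x_{2n+1}$ is a cocycle and $F_n(x_\bullet)=[x_{2n+1}]$. \item If $A$ is a Hirsch $\mathbb Q$-algebra and $a\in A^{2n+1}$ is a cocycle, $n\ge1$, then $K(a)$ is a twisting sequence, $F_n(K(a))=[a]$, and $F_m(K(a))=0$ for all $m\ne n$. Likewise, if $A$ is any Hirsch algebra and $a\in A^{2n+1}$ is a cocycle, then $K(a)$ is a twisting sequence in $A_{\mathbb Q}$, $F_n(K(a))\in H^{2n+1}(A_{\mathbb Q})\otimes\mathbb Q$ is the image of $[a]$, and $F_m(K(a))=0$ for all $m\neq n$. \item Let $A$ have torsion-free cohomology. If $F_i(x_\bullet)=F_i(y_\bullet)$ for all $i\le n$, then $x_\bullet$ is homotopic to a twisting sequence $x'_\bullet$ with $x'_{2i+1}=y_{2i+1}$ for all $i\le n$. If moreover the cohomology of $A$ is supported in bounded degrees and $F_n(x_\bullet)=F_n(y_\bullet)$ for all $n$, then $x_\bullet$ is homotopic to $y_\bullet$. \end{enumerate} -/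

import Mathlib

open scoped TensorProduct DirectSum

universe u

noncomputable section

namespace Hirsch

/-! ## Auxiliary operations on finite tuples -/

/-- The first `i` entries of a tuple of length `p`. -/
def takeFst {X : Type*} {p : ℕ} (a : Fin p → X) (i : Fin (p + 1)) : Fin (i : ℕ) → X :=
  fun k => a ⟨k, by omega⟩

/-- The last `p - i` entries of a tuple of length `p`. -/
def dropFst {X : Type*} {p : ℕ} (a : Fin p → X) (i : Fin (p + 1)) : Fin (p - (i : ℕ)) → X :=
  fun k => a ⟨(i : ℕ) + k, by omega⟩

/-- For `i + 1 < p` (counting from `0`), the tuple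
`(a_0, …, a_{i-1}, a_i * a_{i+1}, a_{i+2}, …, a_{p-1})` of length `p - 1`. -/
def merge {X : Type*} [Mul X] {p : ℕ} (a : Fin p → X) (i : Fin (p - 1)) : Fin (p - 1) → X :=
  fun k =>
    if (k : ℕ) < i then a ⟨k, by omega⟩
    else if (k : ℕ) = i then a ⟨k, by omega⟩ * a ⟨k + 1, by omega⟩
    else a ⟨k + 1, by omega⟩

/-- The number `ε_i = |a_1| + ⋯ + |a_i| + i`, where `α` is the tuple of degrees `|a_1|, …, |a_p|`. -/
def eps {p : ℕ} (α : Fin p → ℤ) (i : ℕ) : ℤ :=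
  ∑ k : Fin p, if (k : ℕ) < i then α k + 1 else 0

/-! ## Differential graded algebras and Hirsch algebras -/

/-- An associative differential graded algebra over `ℤ`: a ring `A` which is the (internal) direct
sum of subgroups `gr k` (`k : ℤ`), with a differential of degree `+1` satisfying the graded Leibniz
rule. A unit is not required and is never used. -/
class DGAlgebra (A : Type u) extends NonUnitalRing A where
  /-- the homogeneous elements of degree `k` -/
  gr : ℤ → Submodule ℤ A
  isInternal : DirectSum.IsInternal gr
  mul_mem : ∀ {k l : ℤ} {a b : A}, a ∈ gr k → b ∈ gr l → a * b ∈ gr (k + l)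
  /-- the differential -/
  d : A →ₗ[ℤ] A
  d_mem : ∀ {k : ℤ} {a : A}, a ∈ gr k → d a ∈ gr (k + 1)
  d_d : ∀ a : A, d (d a) = 0
  leibniz : ∀ {k : ℤ} {a : A} (b : A), a ∈ gr k → d (a * b) = d a * b + k.negOnePow • (a * d b)

open DGAlgebra

/-- A Hirsch algebra: a dg-algebra with operations `E_{p,q} : A^{⊗p} ⊗ A^{⊗q} → A` of degree
`1 - p - q`. The value `E_{p,q}(a_1, …, a_p; b_1, …, b_q)` is `E p q (Sum.elim a b)`.
The operations are indexed by `p + q ≥ 1`; we put `E 0 0 = 0`, so that the product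
`E_{p,q} · E_{0,0}` in the last sum of `d_E` does not contribute. -/
class HirschAlgebra (A : Type u) extends DGAlgebra A where
  /-- the operations `E_{p,q}` -/
  E : (p q : ℕ) → MultilinearMap ℤ (fun _ : Fin p ⊕ Fin q => A) A
  E_zero_zero : E 0 0 = 0
  E_one_zero : ∀ (a : Fin 1 → A) (b : Fin 0 → A), E 1 0 (Sum.elim a b) = a 0
  E_zero_one : ∀ (a : Fin 0 → A) (b : Fin 1 → A), E 0 1 (Sum.elim a b) = b 0
  E_left_zero : ∀ p, 1 < p → E p 0 = 0
  E_right_zero : ∀ q, 1 < q → E 0 q = 0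
  E_mem : ∀ {p q : ℕ} {α : Fin p → ℤ} {β : Fin q → ℤ} {a : Fin p → A} {b : Fin q → A},
    (∀ i, a i ∈ gr (α i)) → (∀ j, b j ∈ gr (β j)) →
      E p q (Sum.elim a b) ∈ gr (∑ i, α i + ∑ j, β j + (1 - p - q))
  d_E : ∀ {p q : ℕ} {α : Fin p → ℤ} {β : Fin q → ℤ} {a : Fin p → A} {b : Fin q → A},
    (∀ i, a i ∈ gr (α i)) → (∀ j, b j ∈ gr (β j)) →
      d (E p q (Sum.elim a b)) =
        ∑ i : Fin p, (eps α i).negOnePow •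
            E p q (Sum.elim (Function.update a i (d (a i))) b)
        + ∑ j : Fin q, (eps α p + eps β j).negOnePow •
            E p q (Sum.elim a (Function.update b j (d (b j))))
        + ∑ i : Fin (p - 1), (eps α (i + 1)).negOnePow •
            E (p - 1) q (Sum.elim (merge a i) b)
        + ∑ j : Fin (q - 1), (eps α p + eps β (j + 1)).negOnePow •
            E p (q - 1) (Sum.elim a (merge b j))
        + ∑ i : Fin (p + 1), ∑ j : Fin (q + 1),
            if (i : ℕ) = 0 ∧ (j : ℕ) = 0 then 0 else
              (eps α i + eps β j + (eps α i + eps α p) * eps β j + 1).negOnePow •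
                (E i j (Sum.elim (takeFst a i) (takeFst b j)) *
                  E (p - i) (q - j) (Sum.elim (dropFst a i) (dropFst b j)))

open HirschAlgebra

/-- Maps of Hirsch algebras: degree-preserving ring homomorphisms that commute with the differential
and with all operations `E_{p,q}`. -/
structure HirschHom (A B : Type u) [HirschAlgebra A] [HirschAlgebra B] extends A →ₙ+* B where
  map_gr : ∀ {k : ℤ} {a : A}, a ∈ gr k → toFun a ∈ (gr k : Submodule ℤ B)
  map_d : ∀ a : A, toFun (d a) = d (toFun a)
  map_E : ∀ (p q : ℕ) (z : Fin p ⊕ Fin q → A), toFun (E p q z) = E p q (fun i => toFun (z i))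

/-! ## Cohomology -/

section Cohomology

variable (A : Type u) [DGAlgebra A]

/-- The group `Z^k(A)` of cocycles of degree `k`. -/
def cocycles (k : ℤ) : Submodule ℤ A := gr k ⊓ LinearMap.ker d

/-- The group `d(A^{k-1})` of coboundaries of degree `k`. -/
def coboundaries (k : ℤ) : Submodule ℤ A := (gr (k - 1)).map d

/-- The cohomology group `H^k(A)`. -/
abbrev Cohomology (k : ℤ) : Type u :=
  cocycles A k ⧸ (coboundaries A k).comap (cocycles A k).subtype

variable {A}

/-- The class `[z] ∈ H^k(A)` of a cocycle. -/
def cls {k : ℤ} (z : A) (hz : z ∈ cocycles A k) : Cohomology A k := Submodule.Quotient.mk ⟨z, hz⟩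

end Cohomology

/-! ## Twisting sequences -/

section Twisting

variable {A : Type u} [DGAlgebra A]

/-- `x n` stands for `x_{2n+1}`, `n ≥ 1`. There is no term `x_1`; we put `x 0 = 0`, so that the sum
over the antidiagonal is the sum over `i + j = n` with `i, j ≥ 1`. -/
structure IsTwistingSequence (x : ℕ → A) : Prop where
  zero : x 0 = 0
  mem : ∀ n : ℕ, x n ∈ gr (2 * n + 1 : ℤ)
  eqn : ∀ n : ℕ, d (x n) + ∑ ij ∈ Finset.HasAntidiagonal.antidiagonal n, x ij.1 * x ij.2 = 0

variable (A) in
/-- The set `TS(A)` of twisting sequences. -/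
def TS : Type u := {x : ℕ → A // IsTwistingSequence x}

/-- Homotopy of twisting sequences. Here `h n` stands for `h_{2n}`, `n ≥ 1`, and `h 0 = 0`. -/
def Homotopic (x y : TS A) : Prop :=
  ∃ h : ℕ → A, h 0 = 0 ∧ (∀ n : ℕ, h n ∈ gr (2 * n : ℤ)) ∧
    ∀ n : ℕ, y.1 n - x.1 n + d (h n)
      + ∑ ij ∈ Finset.HasAntidiagonal.antidiagonal n, (y.1 ij.2 * h ij.1 - h ij.1 * x.1 ij.2) = 0

variable (A) in
/-- The set `ts(A)` of homotopy classes of twisting sequences. -/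
def HTS : Type u := Quot (Homotopic (A := A))

/-- The homotopy class of a twisting sequence. -/
def TS.cls (x : TS A) : HTS A := Quot.mk _ x

end Twisting

/-! ## Maps induced by a map of Hirsch algebras -/

namespace HirschHom

variable {A B : Type u} [HirschAlgebra A] [HirschAlgebra B] (f : HirschHom A B)

/-- The underlying additive map. -/
def lin : A →ₗ[ℤ] B := f.toNonUnitalRingHom.toAddMonoidHom.toIntLinearMap

theorem lin_gr {k : ℤ} {a : A} (ha : a ∈ gr k) : f.lin a ∈ (gr k : Submodule ℤ B) := f.map_gr ha

theorem lin_d (a : A) : f.lin (d a) = d (f.lin a) := f.map_d a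

theorem lin_mul (a b : A) : f.lin (a * b) = f.lin a * f.lin b := map_mul f.toNonUnitalRingHom a b

theorem lin_cocycles {k : ℤ} {a : A} (ha : a ∈ cocycles A k) : f.lin a ∈ cocycles B k := by
  refine ⟨f.lin_gr ha.1, ?_⟩
  have h : d a = 0 := ha.2
  change d (f.lin a) = 0
  rw [← lin_d, h, map_zero]

/-- The induced map `f_* : H^k(A) → H^k(B)`, `[z] ↦ [f(z)]`. -/
def mapH (k : ℤ) : Cohomology A k →ₗ[ℤ] Cohomology B k :=
  Submodule.mapQ _ _ (f.lin.restrict fun _ ha => f.lin_cocycles ha) (by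
    rintro ⟨z, hz⟩ ⟨w, hw, rfl⟩
    exact ⟨f.lin w, f.lin_gr hw, (f.lin_d w).symm⟩)

/-- The induced map `f_* ⊗ ℚ : H^k(A) ⊗ ℚ → H^k(B) ⊗ ℚ`. -/
def mapHQ (k : ℤ) : Cohomology A k ⊗[ℤ] ℚ →ₗ[ℤ] Cohomology B k ⊗[ℤ] ℚ :=
  (f.mapH k).rTensor ℚ

/-- The induced map `TS(A) → TS(B)`. -/
def mapTS (x : TS A) : TS B :=
  ⟨fun n => f.lin (x.1 n), by
    refine ⟨by rw [x.2.zero, map_zero], fun n => f.lin_gr (x.2.mem n), fun n => ?_⟩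
    rw [← lin_d]
    simp only [← lin_mul]
    rw [← map_sum, ← map_add, x.2.eqn, map_zero]⟩

/-- The induced map `ts(A) → ts(B)`. -/
def mapHTS : HTS A → HTS B :=
  Quot.map f.mapTS (by
    rintro x y ⟨h, h0, hm, he⟩
    refine ⟨fun n => f.lin (h n), by simp only [h0, map_zero], fun n => f.lin_gr (hm n), fun n => ?_⟩
    simp only [mapTS, ← lin_d, ← lin_mul, ← map_sub]
    rw [← map_sum, ← map_add, ← map_add, he, map_zero])

end HirschHom

/-! ## The bar construction and the Kraines construction -/

section Bar

variable (A : Type u) [HirschAlgebra A]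

/-- The group underlying the bar construction, `BA = ⨁_n A^{⊗n}`. Its ring structure in Mathlib is
concatenation of words; it is used here only to write down words (it is not the product `μ` that
the operations `E_{p,q}` induce on `BA`). -/
abbrev Bar : Type u := ⨁ n : ℕ, ⨂[ℤ]^n A

variable {A}

/-- The word `[b_1 | ⋯ | b_n] ∈ BA`. -/
def word (n : ℕ) : MultilinearMap ℤ (fun _ : Fin n => A) (Bar A) :=
  (DirectSum.lof ℤ ℕ (fun n => ⨂[ℤ]^n A) n).compMultilinearMap (PiTensorProduct.tprod ℤ)

/-- The one-letter word `[b]`, as a linear function of `b`. -/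
def letterWord : A →ₗ[ℤ] Bar A where
  toFun b := word (A := A) 1 (fun _ => b)
  map_add' x y := by
    have h := (word (A := A) 1).map_update_add (fun _ => 0) 0 x y
    simp only [Function.update_eq_const_of_subsingleton] at h
    exact h
  map_smul' c x := by
    have h := (word (A := A) 1).map_update_smul (fun _ => 0) 0 c x
    simp only [Function.update_eq_const_of_subsingleton] at h
    exact h

/-- The part of `μ([a], [b_1 | ⋯ | b_n])` in which `[a]` is multiplied with the block of `l` letters
that follows the first `i` letters, as a multilinear function of the letters: the word
`[b_1 | ⋯ | b_i | E_{1,l}(a; b_{i+1}, …, b_{i+l}) | b_{i+l+1} | ⋯ | b_{i+l+r}]`. -/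
def leftMulTerm (a : A) (i l r : ℕ) :
    MultilinearMap ℤ (fun _ : (Fin i ⊕ Fin l) ⊕ Fin r => A) (Bar A) :=
  (LinearMap.mul' ℤ (Bar A)).compMultilinearMap
    (((LinearMap.mul' ℤ (Bar A)).compMultilinearMap
      ((word (A := A) i).domCoprod
        (letterWord.compMultilinearMap ((E 1 l).currySum (fun _ => a))))).domCoprod
      (word (A := A) r))

/-- A tuple of length `n = i + l + r` cut into blocks of lengths `i`, `l`, `r`. -/
def blocks {i l r n : ℕ} (h : i + l + r = n) : (Fin i ⊕ Fin l) ⊕ Fin r ≃ Fin n :=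
  (((finSumFinEquiv (m := i) (n := l)).sumCongr (Equiv.refl (Fin r))).trans finSumFinEquiv).trans
    (finCongr h)

/-- Left multiplication `μ([a], -) : BA → BA` by the word `[a]`, for `a` of odd degree.
On words,
`μ([a], [b_1 | ⋯ | b_n]) =
  ∑_{i + l + r = n} [b_1 | ⋯ | b_i | E_{1,l}(a; b_{i+1}, …, b_{i+l}) | b_{i+l+1} | ⋯ | b_n]`,
see `leftMul_word`. This is the general product `μ = ∑_k (μ^1)^{⊗ k} ∘ ∇_k` of the bar construction,
with `μ^1([a_1 | ⋯ | a_p], [b_1 | ⋯ | b_q]) = E_{p,q}(a_1, …, a_p; b_1, …, b_q)`: the word `[a]`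
goes to one of the `k` blocks, the remaining blocks contribute through `E_{0,q}`, that is, they
consist of one letter each, and there are no signs, because `[a]` has the even degree `|a| - 1`. -/
def leftMul (a : A) : Bar A →ₗ[ℤ] Bar A :=
  DirectSum.toModule ℤ ℕ (Bar A) fun n => PiTensorProduct.lift
    (∑ i : Fin (n + 1), ∑ l : Fin (n + 1 - i),
      (leftMulTerm a i l (n - i - l)).domDomCongr (blocks (by omega)))

theorem leftMul_word (a : A) (n : ℕ) (b : Fin n → A) :
    leftMul a (word (A := A) n b) = ∑ i : Fin (n + 1), ∑ l : Fin (n + 1 - i),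
      word (A := A) i (fun k => b ⟨k, by omega⟩)
        * word (A := A) 1 (fun _ => E 1 l
            (Sum.elim (fun _ => a) (fun k : Fin l => b ⟨i + k, by omega⟩)))
        * word (A := A) (n - i - l) (fun k => b ⟨i + l + k, by omega⟩) := by
  have h : leftMul a (word (A := A) n b) = (∑ i : Fin (n + 1), ∑ l : Fin (n + 1 - i),
      (leftMulTerm a i l (n - i - l)).domDomCongr (blocks (by omega))) b := by
    rw [leftMul, word, LinearMap.compMultilinearMap_apply]
    erw [DirectSum.toModule_lof]
    rw [PiTensorProduct.lift.tprod]
  rw [h]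
  simp only [sum_apply]
  rfl

/-- The component `BA → (BA)_1 = A`. -/
def letter : Bar A →ₗ[ℤ] A :=
  (PiTensorProduct.subsingletonEquiv (R := ℤ) (s := fun _ : Fin 1 => A) 0).toLinearMap ∘ₗ
    DirectSum.component ℤ ℕ (fun n => ⨂[ℤ]^n A) 1

/-- The elements `a_0 = 1 = []`, `a_m = μ([a], a_{m-1})` of `BA`. -/
def barPow (a : A) : ℕ → Bar A
  | 0 => word (A := A) 0 (fun k => k.elim0)
  | m + 1 => leftMul a (barPow a m)

/-- The Kraines construction `K(a)` on an odd cocycle `a` of degree `2n+1` in a rational Hirsch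
algebra: the `(BA)_1`-component of `exp(a) = ∑_m (a_m / m!) T^{nm}`. Thus
`K(a)_{2k+1}` is the `(BA)_1`-component of `a_m / m!` if `k = nm`, and `0` if `n ∤ k`. -/
def kraines [Module ℚ A] (n : ℕ) (a : A) (k : ℕ) : A :=
  if n ∣ k then (((k / n).factorial : ℚ)⁻¹) • letter (A := A) (barPow a (k / n)) else 0

end Bar

/-! ## Rationalization -/

/-- The rationalization `M_ℚ = ℚ ⊗ M` of an abelian group. -/
def Rationalization (M : Type*) [AddCommGroup M] : Type _ := ℚ ⊗[ℤ] M

namespace Rationalization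

section Group

variable {M : Type*} [AddCommGroup M]

instance : AddCommGroup (Rationalization M) := inferInstanceAs (AddCommGroup (ℚ ⊗[ℤ] M))

instance : Module ℚ (Rationalization M) := inferInstanceAs (Module ℚ (ℚ ⊗[ℤ] M))

/-- The element `q ⊗ a` of `ℚ ⊗ M`. -/
def mk (q : ℚ) (a : M) : Rationalization M := q ⊗ₜ[ℤ] a

theorem mk_add (q : ℚ) (a b : M) : mk q (a + b) = mk q a + mk q b := TensorProduct.tmul_add q a b

theorem add_mk (q r : ℚ) (a : M) : mk (q + r) a = mk q a + mk r a := TensorProduct.add_tmul q r a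

theorem smul_mk (q r : ℚ) (a : M) : q • mk r a = mk (q * r) a := rfl

/-- The additive map `a ↦ q ⊗ a`. -/
def mkHom (q : ℚ) : M →ₗ[ℤ] Rationalization M :=
  (AddMonoidHom.mk' (mk q) (mk_add q)).toIntLinearMap

theorem mkHom_apply (q : ℚ) (a : M) : mkHom q a = mk q a := rfl

/-- The image `ℚ ⊗ N ⊆ ℚ ⊗ M` of a subgroup `N ⊆ M`. -/
def sub (N : Submodule ℤ M) : Submodule ℤ (Rationalization M) :=
  AddSubgroup.toIntSubmodule (N.baseChange ℚ).toAddSubgroup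

theorem mk_mem {N : Submodule ℤ M} (q : ℚ) {a : M} (ha : a ∈ N) : mk q a ∈ sub N :=
  Submodule.tmul_mem_baseChange_of_mem _ ha

theorem exists_mk {N : Submodule ℤ M} {z : Rationalization M} (hz : z ∈ sub N) :
    ∃ q : ℚ, ∃ a ∈ N, z = mk q a := by
  obtain ⟨w, rfl⟩ : ∃ w : ℚ ⊗[ℤ] N, N.subtype.baseChange ℚ w = z := by
    have hz' : (z : ℚ ⊗[ℤ] M) ∈ N.baseChange ℚ := hz
    rw [Submodule.baseChange] at hz'
    exact hz'
  clear hz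
  suffices h : ∃ q : ℚ, ∃ a : N, w = q ⊗ₜ[ℤ] a by
    obtain ⟨q, a, rfl⟩ := h
    exact ⟨q, a, a.2, rfl⟩
  induction w with
  | zero => exact ⟨0, 0, by simp⟩
  | tmul q a => exact ⟨q, a, rfl⟩
  | add x y hx hy =>
    obtain ⟨q, a, rfl⟩ := hx
    obtain ⟨r, b, rfl⟩ := hy
    refine ⟨(q.den * r.den : ℚ)⁻¹, (q.num * r.den) • a + (r.num * q.den) • b, ?_⟩
    have hq : (q.den : ℚ) ≠ 0 := by exact_mod_cast q.den_nz
    have hr : (r.den : ℚ) ≠ 0 := by exact_mod_cast r.den_nz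
    rw [TensorProduct.tmul_add, ← TensorProduct.smul_tmul, ← TensorProduct.smul_tmul]
    congr 2
    · rw [zsmul_eq_mul]
      push_cast
      nth_rewrite 1 [← Rat.num_div_den q]
      field_simp
    · rw [zsmul_eq_mul]
      push_cast
      nth_rewrite 1 [← Rat.num_div_den r]
      field_simp

theorem exists_mk' (z : Rationalization M) : ∃ q : ℚ, ∃ a : M, z = mk q a := by
  have hz : (z : ℚ ⊗[ℤ] M) ∈ (⊤ : Submodule ℤ M).baseChange ℚ := by
    rw [Submodule.baseChange_top]
    trivial
  obtain ⟨q, a, -, h⟩ := exists_mk (N := ⊤) hz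
  exact ⟨q, a, h⟩

/-- A chosen numerator of an element of `ℚ ⊗ M`. -/
def num (z : Rationalization M) : M := (exists_mk' z).choose_spec.choose

/-- A chosen rational coefficient of an element of `ℚ ⊗ M`. -/
def coef (z : Rationalization M) : ℚ := (exists_mk' z).choose

theorem mk_coef_num (z : Rationalization M) : mk (coef z) (num z) = z :=
  (exists_mk' z).choose_spec.choose_spec.symm

theorem isInternal_sub {N : ℤ → Submodule ℤ M} (h : DirectSum.IsInternal N) :
    DirectSum.IsInternal fun k => sub (N k) :=
  h.baseChange (S := ℚ)

end Group

section Extension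

variable {ι M V : Type*} [AddCommGroup M] [AddCommGroup V] [Module ℚ V]

/-- The extension of an additive map `M → V` into a `ℚ`-vector space to `ℚ ⊗ M`. -/
def linExt (g : M →ₗ[ℤ] V) : Rationalization M →ₗ[ℤ] V :=
  (TensorProduct.lift (LinearMap.mk₂ ℤ (fun (q : ℚ) a => q • g a)
    (fun q r a => add_smul q r (g a)) (fun c q a => by rw [smul_assoc])
    (fun q a b => by rw [map_add, smul_add])
    (fun c q a => by rw [map_smul, smul_comm]))).toAddMonoidHom.toIntLinearMap

theorem linExt_mk (g : M →ₗ[ℤ] V) (q : ℚ) (a : M) : linExt g (mk q a) = q • g a := rfl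

variable [Fintype ι]

/-- The extension of a multilinear map `M^ι → V` into a `ℚ`-vector space to `ℚ ⊗ M`, as a
function. -/
def multExtFun (f : MultilinearMap ℤ (fun _ : ι => M) V) (z : ι → Rationalization M) : V :=
  (∏ i, coef (z i)) • f fun i => num (z i)

theorem multExtFun_update (f : MultilinearMap ℤ (fun _ : ι => M) V) [DecidableEq ι]
    (q : ι → ℚ) (a : ι → M) (i : ι) (r : ℚ) (c : M) :
    (∏ j, Function.update q i r j) • f (Function.update a i c) =
      linExt ((∏ j ∈ Finset.univ.erase i, q j) • f.toLinearMap a i) (mk r c) := by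
  rw [linExt_mk, LinearMap.smul_apply, smul_smul,
    ← Finset.mul_prod_erase _ _ (Finset.mem_univ i), Function.update_self]
  have h : ∏ j ∈ Finset.univ.erase i, Function.update q i r j = ∏ j ∈ Finset.univ.erase i, q j :=
    Finset.prod_congr rfl fun j hj => by rw [Function.update_of_ne (Finset.ne_of_mem_erase hj)]
  rw [h]
  rfl

theorem multExtFun_mk (f : MultilinearMap ℤ (fun _ : ι => M) V) (q : ι → ℚ) (a : ι → M) :
    multExtFun f (fun i => mk (q i) (a i)) = (∏ i, q i) • f a := by
  classical
  set z : ι → Rationalization M := fun i => mk (q i) (a i) with hz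
  suffices h : ∀ s : Finset ι,
      (∏ i, s.piecewise q (fun i => coef (z i)) i) • f (s.piecewise a fun i => num (z i)) =
        multExtFun f z by
    have := h Finset.univ
    simpa using this.symm
  intro s
  induction s using Finset.induction_on with
  | empty => simp [multExtFun]
  | insert i s hi ih =>
    rw [← ih, Finset.piecewise_insert, Finset.piecewise_insert, multExtFun_update]
    have e : mk (q i) (a i) = mk (coef (z i)) (num (z i)) := (mk_coef_num _).symm
    rw [e, ← multExtFun_update]
    have e1 : Function.update (s.piecewise q fun i => coef (z i)) i (coef (z i)) =
        s.piecewise q fun i => coef (z i) := by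
      rw [Function.update_eq_self_iff, Finset.piecewise_eq_of_notMem _ _ _ hi]
    have e2 : Function.update (s.piecewise a fun i => num (z i)) i (num (z i)) =
        s.piecewise a fun i => num (z i) := by
      rw [Function.update_eq_self_iff, Finset.piecewise_eq_of_notMem _ _ _ hi]
    rw [e1, e2]

theorem multExtFun_eq (f : MultilinearMap ℤ (fun _ : ι => M) V) [DecidableEq ι]
    (z : ι → Rationalization M) (i : ι) (x : Rationalization M) :
    multExtFun f (Function.update z i x) =
      linExt ((∏ j ∈ Finset.univ.erase i, coef (z j)) • f.toLinearMap (fun j => num (z j)) i)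
        x := by
  obtain ⟨r, c, rfl⟩ := exists_mk' x
  rw [← multExtFun_update, ← multExtFun_mk]
  congr 1
  ext j
  rcases eq_or_ne j i with rfl | hj
  · simp
  · simp [hj, mk_coef_num]

/-- The extension of a multilinear map `M^ι → V` into a `ℚ`-vector space to `ℚ ⊗ M`. -/
def multExt (f : MultilinearMap ℤ (fun _ : ι => M) V) :
    MultilinearMap ℤ (fun _ : ι => Rationalization M) V where
  toFun := multExtFun f
  map_update_add' z i x y := by rw [multExtFun_eq, multExtFun_eq, multExtFun_eq, map_add]
  map_update_smul' z i c x := by rw [multExtFun_eq, multExtFun_eq, map_smul]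

theorem multExt_mk (f : MultilinearMap ℤ (fun _ : ι => M) V) (q : ι → ℚ) (a : ι → M) :
    multExt f (fun i => mk (q i) (a i)) = (∏ i, q i) • f a := multExtFun_mk f q a

end Extension

section Products

theorem prod_merge {p : ℕ} (q : Fin p → ℚ) (i : Fin (p - 1)) : ∏ k, merge q i k = ∏ k, q k := by
  obtain _ | p := p
  · exact i.elim0
  change Fin p at i
  have h : ∀ k : Fin p, merge q i k =
      q (i.succ.succAbove k) * if k = i then q i.succ else 1 := by
    intro k
    rcases lt_trichotomy k i with hk | rfl | hk
    · rw [Fin.succAbove_of_castSucc_lt _ _ (by simpa [Fin.lt_def] using by omega)]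
      have : (k : ℕ) < i := hk
      simp [merge, this, hk.ne]
      rfl
    · rw [Fin.succAbove_of_castSucc_lt _ _ (by simp)]
      simp [merge]
      rfl
    · rw [Fin.succAbove_of_le_castSucc _ _ (by simpa [Fin.le_def] using hk)]
      have h1 : ¬ (k : ℕ) < i := not_lt.2 (le_of_lt hk)
      have h2 : (k : ℕ) ≠ i := fun e => hk.ne' (Fin.ext e)
      simp [merge, h1, h2, hk.ne']
      rfl
  have h' : ∏ k : Fin p, merge q i k =
      ∏ k : Fin p, (q (i.succ.succAbove k) * if k = i then q i.succ else 1) :=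
    Finset.prod_congr rfl fun k _ => h k
  rw [Fin.prod_univ_succAbove q i.succ, mul_comm]
  refine h'.trans ?_
  rw [Finset.prod_mul_distrib]
  simp

theorem prod_take_drop {p : ℕ} (q : Fin p → ℚ) (i : Fin (p + 1)) :
    (∏ k, takeFst q i k) * ∏ k, dropFst q i k = ∏ k, q k := by
  obtain ⟨i, hi⟩ := i
  obtain ⟨r, rfl⟩ := Nat.exists_eq_add_of_le (Nat.lt_succ_iff.1 hi)
  rw [Fin.prod_univ_add]
  congr 1
  change ∏ k : Fin (i + r - i), q ⟨i + k, _⟩ = _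
  have : i + r - i = r := by omega
  rw [← Equiv.prod_comp (finCongr this)]
  rfl

end Products

section Algebra

instance {A : Type*} [NonUnitalRing A] : NonUnitalRing (Rationalization A) :=
  inferInstanceAs (NonUnitalRing (ℚ ⊗[ℤ] A))

theorem mk_mul_mk {A : Type*} [NonUnitalRing A] (q r : ℚ) (a b : A) :
    mk q a * mk r b = mk (q * r) (a * b) := Algebra.TensorProduct.tmul_mul_tmul q r a b

theorem merge_mk {A : Type*} [NonUnitalRing A] {p : ℕ} (q : Fin p → ℚ) (a : Fin p → A)
    (i : Fin (p - 1)) :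
    merge (fun k => mk (q k) (a k)) i = fun k => mk (merge q i k) (merge a i k) := by
  ext k
  simp only [merge]
  split_ifs <;> simp [mk_mul_mk]

theorem update_mk {M κ : Type*} [AddCommGroup M] [DecidableEq κ] (q : κ → ℚ) (a : κ → M) (i : κ)
    (c : M) : Function.update (fun k => mk (q k) (a k)) i (mk (q i) c) =
      fun k => mk (q k) (Function.update a i c k) := by
  ext k
  rcases eq_or_ne k i with rfl | hk
  · simp
  · simp [hk]

instance {A : Type*} [DGAlgebra A] : DGAlgebra (Rationalization A) where
  gr k := sub (gr k)
  isInternal := isInternal_sub isInternal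
  mul_mem := by
    intro k l a b ha hb
    obtain ⟨q, a, ha', rfl⟩ := exists_mk ha
    obtain ⟨r, b, hb', rfl⟩ := exists_mk hb
    rw [mk_mul_mk]
    exact mk_mem _ (DGAlgebra.mul_mem ha' hb')
  d := linExt (mkHom 1 ∘ₗ d)
  d_mem := by
    intro k a ha
    obtain ⟨q, a, ha', rfl⟩ := exists_mk ha
    rw [linExt_mk, LinearMap.comp_apply, mkHom_apply, smul_mk]
    exact mk_mem _ (d_mem ha')
  d_d := by
    intro a
    obtain ⟨q, a, rfl⟩ := exists_mk' a
    simp only [linExt_mk, LinearMap.comp_apply, mkHom_apply, smul_mk, d_d]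
    rw [← mkHom_apply, map_zero]
  leibniz := by
    intro k a b ha
    obtain ⟨q, a, ha', rfl⟩ := exists_mk ha
    obtain ⟨r, b, rfl⟩ := exists_mk' b
    simp only [mk_mul_mk, linExt_mk, LinearMap.comp_apply, mkHom_apply, smul_mk, leibniz b ha',
      mk_add, mul_one]
    simp only [smul_add, smul_mk, mul_one]
    simp only [← mkHom_apply, Units.smul_def, map_zsmul]

theorem mem_gr {A : Type*} [DGAlgebra A] {k : ℤ} {z : Rationalization A} :
    z ∈ (gr k : Submodule ℤ (Rationalization A)) ↔ z ∈ sub (gr k : Submodule ℤ A) := Iff.rfl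

theorem d_mk {A : Type*} [DGAlgebra A] (q : ℚ) (a : A) : d (mk q a) = mk q (d a) := by
  change linExt (mkHom 1 ∘ₗ d) (mk q a) = _
  rw [linExt_mk, LinearMap.comp_apply, mkHom_apply, smul_mk, mul_one]

variable {A : Type*} [HirschAlgebra A]

/-- The extension of the operations `E_{p,q}` to `A_ℚ`. -/
def ratE (p q : ℕ) :
    MultilinearMap ℤ (fun _ : Fin p ⊕ Fin q => Rationalization A) (Rationalization A) :=
  multExt ((mkHom 1).compMultilinearMap (E p q))

theorem ratE_mk (p q : ℕ) (u : Fin p → ℚ) (v : Fin q → ℚ) (a : Fin p → A) (b : Fin q → A) :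
    ratE p q (Sum.elim (fun i => mk (u i) (a i)) (fun j => mk (v j) (b j))) =
      mk ((∏ i, u i) * ∏ j, v j) (E p q (Sum.elim a b)) := by
  have h : Sum.elim (fun i => mk (u i) (a i)) (fun j => mk (v j) (b j)) =
      fun k => mk (Sum.elim u v k) (Sum.elim a b k) := by
    ext (k | k) <;> rfl
  rw [h, ratE, multExt_mk, LinearMap.compMultilinearMap_apply, mkHom_apply, smul_mk, mul_one,
    Fintype.prod_sum_type]
  rfl

theorem exists_tuple {p : ℕ} {α : Fin p → ℤ} {a : Fin p → Rationalization A}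
    (h : ∀ i, a i ∈ sub (gr (α i) : Submodule ℤ A)) :
    ∃ (u : Fin p → ℚ) (a' : Fin p → A), (∀ i, a' i ∈ gr (α i)) ∧ a = fun i => mk (u i) (a' i) := by
  choose u a' h1 h2 using fun i => exists_mk (h i)
  exact ⟨u, a', h1, funext h2⟩

theorem exists_tuple' {p : ℕ} (a : Fin p → Rationalization A) :
    ∃ (u : Fin p → ℚ) (a' : Fin p → A), a = fun i => mk (u i) (a' i) := by
  choose u a' h2 using fun i => exists_mk' (a i)
  exact ⟨u, a', funext h2⟩

theorem smul_mk_units (e : ℤˣ) (q : ℚ) (a : A) : mk q (e • a) = e • mk q a := by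
  simp only [← mkHom_apply, Units.smul_def, map_zsmul]

instance : HirschAlgebra (Rationalization A) where
  E := ratE
  E_zero_zero := by
    ext z
    obtain ⟨u, a, hu⟩ := exists_tuple' (fun i => z (Sum.inl i))
    obtain ⟨v, b, hv⟩ := exists_tuple' (fun i => z (Sum.inr i))
    obtain rfl : z = Sum.elim (fun i => mk (u i) (a i)) (fun j => mk (v j) (b j)) := by
      rw [← hu, ← hv]
      ext (k | k) <;> rfl
    rw [ratE_mk, E_zero_zero, zero_apply, zero_apply, ← mkHom_apply,
      map_zero]
  E_one_zero a b := by
    obtain ⟨u, a, rfl⟩ := exists_tuple' a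
    obtain ⟨v, b, rfl⟩ := exists_tuple' b
    simp [ratE_mk, E_one_zero]
  E_zero_one a b := by
    obtain ⟨u, a, rfl⟩ := exists_tuple' a
    obtain ⟨v, b, rfl⟩ := exists_tuple' b
    simp [ratE_mk, E_zero_one]
  E_left_zero p hp := by
    ext z
    obtain ⟨u, a, hu⟩ := exists_tuple' (fun i => z (Sum.inl i))
    obtain ⟨v, b, hv⟩ := exists_tuple' (fun i => z (Sum.inr i))
    obtain rfl : z = Sum.elim (fun i => mk (u i) (a i)) (fun j => mk (v j) (b j)) := by
      rw [← hu, ← hv]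
      ext (k | k) <;> rfl
    rw [ratE_mk, E_left_zero p hp, zero_apply, zero_apply,
      ← mkHom_apply, map_zero]
  E_right_zero p hp := by
    ext z
    obtain ⟨u, a, hu⟩ := exists_tuple' (fun i => z (Sum.inl i))
    obtain ⟨v, b, hv⟩ := exists_tuple' (fun i => z (Sum.inr i))
    obtain rfl : z = Sum.elim (fun i => mk (u i) (a i)) (fun j => mk (v j) (b j)) := by
      rw [← hu, ← hv]
      ext (k | k) <;> rfl
    rw [ratE_mk, E_right_zero p hp, zero_apply, zero_apply,
      ← mkHom_apply, map_zero]
  E_mem := by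
    intro p q α β a b ha hb
    obtain ⟨u, a, ha', rfl⟩ := exists_tuple ha
    obtain ⟨v, b, hb', rfl⟩ := exists_tuple hb
    rw [ratE_mk]
    exact mk_mem _ (E_mem ha' hb')
  d_E := by
    intro p q α β a b ha hb
    obtain ⟨u, a, ha', rfl⟩ := exists_tuple ha
    obtain ⟨v, b, hb', rfl⟩ := exists_tuple hb
    have ht : ∀ {p : ℕ} (u : Fin p → ℚ) (a : Fin p → A) (i : Fin (p + 1)),
      takeFst (fun k => mk (u k) (a k)) i = fun k => mk (takeFst u i k) (takeFst a i k) :=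
      fun _ _ _ => rfl
    have hd : ∀ {p : ℕ} (u : Fin p → ℚ) (a : Fin p → A) (i : Fin (p + 1)),
      dropFst (fun k => mk (u k) (a k)) i = fun k => mk (dropFst u i k) (dropFst a i k) :=
      fun _ _ _ => rfl
    have hprod : ∀ (i : Fin (p + 1)) (j : Fin (q + 1)),
        ((∏ k, takeFst u i k) * ∏ k, takeFst v j k) *
          ((∏ k, dropFst u i k) * ∏ k, dropFst v j k) = (∏ k, u k) * ∏ k, v k := by
      intro i j
      rw [mul_mul_mul_comm, prod_take_drop, prod_take_drop]
    simp only [d_mk, update_mk, merge_mk, ht, hd, ratE_mk, prod_merge, mk_mul_mk, hprod,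
      d_E ha' hb', ← smul_mk_units]
    simp only [← mkHom_apply, map_add, map_sum, apply_ite (mkHom _), map_zero]

/-- The canonical map of Hirsch algebras `A → A_ℚ`, `a ↦ 1 ⊗ a`. -/
def incl (A : Type u) [HirschAlgebra A] : HirschHom A (Rationalization A) where
  toFun := mk 1
  map_zero' := (mkHom (M := A) 1).map_zero
  map_add' := mk_add 1
  map_mul' a b := by rw [mk_mul_mk, mul_one]
  map_gr ha := mk_mem 1 ha
  map_d a := (d_mk 1 a).symm
  map_E p q z := by
    have h : z = Sum.elim (fun i => z (Sum.inl i)) (fun j => z (Sum.inr j)) := by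
      ext (k | k) <;> rfl
    have h' : (fun i => mk 1 (z i)) = Sum.elim (fun i => mk 1 (z (Sum.inl i)))
        (fun j => mk 1 (z (Sum.inr j))) := by
      ext (k | k) <;> rfl
    change _ = ratE p q (fun i => mk 1 (z i))
    rw [h', ratE_mk, ← h]
    simp

end Algebra

end Rationalization

end Hirsch
end

/-!
The product `μ` of the bar construction of a Hirsch algebra is not associative in general, so a
twisting sequence has no logarithm from which its characteristic classes could be read off. Flows
take the place of the logarithm. Let `A` be a Hirsch algebra over `ℚ` and `a` a cocycle of degree
`2 * r + 3`. A series `u` in `T` and `s` with coefficients in `A` is a flow of `a` (`IsFlow`) if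

  `du/ds = T ^ (r + 1) * ∑ l, E_{1,l}(a; u, …, u)`.

This is the infinitesimal form of `μ([a], -)`: the series `∑ l, [u | ⋯ | u]` of words evolves by
left multiplication by `[a]` (`IsFlow.euler_wordSer`). A flow exists for any value at `s = 0` or
`s = 1`. The relation for `d E_{1,l}` shows that the curvature `du + u * u` satisfies a homogeneous
linear differential equation, so it vanishes if it vanishes at `s = 0` or at `s = 1`
(`IsFlow.isTwistingFamily`): flows preserve twisting sequences. The same argument for the defect of
the homotopy relation shows that flows of cohomologous cocycles carry homotopic twisting sequences
to homotopic ones (`IsFlow.exists_isHomotopy`).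

If the terms of `x` at `1, …, r` are zero, then `a = x (r + 1)` is a cocycle, and flowing back along
`a` from `s = 1` to `s = 0` removes this term (`step_succ`). After `n - 1` such steps the term at
`n` is a cocycle, whose class depends only on the homotopy class of the twisting sequence
(`leading_homotopic`). For a general Hirsch algebra this is applied to the image of the sequence in
`A_ℚ`, and the class is moved to `H(A) ⊗ ℚ` by the isomorphism `compareEquiv`. This is `charClass`.
All constructions commute with maps of Hirsch algebras.

The Kraines construction is the value at `s = 1` of the flow of `a` that starts at zero
(`IsFlow.evalOne_eq_kraines`): the coefficient of `s ^ m` in the series of words is `a_m / m!`.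
So it is a twisting sequence, and a single step of the above procedure carries it to zero.

If `x` and `y` agree below `n`, the removal of the lower terms does not change the difference
`x n - y n` (`leading_sub_leading`). Hence if the classes at `n` agree and there is no torsion, this
difference is a coboundary, and `x` can be changed by a homotopy so as to agree with `y` also at `n`
(`exists_isHomotopy_single`). In bounded cohomology the remaining obstructions to a homotopy vanish
(`exists_isHomotopy_of_eq`).

Flows are handled as formal power series whose exponent `(m, j)` stands for `(s * T) ^ m * T ^ j`.
All vector fields used here carry at least one factor `T` with the `s`, and in these variables
every total degree has finitely many monomials, so that the value at `s = 1` makes sense.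
-/

noncomputable section

namespace Hirsch

open DGAlgebra HirschAlgebra Finset.HasAntidiagonal

/-! ### Power series with coefficients in a ring without unit -/

/-- Pairs `(m, j)` of natural numbers with a given sum form a finite set. -/
instance : Finset.HasAntidiagonal (ℕ × ℕ) :=
  Finset.HasAntidiagonal.antidiagonalOfLocallyFinite

/-- Formal power series with exponents in `Γ` and coefficients in `V`. The coefficient of the
series `x` at the exponent `p` is written `x p`. -/
@[ext]
structure Ser (Γ V : Type*) where
  /-- the coefficients -/
  coeff : Γ → V

namespace Ser

variable {Γ V W : Type*}

instance : CoeFun (Ser Γ V) (fun _ => Γ → V) := ⟨coeff⟩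

@[simp] theorem mk_apply (f : Γ → V) (p : Γ) : (⟨f⟩ : Ser Γ V) p = f p := rfl

theorem ext' {x y : Ser Γ V} (h : ∀ p, x p = y p) : x = y := Ser.ext (funext h)

/-- A series is the same as the function of its coefficients. -/
def equivFun : Ser Γ V ≃ (Γ → V) := ⟨coeff, mk, fun _ => rfl, fun _ => rfl⟩

instance [AddCommGroup V] : AddCommGroup (Ser Γ V) := equivFun.addCommGroup

section AddCommGroup

variable [AddCommGroup V] [AddCommGroup W]

@[simp] theorem zero_apply (p : Γ) : (0 : Ser Γ V) p = 0 := rfl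
@[simp] theorem add_apply (x y : Ser Γ V) (p : Γ) : (x + y) p = x p + y p := rfl
@[simp] theorem sub_apply (x y : Ser Γ V) (p : Γ) : (x - y) p = x p - y p := rfl
@[simp] theorem neg_apply (x : Ser Γ V) (p : Γ) : (-x) p = -x p := rfl

/-- An additive map applied to all coefficients of a series. -/
def map (f : V →+ W) : Ser Γ V →+ Ser Γ W where
  toFun x := ⟨fun p => f (x p)⟩
  map_zero' := by ext p; simp
  map_add' x y := by ext p; simp

@[simp] theorem map_apply (f : V →+ W) (x : Ser Γ V) (p : Γ) : map f x p = f (x p) := rfl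

end AddCommGroup

variable [AddCommMonoid Γ] [Finset.HasAntidiagonal Γ]

section Mul

variable {R : Type*} [NonUnitalRing R]

/-- Convolution. -/
instance : Mul (Ser Γ R) := ⟨fun x y => ⟨fun p => ∑ ij ∈ antidiagonal p, x ij.1 * y ij.2⟩⟩

theorem mul_apply (x y : Ser Γ R) (p : Γ) :
    (x * y) p = ∑ ij ∈ antidiagonal p, x ij.1 * y ij.2 := rfl

/-- Reassociation of a sum over the decompositions of an exponent into three summands. -/
theorem sum_antidiagonal_assoc [AddCommMonoid V] (f : Γ → Γ → Γ → V) (n : Γ) :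
    ∑ ij ∈ antidiagonal n, ∑ kl ∈ antidiagonal ij.1, f kl.1 kl.2 ij.2 =
      ∑ ij ∈ antidiagonal n, ∑ kl ∈ antidiagonal ij.2, f ij.1 kl.1 kl.2 := by
  simp only [Finset.sum_sigma']
  refine Finset.sum_nbij' (fun a ↦ ⟨(a.2.1, a.2.2 + a.1.2), (a.2.2, a.1.2)⟩)
    (fun a ↦ ⟨(a.1.1 + a.2.1, a.2.2), (a.1.1, a.2.1)⟩) ?_ ?_ ?_ ?_ ?_
  · rintro ⟨⟨i, j⟩, ⟨k, l⟩⟩ h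
    simp only [Finset.mem_sigma, mem_antidiagonal] at h ⊢
    exact ⟨by rw [← add_assoc, h.2, h.1], trivial⟩
  · rintro ⟨⟨i, j⟩, ⟨k, l⟩⟩ h
    simp only [Finset.mem_sigma, mem_antidiagonal] at h ⊢
    exact ⟨by rw [add_assoc, h.2, h.1], trivial⟩
  · rintro ⟨⟨i, j⟩, ⟨k, l⟩⟩ h
    simp only [Finset.mem_sigma, mem_antidiagonal] at h
    simp [h.2]
  · rintro ⟨⟨i, j⟩, ⟨k, l⟩⟩ h
    simp only [Finset.mem_sigma, mem_antidiagonal] at h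
    simp [h.2]
  · intro _ _
    rfl

instance : NonUnitalRing (Ser Γ R) where
  left_distrib x y z := by
    refine ext' fun p => ?_
    simp only [mul_apply, add_apply, mul_add, Finset.sum_add_distrib]
  right_distrib x y z := by
    refine ext' fun p => ?_
    simp only [mul_apply, add_apply, add_mul, Finset.sum_add_distrib]
  zero_mul x := ext' fun p => by simp [mul_apply]
  mul_zero x := ext' fun p => by simp [mul_apply]
  mul_assoc x y z := by
    refine ext' fun p => ?_
    simp only [mul_apply, Finset.sum_mul, Finset.mul_sum, mul_assoc]
    exact sum_antidiagonal_assoc (fun i j k => x i * (y j * z k)) p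

theorem map_mul {S : Type*} [NonUnitalRing S] (f : R →+ S) (hf : ∀ a b, f (a * b) = f a * f b)
    (x y : Ser Γ R) : map f (x * y) = map f x * map f y :=
  ext' fun p => by simp [mul_apply, hf]

end Mul

/-! ### Series in two variables -/

section TwoVariables

/-- The restriction to `s = 1` of a series, where the exponent `(m, j)` stands for the monomial
`(sT) ^ m * T ^ j`. -/
def evalOne [AddCommGroup V] : Ser (ℕ × ℕ) V →+ Ser ℕ V where
  toFun x := ⟨fun k => ∑ p ∈ antidiagonal k, x p⟩
  map_zero' := ext' fun k => by simp
  map_add' x y := ext' fun k => by simp [Finset.sum_add_distrib]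

theorem evalOne_apply [AddCommGroup V] (x : Ser (ℕ × ℕ) V) (k : ℕ) :
    evalOne x k = ∑ p ∈ antidiagonal k, x p := rfl

/-- The restriction to `s = 0` of a series, where the exponent `(m, j)` stands for the monomial
`(sT) ^ m * T ^ j`. -/
def evalZero [AddCommGroup V] : Ser (ℕ × ℕ) V →+ Ser ℕ V where
  toFun x := ⟨fun k => x (0, k)⟩
  map_zero' := rfl
  map_add' _ _ := rfl

@[simp] theorem evalZero_apply [AddCommGroup V] (x : Ser (ℕ × ℕ) V) (k : ℕ) :
    evalZero x k = x (0, k) := rfl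

/-- The Euler derivation `s * d/ds`, where the exponent `(m, j)` stands for the monomial
`(sT) ^ m * T ^ j`. -/
def euler [AddCommGroup V] : Ser (ℕ × ℕ) V →+ Ser (ℕ × ℕ) V where
  toFun x := ⟨fun p => p.1 • x p⟩
  map_zero' := ext' fun k => by simp
  map_add' x y := ext' fun k => by simp

@[simp] theorem euler_apply [AddCommGroup V] (x : Ser (ℕ × ℕ) V) (p : ℕ × ℕ) :
    euler x p = p.1 • x p := rfl

/-- Multiplication by the monomial with exponent `(1, r)`. -/
def shift [AddCommGroup V] (r : ℕ) : Ser (ℕ × ℕ) V →+ Ser (ℕ × ℕ) V where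
  toFun x := ⟨fun p => if (1, r) ≤ p then x (p - (1, r)) else 0⟩
  map_zero' := ext' fun k => by simp
  map_add' x y := ext' fun k => by
    simp only [add_apply]
    split_ifs <;> simp

theorem shift_apply [AddCommGroup V] (r : ℕ) (x : Ser (ℕ × ℕ) V) (p : ℕ × ℕ) :
    shift r x p = if (1, r) ≤ p then x (p - (1, r)) else 0 := rfl

@[simp] theorem shift_add_apply [AddCommGroup V] (r : ℕ) (x : Ser (ℕ × ℕ) V) (p : ℕ × ℕ) :
    shift r x ((1, r) + p) = x p := by
  rw [shift_apply, if_pos le_self_add, add_tsub_cancel_left]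

theorem map_shift [AddCommGroup V] [AddCommGroup W] (f : V →+ W) (r : ℕ) (x : Ser (ℕ × ℕ) V) :
    map f (shift r x) = shift r (map f x) := by
  refine ext' fun p => ?_
  simp only [map_apply, shift_apply]
  split_ifs <;> simp

theorem map_euler [AddCommGroup V] [AddCommGroup W] (f : V →+ W) (x : Ser (ℕ × ℕ) V) :
    map f (euler x) = euler (map f x) :=
  ext' fun p => by simp

variable {R : Type*} [NonUnitalRing R]

theorem euler_mul (x y : Ser (ℕ × ℕ) R) : euler (x * y) = euler x * y + x * euler y := by
  refine ext' fun p => ?_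
  simp only [euler_apply, mul_apply, add_apply, Finset.smul_sum, ← Finset.sum_add_distrib]
  refine Finset.sum_congr rfl fun ij hij => ?_
  rw [← mem_antidiagonal.1 hij, Prod.fst_add, add_smul, smul_mul_assoc, mul_smul_comm]

/-- Multiplying a series by a monomial multiplies by this monomial all sums over antidiagonals in
which the series is the first factor. -/
theorem sum_shift [AddCommGroup V] [AddCommGroup W] (r : ℕ) (x : Ser (ℕ × ℕ) V)
    (f : V → ℕ × ℕ → W) (hf : ∀ q, f 0 q = 0) (p : ℕ × ℕ) :
    ∑ ij ∈ antidiagonal p, f (shift r x ij.1) ij.2 =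
      shift r ⟨fun p => ∑ ij ∈ antidiagonal p, f (x ij.1) ij.2⟩ p := by
  by_cases hp : (1, r) ≤ p
  · obtain ⟨q, rfl⟩ := exists_add_of_le hp
    rw [shift_add_apply]
    symm
    refine Finset.sum_of_injOn (fun ij => ((1, r) + ij.1, ij.2)) ?_ ?_ ?_ ?_
    · intro a _ b _ h
      simp only [Prod.mk.injEq, add_right_inj] at h
      exact Prod.ext h.1 h.2
    · intro a ha
      simp only [Finset.mem_coe, mem_antidiagonal] at ha ⊢
      rw [add_assoc, ha]
    · intro a ha hn
      rw [shift_apply, if_neg, hf]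
      intro hle
      obtain ⟨c, hc⟩ := exists_add_of_le hle
      rw [mem_antidiagonal, hc, add_assoc] at ha
      exact hn ⟨(c, a.2), by simpa using add_left_cancel ha, by simp [← hc]⟩
    · intro a _
      rw [shift_add_apply]
  · rw [shift_apply, if_neg hp]
    refine Finset.sum_eq_zero fun ij hij => ?_
    rw [shift_apply, if_neg, hf]
    rw [mem_antidiagonal] at hij
    exact fun h => hp (h.trans (hij ▸ le_self_add))

theorem shift_mul (r : ℕ) (x y : Ser (ℕ × ℕ) R) : shift r x * y = shift r (x * y) :=
  ext' fun p => sum_shift r x (fun a q => a * y q) (by simp) p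

theorem mul_shift (r : ℕ) (x y : Ser (ℕ × ℕ) R) : x * shift r y = shift r (x * y) := by
  have key : ∀ (z w : Ser (ℕ × ℕ) R) (p : ℕ × ℕ),
      (z * w) p = ∑ ij ∈ antidiagonal p, z ij.2 * w ij.1 := by
    intro z w p
    rw [mul_apply, ← Finset.HasAntidiagonal.map_swap_antidiagonal, Finset.sum_map]
    simp
  have h : x * y = ⟨fun p => ∑ ij ∈ antidiagonal p, x ij.2 * y ij.1⟩ := ext' (key x y)
  refine ext' fun p => ?_
  rw [key, h]
  exact sum_shift r y (fun a q => x q * a) (by simp) p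

theorem evalZero_mul (x y : Ser (ℕ × ℕ) R) : evalZero (x * y) = evalZero x * evalZero y := by
  refine ext' fun k => ?_
  simp only [evalZero_apply, mul_apply]
  symm
  refine Finset.sum_nbij' (fun ij => ((0, ij.1), (0, ij.2))) (fun ij => (ij.1.2, ij.2.2))
    ?_ ?_ ?_ ?_ ?_
  · rintro ⟨i, j⟩ h
    simpa using h
  · rintro ⟨⟨a, i⟩, ⟨b, j⟩⟩ h
    simp only [mem_antidiagonal, Prod.mk_add_mk, Prod.mk.injEq] at h ⊢
    exact h.2
  · rintro ⟨i, j⟩ _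
    rfl
  · rintro ⟨⟨a, i⟩, ⟨b, j⟩⟩ h
    simp only [mem_antidiagonal, Prod.mk_add_mk, Prod.mk.injEq] at h
    obtain rfl : a = 0 := by omega
    obtain rfl : b = 0 := by omega
    rfl
  · intro _ _
    rfl

theorem evalOne_mul (x y : Ser (ℕ × ℕ) R) : evalOne (x * y) = evalOne x * evalOne y := by
  refine ext' fun k => ?_
  simp only [evalOne_apply, mul_apply, Finset.sum_mul_sum]
  simp only [← Finset.sum_product', Finset.sum_sigma']
  refine Finset.sum_nbij' (fun a => ⟨(a.2.1.1 + a.2.1.2, a.2.2.1 + a.2.2.2), a.2⟩)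
    (fun a => ⟨a.2.1 + a.2.2, a.2⟩) ?_ ?_ ?_ ?_ ?_
  · rintro ⟨⟨m, j⟩, ⟨⟨a, b⟩, ⟨c, e⟩⟩⟩ h
    simp only [Finset.mem_sigma, mem_antidiagonal, Prod.mk_add_mk, Prod.mk.injEq,
      Finset.mem_product] at h ⊢
    exact ⟨by omega, trivial, trivial⟩
  · rintro ⟨⟨m, j⟩, ⟨⟨a, b⟩, ⟨c, e⟩⟩⟩ h
    simp only [Finset.mem_sigma, mem_antidiagonal, Prod.mk_add_mk, Finset.mem_product] at h ⊢
    exact ⟨by omega, trivial⟩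
  · rintro ⟨⟨m, j⟩, ⟨⟨a, b⟩, ⟨c, e⟩⟩⟩ h
    simp only [Finset.mem_sigma, mem_antidiagonal, Prod.mk_add_mk, Prod.mk.injEq] at h ⊢
    simp [h.2]
  · rintro ⟨⟨m, j⟩, ⟨⟨a, b⟩, ⟨c, e⟩⟩⟩ h
    simp only [Finset.mem_sigma, mem_antidiagonal, Finset.mem_product] at h ⊢
    simp [h.2]
  · intro _ _
    rfl

end TwoVariables

end Ser

/-! ### Sums over words in the coefficients of a series -/

section WordSum

variable {A V W : Type*}

/-- The total degree of the second half of a decomposition drops if the first half is nonzero. -/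
theorem weight_lt {γ : ℕ × ℕ} {pq : (ℕ × ℕ) × (ℕ × ℕ)}
    (h : pq ∈ (antidiagonal γ).filter (·.1 ≠ 0)) : pq.2.1 + pq.2.2 < γ.1 + γ.2 := by
  obtain ⟨⟨a, b⟩, ⟨c, e⟩⟩ := pq
  simp only [Finset.mem_filter, mem_antidiagonal, ne_eq, Prod.ext_iff, Prod.fst_add,
    Prod.snd_add, Prod.fst_zero, Prod.snd_zero] at h ⊢
  omega

/-- The sum of `φ [x p₁, …, x pₗ]` over all `l` and all `l`-tuples of nonzero exponents with
`p₁ + ⋯ + pₗ = γ`. If `φ` is additive in each letter, this is the coefficient at `γ` of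
`∑ l, φ [x, …, x]`. -/
def wordSum [AddCommMonoid V] (x : Ser (ℕ × ℕ) A) (φ : List A → V) (γ : ℕ × ℕ) : V :=
  (if γ = 0 then φ [] else 0) +
    ∑ pq : {pq // pq ∈ (antidiagonal γ).filter (·.1 ≠ 0)},
      wordSum x (fun L => φ (x pq.1.1 :: L)) pq.1.2
termination_by γ.1 + γ.2
decreasing_by exact weight_lt pq.2

theorem wordSum_eq [AddCommMonoid V] (x : Ser (ℕ × ℕ) A) (φ : List A → V) (γ : ℕ × ℕ) :
    wordSum x φ γ = (if γ = 0 then φ [] else 0) +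
      ∑ pq ∈ (antidiagonal γ).filter (·.1 ≠ 0), wordSum x (fun L => φ (x pq.1 :: L)) pq.2 := by
  rw [wordSum]
  congr 1
  exact Finset.sum_coe_sort _ fun pq : (ℕ × ℕ) × (ℕ × ℕ) =>
    wordSum x (fun L => φ (x pq.1 :: L)) pq.2

/-- The sum of `φ [y p₁, …, y pₖ, h p, x q₁, …, x qₗ]` over all `k` and `l`, all nonzero exponents
`pᵢ` and `qᵢ` and all exponents `p`, such that the sum of all exponents is `γ`. -/
def wordSum₂ [AddCommMonoid V] (y h x : Ser (ℕ × ℕ) A) (φ : List A → V) (γ : ℕ × ℕ) : V :=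
  ∑ pq ∈ antidiagonal γ, wordSum x (fun L => φ (h pq.1 :: L)) pq.2 +
    ∑ pq : {pq // pq ∈ (antidiagonal γ).filter (·.1 ≠ 0)},
      wordSum₂ y h x (fun L => φ (y pq.1.1 :: L)) pq.1.2
termination_by γ.1 + γ.2
decreasing_by exact weight_lt pq.2

theorem wordSum₂_eq [AddCommMonoid V] (y h x : Ser (ℕ × ℕ) A) (φ : List A → V) (γ : ℕ × ℕ) :
    wordSum₂ y h x φ γ =
      ∑ pq ∈ antidiagonal γ, wordSum x (fun L => φ (h pq.1 :: L)) pq.2 +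
      ∑ pq ∈ (antidiagonal γ).filter (·.1 ≠ 0), wordSum₂ y h x (fun L => φ (y pq.1 :: L)) pq.2 := by
  rw [wordSum₂]
  congr 1
  exact Finset.sum_coe_sort _ fun pq : (ℕ × ℕ) × (ℕ × ℕ) =>
    wordSum₂ y h x (fun L => φ (y pq.1 :: L)) pq.2

/-- Induction on the total degree of an exponent. -/
theorem weight_induction {P : ℕ × ℕ → Prop}
    (h : ∀ γ, (∀ δ, δ.1 + δ.2 < γ.1 + γ.2 → P δ) → P γ) (γ : ℕ × ℕ) : P γ :=
  (measure fun γ : ℕ × ℕ => γ.1 + γ.2).wf.induction γ h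

theorem weight_snd_le {γ : ℕ × ℕ} {pq : (ℕ × ℕ) × (ℕ × ℕ)} (h : pq ∈ antidiagonal γ) :
    pq.2.1 + pq.2.2 ≤ γ.1 + γ.2 := by
  rw [mem_antidiagonal] at h
  rw [← h, Prod.fst_add, Prod.snd_add]
  omega

theorem weight_fst_le {γ : ℕ × ℕ} {pq : (ℕ × ℕ) × (ℕ × ℕ)} (h : pq ∈ antidiagonal γ) :
    pq.1.1 + pq.1.2 ≤ γ.1 + γ.2 := by
  rw [mem_antidiagonal] at h
  rw [← h, Prod.fst_add, Prod.snd_add]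
  omega

theorem mem_of_filter {γ : ℕ × ℕ} {pq : (ℕ × ℕ) × (ℕ × ℕ)}
    (h : pq ∈ (antidiagonal γ).filter (·.1 ≠ 0)) : pq ∈ antidiagonal γ :=
  (Finset.mem_filter.1 h).1

section AddCommMonoid

variable [AddCommMonoid V] [AddCommMonoid W]

@[simp] theorem wordSum_zero_right (x : Ser (ℕ × ℕ) A) (φ : List A → V) :
    wordSum x φ 0 = φ [] := by
  rw [wordSum_eq, Finset.sum_eq_zero, if_pos rfl, add_zero]
  intro pq hpq
  exact absurd (weight_lt hpq) (by simp)

theorem map_wordSum (f : V →+ W) (x : Ser (ℕ × ℕ) A) (φ : List A → V) (γ : ℕ × ℕ) :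
    f (wordSum x φ γ) = wordSum x (fun L => f (φ L)) γ := by
  induction γ using weight_induction generalizing φ with
  | h γ ih =>
    rw [wordSum_eq, wordSum_eq x (fun L => f (φ L)), map_add, map_sum]
    congr 1
    · split_ifs <;> simp
    · exact Finset.sum_congr rfl fun pq hpq => ih _ (weight_lt hpq) _

theorem map_wordSum₂ (f : V →+ W) (y h x : Ser (ℕ × ℕ) A) (φ : List A → V) (γ : ℕ × ℕ) :
    f (wordSum₂ y h x φ γ) = wordSum₂ y h x (fun L => f (φ L)) γ := by
  induction γ using weight_induction generalizing φ with
  | h γ ih =>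
    rw [wordSum₂_eq, wordSum₂_eq y h x (fun L => f (φ L)), map_add, map_sum, map_sum]
    congr 1
    · exact Finset.sum_congr rfl fun pq hpq => map_wordSum f x _ _
    · exact Finset.sum_congr rfl fun pq hpq => ih _ (weight_lt hpq) _

theorem wordSum_zero (x : Ser (ℕ × ℕ) A) (γ : ℕ × ℕ) :
    wordSum x (fun _ => (0 : V)) γ = 0 :=
  (map_wordSum (0 : V →+ V) x (fun _ => 0) γ).symm

theorem wordSum₂_zero (y h x : Ser (ℕ × ℕ) A) (γ : ℕ × ℕ) :
    wordSum₂ y h x (fun _ => (0 : V)) γ = 0 :=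
  (map_wordSum₂ (0 : V →+ V) y h x (fun _ => 0) γ).symm

theorem wordSum_add (x : Ser (ℕ × ℕ) A) (φ ψ : List A → V) (γ : ℕ × ℕ) :
    wordSum x (fun L => φ L + ψ L) γ = wordSum x φ γ + wordSum x ψ γ := by
  induction γ using weight_induction generalizing φ ψ with
  | h γ ih =>
    rw [wordSum_eq, wordSum_eq x φ, wordSum_eq x ψ, add_add_add_comm, ← Finset.sum_add_distrib]
    congr 1
    · split_ifs <;> simp
    · exact Finset.sum_congr rfl fun pq hpq => ih _ (weight_lt hpq) _ _

theorem wordSum₂_add (y h x : Ser (ℕ × ℕ) A) (φ ψ : List A → V) (γ : ℕ × ℕ) :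
    wordSum₂ y h x (fun L => φ L + ψ L) γ = wordSum₂ y h x φ γ + wordSum₂ y h x ψ γ := by
  induction γ using weight_induction generalizing φ ψ with
  | h γ ih =>
    rw [wordSum₂_eq, wordSum₂_eq y h x φ, wordSum₂_eq y h x ψ, add_add_add_comm,
      ← Finset.sum_add_distrib, ← Finset.sum_add_distrib]
    congr 1
    · exact Finset.sum_congr rfl fun pq hpq => wordSum_add x _ _ _
    · exact Finset.sum_congr rfl fun pq hpq => ih _ (weight_lt hpq) _ _

/-- A word sum only involves words in the coefficients at exponents of bounded total degree, and
the functional may be replaced by one that has the same values on the words of a given kind. -/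
theorem wordSum_congr {x x' : Ser (ℕ × ℕ) A} {φ ψ : List A → V} {P : A → Prop} {γ : ℕ × ℕ}
    (hx : ∀ p : ℕ × ℕ, p.1 + p.2 ≤ γ.1 + γ.2 → x p = x' p) (hP : ∀ p, P (x p))
    (h : ∀ L : List A, (∀ b ∈ L, P b) → φ L = ψ L) : wordSum x φ γ = wordSum x' ψ γ := by
  induction γ using weight_induction generalizing φ ψ with
  | h γ ih =>
    rw [wordSum_eq, wordSum_eq x' ψ, h [] (by simp)]
    congr 1
    refine Finset.sum_congr rfl fun pq hpq => ?_
    rw [← hx _ (weight_fst_le (mem_of_filter hpq))]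
    refine ih _ (weight_lt hpq) (fun p hp => hx p (hp.trans (weight_lt hpq).le)) fun L hL => ?_
    exact h _ (List.forall_mem_cons.2 ⟨hP _, hL⟩)

theorem wordSum_congr_left {x x' : Ser (ℕ × ℕ) A} {φ : List A → V} {γ : ℕ × ℕ}
    (hx : ∀ p : ℕ × ℕ, p.1 + p.2 ≤ γ.1 + γ.2 → x p = x' p) : wordSum x φ γ = wordSum x' φ γ :=
  wordSum_congr (P := fun _ => True) hx (fun _ => trivial) fun _ _ => rfl

theorem wordSum_congr_right {x : Ser (ℕ × ℕ) A} {φ ψ : List A → V} {γ : ℕ × ℕ} {P : A → Prop}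
    (hP : ∀ p, P (x p)) (h : ∀ L : List A, (∀ b ∈ L, P b) → φ L = ψ L) :
    wordSum x φ γ = wordSum x ψ γ :=
  wordSum_congr (fun _ _ => rfl) hP h

theorem wordSum₂_congr {y h h' x : Ser (ℕ × ℕ) A} {φ ψ : List A → V} {P : A → Prop}
    {γ : ℕ × ℕ} (hh : ∀ p : ℕ × ℕ, p.1 + p.2 ≤ γ.1 + γ.2 → h p = h' p) (hPy : ∀ p, P (y p))
    (hPh : ∀ p, P (h p)) (hPx : ∀ p, P (x p))
    (hφ : ∀ L : List A, (∀ b ∈ L, P b) → φ L = ψ L) :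
    wordSum₂ y h x φ γ = wordSum₂ y h' x ψ γ := by
  induction γ using weight_induction generalizing φ ψ with
  | h γ ih =>
    rw [wordSum₂_eq, wordSum₂_eq y h' x ψ]
    congr 1
    · refine Finset.sum_congr rfl fun pq hpq => ?_
      rw [← hh _ (weight_fst_le hpq)]
      exact wordSum_congr_right hPx fun L hL => hφ _ (List.forall_mem_cons.2 ⟨hPh _, hL⟩)
    · refine Finset.sum_congr rfl fun pq hpq => ?_
      refine ih _ (weight_lt hpq) (fun p hp => hh p (hp.trans (weight_lt hpq).le)) fun L hL => ?_
      exact hφ _ (List.forall_mem_cons.2 ⟨hPy _, hL⟩)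

theorem wordSum₂_congr_middle {y h h' x : Ser (ℕ × ℕ) A} {φ : List A → V} {γ : ℕ × ℕ}
    (hh : ∀ p : ℕ × ℕ, p.1 + p.2 ≤ γ.1 + γ.2 → h p = h' p) :
    wordSum₂ y h x φ γ = wordSum₂ y h' x φ γ :=
  wordSum₂_congr (P := fun _ => True) hh (fun _ => trivial) (fun _ => trivial)
    (fun _ => trivial) fun _ _ => rfl

end AddCommMonoid

theorem wordSum_sub [AddCommGroup V] (x : Ser (ℕ × ℕ) A) (φ ψ : List A → V) (γ : ℕ × ℕ) :
    wordSum x (fun L => φ L - ψ L) γ = wordSum x φ γ - wordSum x ψ γ := by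
  rw [eq_sub_iff_add_eq, ← wordSum_add]
  simp

theorem wordSum₂_sub [AddCommGroup V] (y h x : Ser (ℕ × ℕ) A) (φ ψ : List A → V) (γ : ℕ × ℕ) :
    wordSum₂ y h x (fun L => φ L - ψ L) γ = wordSum₂ y h x φ γ - wordSum₂ y h x ψ γ := by
  rw [eq_sub_iff_add_eq, ← wordSum₂_add]
  simp

theorem wordSum_map {B : Type*} [AddCommMonoid V] (f : A → B) (x : Ser (ℕ × ℕ) A)
    (φ : List B → V) (γ : ℕ × ℕ) :
    wordSum ⟨fun p => f (x p)⟩ φ γ = wordSum x (fun L => φ (L.map f)) γ := by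
  induction γ using weight_induction generalizing φ with
  | h γ ih =>
    rw [wordSum_eq, wordSum_eq x]
    congr 1
    exact Finset.sum_congr rfl fun pq hpq => ih _ (weight_lt hpq) _

section Series

variable [AddCommGroup V]

/-- The series of word sums `∑ l, φ [x, …, x]`. -/
def wordSer (x : Ser (ℕ × ℕ) A) (φ : List A → V) : Ser (ℕ × ℕ) V := ⟨wordSum x φ⟩

/-- The series of word sums `∑ k, ∑ l, φ [y, …, y, h, x, …, x]`. -/
def wordSer₂ (y h x : Ser (ℕ × ℕ) A) (φ : List A → V) : Ser (ℕ × ℕ) V := ⟨wordSum₂ y h x φ⟩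

@[simp] theorem wordSer_apply (x : Ser (ℕ × ℕ) A) (φ : List A → V) (γ : ℕ × ℕ) :
    wordSer x φ γ = wordSum x φ γ := rfl

@[simp] theorem wordSer₂_apply (y h x : Ser (ℕ × ℕ) A) (φ : List A → V) (γ : ℕ × ℕ) :
    wordSer₂ y h x φ γ = wordSum₂ y h x φ γ := rfl

/-- A functional that is supported on the empty word. -/
theorem wordSum_ite_nil (x : Ser (ℕ × ℕ) A) (v : V) (γ : ℕ × ℕ) :
    wordSum x (fun L => if L = [] then v else 0) γ = if γ = 0 then v else 0 := by
  rw [wordSum_eq]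
  simp [wordSum_zero]

theorem wordSum₂_ite_nil (y h x : Ser (ℕ × ℕ) A) (v : V) (γ : ℕ × ℕ) :
    wordSum₂ y h x (fun L => if L = [] then v else 0) γ = 0 := by
  rw [wordSum₂_eq]
  simp [wordSum_zero, wordSum₂_zero]

end Series

end WordSum

/-! ### Functionals that are additive in each letter -/

section MultiAdd

variable {A V : Type*} [AddCommGroup A] [AddCommGroup V]

/-- A function of words is additive in each letter. -/
def MultiAdd (φ : List A → V) : Prop :=
  ∀ (L₁ L₂ : List A) (b c : A), φ (L₁ ++ (b + c) :: L₂) = φ (L₁ ++ b :: L₂) + φ (L₁ ++ c :: L₂)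

namespace MultiAdd

variable {φ : List A → V}

theorem cons (hφ : MultiAdd φ) (b : A) : MultiAdd fun L => φ (b :: L) :=
  fun L₁ L₂ c e => hφ (b :: L₁) L₂ c e

/-- The value as an additive function of the first letter. -/
def head (hφ : MultiAdd φ) (L : List A) : A →+ V := AddMonoidHom.mk' (fun b => φ (b :: L)) (hφ [] L)

theorem cons_add (hφ : MultiAdd φ) (b c : A) (L : List A) :
    φ ((b + c) :: L) = φ (b :: L) + φ (c :: L) :=
  hφ [] L b c

theorem cons_neg (hφ : MultiAdd φ) (b : A) (L : List A) : φ (-b :: L) = -φ (b :: L) :=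
  map_neg (hφ.head L) b

/-- A word sum as an additive function of an additional first letter. -/
def headSum (hφ : MultiAdd φ) (x : Ser (ℕ × ℕ) A) (γ : ℕ × ℕ) : A →+ V :=
  AddMonoidHom.mk' (fun b => wordSum x (fun L => φ (b :: L)) γ) fun b c => by
    simp only [hφ.cons_add, wordSum_add]

theorem headSum_apply (hφ : MultiAdd φ) (x : Ser (ℕ × ℕ) A) (γ : ℕ × ℕ) (b : A) :
    hφ.headSum x γ b = wordSum x (fun L => φ (b :: L)) γ := rfl

/-- A word sum with a distinguished letter as an additive function of an additional first letter. -/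
def headSum₂ (hφ : MultiAdd φ) (y h x : Ser (ℕ × ℕ) A) (γ : ℕ × ℕ) : A →+ V :=
  AddMonoidHom.mk' (fun b => wordSum₂ y h x (fun L => φ (b :: L)) γ) fun b c => by
    simp only [hφ.cons_add, wordSum₂_add]

theorem headSum₂_apply (hφ : MultiAdd φ) (y h x : Ser (ℕ × ℕ) A) (γ : ℕ × ℕ) (b : A) :
    hφ.headSum₂ y h x γ b = wordSum₂ y h x (fun L => φ (b :: L)) γ := rfl

end MultiAdd

/-- Summands with a zero first factor may be left out. -/
theorem sum_filter_ne_zero (γ : ℕ × ℕ) (f : ℕ × ℕ → ℕ × ℕ → V)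
    (hf : ∀ q, f 0 q = 0) :
    ∑ pq ∈ (antidiagonal γ).filter (·.1 ≠ 0), f pq.1 pq.2 =
      ∑ pq ∈ antidiagonal γ, f pq.1 pq.2 := by
  refine Finset.sum_filter_of_ne fun pq _ h h0 => h ?_
  rw [h0, hf]

namespace MultiAdd

variable {φ : List A → V}

theorem wordSum₂_add_middle (hφ : MultiAdd φ) (y h h' x : Ser (ℕ × ℕ) A) (γ : ℕ × ℕ) :
    wordSum₂ y (h + h') x φ γ = wordSum₂ y h x φ γ + wordSum₂ y h' x φ γ := by
  induction γ using weight_induction generalizing φ with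
  | h γ ih =>
    rw [wordSum₂_eq, wordSum₂_eq y h, wordSum₂_eq y h', add_add_add_comm,
      ← Finset.sum_add_distrib, ← Finset.sum_add_distrib]
    congr 1
    · refine Finset.sum_congr rfl fun pq _ => ?_
      exact map_add (hφ.headSum x pq.2) _ _
    · exact Finset.sum_congr rfl fun pq hpq => ih _ (weight_lt hpq) (hφ.cons _)

theorem wordSum₂_zero_middle (hφ : MultiAdd φ) (y x : Ser (ℕ × ℕ) A) (γ : ℕ × ℕ) :
    wordSum₂ y 0 x φ γ = 0 := by
  have h := hφ.wordSum₂_add_middle y 0 0 x γ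
  rwa [add_zero, left_eq_add] at h

/-- The difference of two word sums telescopes. -/
theorem wordSum_sub_wordSum (hφ : MultiAdd φ) (y x : Ser (ℕ × ℕ) A) (γ : ℕ × ℕ) (h0 : y 0 = x 0) :
    wordSum y φ γ - wordSum x φ γ = wordSum₂ y (y - x) x φ γ := by
  induction γ using weight_induction generalizing φ with
  | h γ ih =>
    rw [wordSum_eq, wordSum_eq x, wordSum₂_eq, add_sub_add_left_eq_sub,
      ← Finset.sum_sub_distrib, ← sum_filter_ne_zero γ fun p q =>
        wordSum x (fun L => φ ((y - x) p :: L)) q,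
      ← Finset.sum_add_distrib]
    · refine Finset.sum_congr rfl fun pq hpq => ?_
      rw [← ih _ (weight_lt hpq) (hφ.cons _)]
      have h := map_sub (hφ.headSum x pq.2) (y pq.1) (x pq.1)
      simp only [headSum_apply] at h
      rw [Ser.sub_apply, h]
      abel
    · intro q
      rw [Ser.sub_apply, h0, sub_self]
      exact map_zero (hφ.headSum x q)

end MultiAdd

end MultiAdd

/-! ### The transpose of the bar differential -/

section BarDifferential

variable {A V : Type*} [NonUnitalRing A] [AddCommGroup V]

/-- The part of the bar differential that multiplies `b` with the first letter of a word. -/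
def mergeHead (φ : List A → V) (b : A) : List A → V
  | [] => 0
  | c :: L => φ (b * c :: L)

/-- The composition of a functional `φ` on words with the bar differential. The signs
are introduced by the map `σ`, which is meant to be `b ↦ (-1) ^ (|b| + 1) b`. -/
def barD (D σ : A → A) : (List A → V) → List A → V
  | _, [] => 0
  | φ, b :: L => φ (D b :: L) + mergeHead φ (σ b) L + barD D σ (fun L => φ (σ b :: L)) L

/-- The product `± φ [b₁, …, bₗ₋₁] * bₗ`, with the same convention on signs as in `barD`. -/
def lastMul (σ : A → A) : (List A → A) → List A → A
  | _, [] => 0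
  | φ, b :: L => (if L = [] then φ [] * b else 0) + lastMul σ (fun L => φ (σ b :: L)) L

/-- The product `± b₁ * φ [b₂, …, bₗ]`, with the same convention on signs as in `barD`. -/
def firstMul (σ : A → A) (φ : List A → A) : List A → A
  | [] => 0
  | b :: L => σ b * φ L

theorem wordSum_mergeHead {φ : List A → V} (hφ : MultiAdd φ) {x : Ser (ℕ × ℕ) A} (hx : x 0 = 0)
    (b : A) (γ : ℕ × ℕ) :
    wordSum x (mergeHead φ b) γ = ∑ pq ∈ antidiagonal γ, hφ.headSum x pq.2 (b * x pq.1) := by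
  rw [wordSum_eq, ← sum_filter_ne_zero γ fun p q => hφ.headSum x q (b * x p)]
  · simp [mergeHead, MultiAdd.headSum_apply]
  · simp [hx]

theorem wordSum₂_mergeHead {φ : List A → V} (hφ : MultiAdd φ) {y : Ser (ℕ × ℕ) A} (hy : y 0 = 0)
    (h x : Ser (ℕ × ℕ) A) (b : A) (γ : ℕ × ℕ) :
    wordSum₂ y h x (mergeHead φ b) γ = ∑ pq ∈ antidiagonal γ, hφ.headSum x pq.2 (b * h pq.1) +
      ∑ pq ∈ antidiagonal γ, hφ.headSum₂ y h x pq.2 (b * y pq.1) := by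
  rw [wordSum₂_eq, ← sum_filter_ne_zero γ fun p q => hφ.headSum₂ y h x q (b * y p)]
  · simp [mergeHead, MultiAdd.headSum_apply, MultiAdd.headSum₂_apply]
  · simp [hy]

/-- A sum over products of coefficients is a sum over the coefficients of the product. -/
theorem sum_sum_mul (f : ℕ × ℕ → A →+ V) (x y : Ser (ℕ × ℕ) A) (γ : ℕ × ℕ) :
    ∑ pq ∈ antidiagonal γ, ∑ kl ∈ antidiagonal pq.2, f kl.2 (x pq.1 * y kl.1) =
      ∑ pq ∈ antidiagonal γ, f pq.2 ((x * y) pq.1) := by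
  simp only [Ser.mul_apply, map_sum]
  exact (Ser.sum_antidiagonal_assoc (fun i j k => f k (x i * y j)) γ).symm

/-- The bar differential acts on the words `[x, …, x]` through the curvature of `x`. -/
theorem wordSum_barD {D : A →+ A} {σ : A → A} {φ : List A → V} (hφ : MultiAdd φ)
    {x : Ser (ℕ × ℕ) A} (hx : x 0 = 0) (hσ : ∀ p, σ (x p) = x p) (γ : ℕ × ℕ) :
    wordSum x (barD D σ φ) γ = wordSum₂ x (Ser.map D x + x * x) x φ γ := by
  induction γ using weight_induction generalizing φ with
  | h γ ih =>
    have key : ∀ pq ∈ (antidiagonal γ).filter (·.1 ≠ 0),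
        wordSum x (fun L => barD D σ φ (x pq.1 :: L)) pq.2 =
          (hφ.headSum x pq.2 (D (x pq.1)) + wordSum x (mergeHead φ (x pq.1)) pq.2) +
          wordSum₂ x (Ser.map D x + x * x) x (fun L => φ (x pq.1 :: L)) pq.2 := by
      intro pq hpq
      rw [← ih _ (weight_lt hpq) (hφ.cons _)]
      simp only [barD, wordSum_add, hσ]
      rfl
    rw [wordSum_eq, Finset.sum_congr rfl key, Finset.sum_add_distrib, wordSum₂_eq, ← add_assoc]
    congr 1
    rw [sum_filter_ne_zero γ fun p q => hφ.headSum x q (D (x p)) + wordSum x (mergeHead φ (x p)) q]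
    · simp only [barD, ite_self, zero_add, wordSum_mergeHead hφ hx, Finset.sum_add_distrib]
      rw [sum_sum_mul, ← Finset.sum_add_distrib]
      refine Finset.sum_congr rfl fun pq _ => ?_
      rw [← map_add]
      rfl
    · intro q
      simp [hx, wordSum_mergeHead hφ hx]

theorem wordSum_barD_of_twisting {D : A →+ A} {σ : A → A} {φ : List A → V} (hφ : MultiAdd φ)
    {x : Ser (ℕ × ℕ) A} (hx : x 0 = 0) (hσ : ∀ p, σ (x p) = x p) (hc : Ser.map D x + x * x = 0)
    (γ : ℕ × ℕ) : wordSum x (barD D σ φ) γ = 0 := by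
  rw [wordSum_barD hφ hx hσ, hc, hφ.wordSum₂_zero_middle]

/-- For twisting elements `x` and `y` the bar differential acts on the words
`[y, …, y, h, x, …, x]` through the twisted differential of `h`. -/
theorem wordSum₂_barD {D : A →+ A} {σ : A → A} {φ : List A → V} (hφ : MultiAdd φ)
    {y h x : Ser (ℕ × ℕ) A} (hy : y 0 = 0) (hx : x 0 = 0) (hσy : ∀ p, σ (y p) = y p)
    (hσx : ∀ p, σ (x p) = x p) (hσh : ∀ p, σ (h p) = -h p) (hcy : Ser.map D y + y * y = 0)
    (hcx : Ser.map D x + x * x = 0) (γ : ℕ × ℕ) :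
    wordSum₂ y h x (barD D σ φ) γ = wordSum₂ y (Ser.map D h + y * h - h * x) x φ γ := by
  induction γ using weight_induction generalizing φ with
  | h γ ih =>
    have key₁ : ∀ pq ∈ antidiagonal γ,
        wordSum x (fun L => barD D σ φ (h pq.1 :: L)) pq.2 =
          hφ.headSum x pq.2 (D (h pq.1)) +
            ∑ kl ∈ antidiagonal pq.2, hφ.headSum x kl.2 ((-h) pq.1 * x kl.1) := by
      intro pq _
      simp only [barD, wordSum_add, hσh]
      rw [wordSum_barD_of_twisting (hφ.cons _) hx hσx hcx, wordSum_mergeHead hφ hx, add_zero]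
      rfl
    have key₂ : ∀ pq ∈ (antidiagonal γ).filter (·.1 ≠ 0),
        wordSum₂ y h x (fun L => barD D σ φ (y pq.1 :: L)) pq.2 =
          (hφ.headSum₂ y h x pq.2 (D (y pq.1)) + wordSum₂ y h x (mergeHead φ (y pq.1)) pq.2) +
          wordSum₂ y (Ser.map D h + y * h - h * x) x (fun L => φ (y pq.1 :: L)) pq.2 := by
      intro pq hpq
      rw [← ih _ (weight_lt hpq) (hφ.cons _)]
      simp only [barD, wordSum₂_add, hσy]
      rfl
    rw [wordSum₂_eq, Finset.sum_congr rfl key₁, Finset.sum_congr rfl key₂, Finset.sum_add_distrib,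
      wordSum₂_eq y (Ser.map D h + y * h - h * x), Finset.sum_add_distrib, ← add_assoc]
    congr 1
    rw [sum_filter_ne_zero γ fun p q =>
      hφ.headSum₂ y h x q (D (y p)) + wordSum₂ y h x (mergeHead φ (y p)) q]
    · simp only [wordSum₂_mergeHead hφ hy, Finset.sum_add_distrib]
      have hcy' : ∀ p, D (y p) + (y * y) p = 0 := fun p =>
        congrArg (fun z : Ser (ℕ × ℕ) A => z p) hcy
      rw [sum_sum_mul, sum_sum_mul, sum_sum_mul (fun q => hφ.headSum₂ y h x q)]
      have h₀ : ∑ pq ∈ antidiagonal γ, hφ.headSum₂ y h x pq.2 (D (y pq.1)) +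
          ∑ pq ∈ antidiagonal γ, hφ.headSum₂ y h x pq.2 ((y * y) pq.1) = 0 := by
        rw [← Finset.sum_add_distrib]
        exact Finset.sum_eq_zero fun pq _ => by rw [← map_add, hcy', map_zero]
      have h₁ : ∀ a b c e : V, a + e = 0 → b + (a + (c + e)) = b + c := by
        intro a b c e h
        rw [add_left_comm a, h, add_zero]
      rw [h₁ _ _ _ _ h₀, ← Finset.sum_add_distrib, ← Finset.sum_add_distrib]
      refine Finset.sum_congr rfl fun pq _ => ?_
      rw [← map_add, ← map_add]
      change hφ.headSum x pq.2 _ = hφ.headSum x pq.2 _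
      congr 1
      rw [neg_mul]
      simp only [Ser.sub_apply, Ser.add_apply, Ser.neg_apply, Ser.map_apply]
      abel
    · intro q
      simp [hy, wordSum₂_mergeHead hφ hy]

theorem wordSer_firstMul {σ : A → A} {φ : List A → A} {x : Ser (ℕ × ℕ) A} (hx : x 0 = 0)
    (hσ : ∀ p, σ (x p) = x p) : wordSer x (firstMul σ φ) = x * wordSer x φ := by
  refine Ser.ext' fun γ => ?_
  rw [wordSer_apply, wordSum_eq, Ser.mul_apply,
    ← sum_filter_ne_zero γ fun p q => x p * wordSer x φ q]
  · simp only [firstMul, hσ, ite_self, zero_add]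
    exact Finset.sum_congr rfl fun pq _ =>
      (map_wordSum (AddMonoidHom.mulLeft (x pq.1)) x φ pq.2).symm
  · simp [hx]

theorem wordSer₂_firstMul {σ : A → A} {φ : List A → A} {y h x : Ser (ℕ × ℕ) A} (hy : y 0 = 0)
    (hσy : ∀ p, σ (y p) = y p) (hσh : ∀ p, σ (h p) = -h p) :
    wordSer₂ y h x (firstMul σ φ) = y * wordSer₂ y h x φ - h * wordSer x φ := by
  refine Ser.ext' fun γ => ?_
  rw [wordSer₂_apply, wordSum₂_eq, Ser.sub_apply, Ser.mul_apply, Ser.mul_apply, sub_eq_neg_add,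
    ← Finset.sum_neg_distrib, ← sum_filter_ne_zero γ fun p q => y p * wordSer₂ y h x φ q]
  · simp only [firstMul, hσy, hσh]
    congr 1
    · refine Finset.sum_congr rfl fun pq _ => ?_
      rw [← neg_mul]
      exact (map_wordSum (AddMonoidHom.mulLeft (-h pq.1)) x φ pq.2).symm
    · exact Finset.sum_congr rfl fun pq _ =>
        (map_wordSum₂ (AddMonoidHom.mulLeft (y pq.1)) y h x φ pq.2).symm
  · simp [hy]

/-- Reassociation of the sum that arises by expanding a product of a word sum with a series. -/
theorem sum_filter_mul {R : Type*} [NonUnitalRing R] (γ : ℕ × ℕ) (f : ℕ × ℕ → ℕ × ℕ → R)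
    (y : Ser (ℕ × ℕ) R) (hf : ∀ q, f 0 q = 0) :
    ∑ pq ∈ (antidiagonal γ).filter (·.1 ≠ 0), ∑ kl ∈ antidiagonal pq.2, f pq.1 kl.1 * y kl.2 =
      ∑ pq ∈ antidiagonal γ,
        (∑ kl ∈ (antidiagonal pq.1).filter (·.1 ≠ 0), f kl.1 kl.2) * y pq.2 := by
  rw [sum_filter_ne_zero γ fun p q => ∑ kl ∈ antidiagonal q, f p kl.1 * y kl.2]
  · simp only [sum_filter_ne_zero _ f hf, Finset.sum_mul]
    exact (Ser.sum_antidiagonal_assoc (fun i j k => f i j * y k) γ).symm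
  · simp [hf]

theorem sum_antidiagonal_ite {R : Type*} [NonUnitalRing R] (γ : ℕ × ℕ) (v : R)
    (y : Ser (ℕ × ℕ) R) :
    ∑ pq ∈ antidiagonal γ, (if pq.1 = 0 then v else 0) * y pq.2 = v * y γ := by
  rw [Finset.sum_eq_single (0, γ)]
  · simp
  · rintro ⟨p, q⟩ hpq hne
    rw [if_neg, zero_mul]
    rintro rfl
    rw [mem_antidiagonal, zero_add] at hpq
    exact hne (Prod.ext rfl hpq)
  · simp

theorem sum_antidiagonal_ite' (γ : ℕ × ℕ) (f : ℕ × ℕ → V) :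
    ∑ pq ∈ antidiagonal γ, (if pq.2 = 0 then f pq.1 else 0) = f γ := by
  rw [Finset.sum_eq_single (γ, 0)]
  · simp
  · rintro ⟨p, q⟩ hpq hne
    rw [if_neg]
    rintro rfl
    rw [mem_antidiagonal, add_zero] at hpq
    exact hne (Prod.ext hpq rfl)
  · simp

/-- A product of a word sum with a series, expanded at the first letter. -/
theorem wordSer_mul_apply {R : Type*} [NonUnitalRing R] {φ : List A → R} (hφ : MultiAdd φ)
    {x : Ser (ℕ × ℕ) A} (hx : x 0 = 0) (y : Ser (ℕ × ℕ) R) (γ : ℕ × ℕ) :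
    (wordSer x φ * y) γ = φ [] * y γ + ∑ pq ∈ (antidiagonal γ).filter (·.1 ≠ 0),
      (wordSer x (fun L => φ (x pq.1 :: L)) * y) pq.2 := by
  simp only [Ser.mul_apply, wordSer_apply]
  rw [sum_filter_mul γ (fun p q => wordSum x (fun L => φ (x p :: L)) q) y]
  · rw [← sum_antidiagonal_ite, ← Finset.sum_add_distrib]
    refine Finset.sum_congr rfl fun pq _ => ?_
    rw [← add_mul, ← wordSum_eq]
  · intro q
    rw [hx]
    exact map_zero (hφ.headSum x q)

theorem wordSum_lastMul {σ : A → A} {φ : List A → A} (hφ : MultiAdd φ) {x : Ser (ℕ × ℕ) A}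
    (hx : x 0 = 0) (hσ : ∀ p, σ (x p) = x p) (γ : ℕ × ℕ) :
    wordSum x (lastMul σ φ) γ = (wordSer x φ * x) γ := by
  induction γ using weight_induction generalizing φ with
  | h γ ih =>
    rw [wordSer_mul_apply hφ hx, wordSum_eq]
    have key : ∀ pq ∈ (antidiagonal γ).filter (·.1 ≠ 0),
        wordSum x (fun L => lastMul σ φ (x pq.1 :: L)) pq.2 =
          (if pq.2 = 0 then φ [] * x pq.1 else 0) +
            (wordSer x (fun L => φ (x pq.1 :: L)) * x) pq.2 := by
      intro pq hpq
      simp only [lastMul, wordSum_add, hσ, wordSum_ite_nil]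
      rw [ih _ (weight_lt hpq) (hφ.cons _)]
    rw [Finset.sum_congr rfl key, Finset.sum_add_distrib, ← add_assoc]
    congr 1
    rw [sum_filter_ne_zero γ fun p q => if q = 0 then φ [] * x p else 0,
      sum_antidiagonal_ite' γ fun p => φ [] * x p]
    · simp [lastMul]
    · simp [hx]

theorem wordSer_lastMul {σ : A → A} {φ : List A → A} (hφ : MultiAdd φ) {x : Ser (ℕ × ℕ) A}
    (hx : x 0 = 0) (hσ : ∀ p, σ (x p) = x p) : wordSer x (lastMul σ φ) = wordSer x φ * x :=
  Ser.ext' (wordSum_lastMul hφ hx hσ)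

theorem wordSum₂_lastMul {σ : A → A} {φ : List A → A} (hφ : MultiAdd φ) {y h x : Ser (ℕ × ℕ) A}
    (hy : y 0 = 0) (hx : x 0 = 0) (hσy : ∀ p, σ (y p) = y p) (hσx : ∀ p, σ (x p) = x p)
    (hσh : ∀ p, σ (h p) = -h p) (γ : ℕ × ℕ) :
    wordSum₂ y h x (lastMul σ φ) γ = (wordSer y φ * h) γ - (wordSer₂ y h x φ * x) γ := by
  induction γ using weight_induction generalizing φ with
  | h γ ih =>
    have key₁ : ∀ pq ∈ antidiagonal γ, wordSum x (fun L => lastMul σ φ (h pq.1 :: L)) pq.2 =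
        (if pq.2 = 0 then φ [] * h pq.1 else 0) -
          ∑ kl ∈ antidiagonal pq.2, hφ.headSum x kl.1 (h pq.1) * x kl.2 := by
      intro pq _
      simp only [lastMul, wordSum_add, hσh, wordSum_ite_nil]
      rw [wordSum_lastMul (hφ.cons _) hx hσx, Ser.mul_apply, sub_eq_add_neg,
        ← Finset.sum_neg_distrib]
      simp only [← neg_mul, ← map_neg]
      rfl
    have key₂ : ∀ pq ∈ (antidiagonal γ).filter (·.1 ≠ 0),
        wordSum₂ y h x (fun L => lastMul σ φ (y pq.1 :: L)) pq.2 =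
          (wordSer y (fun L => φ (y pq.1 :: L)) * h) pq.2 -
            ∑ kl ∈ antidiagonal pq.2, hφ.headSum₂ y h x kl.1 (y pq.1) * x kl.2 := by
      intro pq hpq
      simp only [lastMul, wordSum₂_add, hσy, wordSum₂_ite_nil]
      rw [ih _ (weight_lt hpq) (hφ.cons _), zero_add]
      rfl
    rw [wordSer_mul_apply hφ hy, wordSum₂_eq, Finset.sum_congr rfl key₁, Finset.sum_congr rfl key₂,
      Finset.sum_sub_distrib, Finset.sum_sub_distrib, sub_add_sub_comm,
      sum_antidiagonal_ite' γ fun p => φ [] * h p]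
    congr 1
    rw [sum_filter_mul γ (fun p q => hφ.headSum₂ y h x q (y p)) x (by simp [hy]),
      ← Ser.sum_antidiagonal_assoc (fun i j k => hφ.headSum x j (h i) * x k),
      ← Finset.sum_add_distrib, Ser.mul_apply]
    refine Finset.sum_congr rfl fun pq _ => ?_
    rw [← Finset.sum_mul, ← add_mul, wordSer₂_apply, wordSum₂_eq]
    rfl

theorem wordSer₂_lastMul {σ : A → A} {φ : List A → A} (hφ : MultiAdd φ) {y h x : Ser (ℕ × ℕ) A}
    (hy : y 0 = 0) (hx : x 0 = 0) (hσy : ∀ p, σ (y p) = y p) (hσx : ∀ p, σ (x p) = x p)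
    (hσh : ∀ p, σ (h p) = -h p) :
    wordSer₂ y h x (lastMul σ φ) = wordSer y φ * h - wordSer₂ y h x φ * x :=
  Ser.ext' (wordSum₂_lastMul hφ hy hx hσy hσx hσh)

end BarDifferential

/-! ### The operations `E_{1,q}` as functionals on words -/

section Sign

variable (A : Type u) [DGAlgebra A]

/-- The linear map `b ↦ (-1) ^ (|b| + 1) b` on homogeneous elements `b`. -/
def barSign : A →ₗ[ℤ] A :=
  DirectSum.toModule ℤ ℤ A (fun k => ((k + 1).negOnePow : ℤ) • (gr k : Submodule ℤ A).subtype) ∘ₗ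
    (LinearEquiv.ofBijective (DirectSum.coeLinearMap (gr : ℤ → Submodule ℤ A))
      isInternal).symm.toLinearMap

variable {A}

theorem barSign_apply {k : ℤ} {b : A} (hb : b ∈ gr k) :
    barSign A b = (k + 1).negOnePow • b := by
  have h : (LinearEquiv.ofBijective (DirectSum.coeLinearMap (gr : ℤ → Submodule ℤ A))
      isInternal).symm b = DirectSum.lof ℤ ℤ (fun k => (gr k : Submodule ℤ A)) k ⟨b, hb⟩ := by
    rw [LinearEquiv.symm_apply_eq]
    exact (DirectSum.coeLinearMap_lof (gr : ℤ → Submodule ℤ A) k ⟨b, hb⟩).symm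
  rw [barSign, LinearMap.comp_apply, LinearEquiv.coe_coe, h, DirectSum.toModule_lof]
  rfl

theorem barSign_of_odd {k : ℤ} (hk : Odd k) {b : A} (hb : b ∈ gr k) : barSign A b = b := by
  rw [barSign_apply hb, Int.negOnePow_even _ hk.add_one, one_smul]

theorem barSign_of_even {k : ℤ} (hk : Even k) {b : A} (hb : b ∈ gr k) : barSign A b = -b := by
  rw [barSign_apply hb, Int.negOnePow_odd _ hk.add_one, Units.neg_smul, one_smul]

end Sign

theorem MultiAdd.cons_units_smul {A V : Type*} [AddCommGroup A] [AddCommGroup V]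
    {φ : List A → V} (hφ : MultiAdd φ) (e : ℤˣ) (b : A) (L : List A) :
    φ (e • b :: L) = e • φ (b :: L) := by
  rcases Int.units_eq_one_or e with rfl | rfl
  · simp
  · rw [Units.neg_smul, Units.neg_smul, one_smul, one_smul, hφ.cons_neg]

@[simp] theorem eps_zero {p : ℕ} (α : Fin p → ℤ) : eps α 0 = 0 := by simp [eps]

theorem eps_cons_succ {p : ℕ} (k : ℤ) (α : Fin p → ℤ) (i : ℕ) :
    eps (Fin.cons k α : Fin (p + 1) → ℤ) (i + 1) = k + 1 + eps α i := by
  simp [eps, Fin.sum_univ_succ]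

theorem merge_cons_cons_zero {X : Type*} [Mul X] {q : ℕ} (b c : X) (t : Fin q → X) :
    merge (Fin.cons b (Fin.cons c t) : Fin (q + 2) → X) (0 : Fin (q + 1)) =
      (Fin.cons (b * c) t : Fin (q + 1) → X) := by
  funext k
  refine Fin.cases ?_ (fun k => ?_) k
  · simp only [merge, Fin.val_zero, lt_irrefl, if_false, if_true, Fin.cons_zero]
    rfl
  · simp only [merge, Fin.val_zero, not_lt_zero, if_false, Fin.val_succ, Nat.succ_ne_zero,
      Fin.cons_succ]
    rfl

theorem merge_cons_succ {X : Type*} [Mul X] {q : ℕ} (b : X) (t : Fin (q + 1) → X) (j : Fin q) :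
    merge (Fin.cons b t : Fin (q + 2) → X) (j.succ : Fin (q + 1)) =
      (Fin.cons b (merge t (j : Fin (q + 1 - 1))) : Fin (q + 1) → X) := by
  funext k
  refine Fin.cases ?_ (fun k => ?_) k
  · simp only [merge, Fin.val_zero, Fin.val_succ, Nat.zero_lt_succ, if_true]
    rfl
  · simp only [merge, Fin.val_succ, Nat.succ_lt_succ_iff, Fin.cons_succ, Nat.succ_inj]
    rfl

section Tuples

variable {A : Type u} [DGAlgebra A]

/-- The sum of the terms with `d bⱼ` and with `bⱼ * bⱼ₊₁` in the Hirsch relation is the transpose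
of the bar differential. -/
theorem barD_ofFn {V : Type*} [AddCommGroup V] {φ : List A → V} (hφ : MultiAdd φ) {q : ℕ}
    {β : Fin q → ℤ} {b : Fin q → A} (hb : ∀ j, b j ∈ gr (β j)) :
    ∑ j : Fin q, (eps β j).negOnePow • φ (List.ofFn (Function.update b j (d (b j)))) +
      ∑ j : Fin (q - 1), (eps β (j + 1)).negOnePow • φ (List.ofFn (merge b j)) =
    barD d (barSign A) φ (List.ofFn b) := by
  induction q generalizing φ with
  | zero => simp [barD]
  | succ q ih =>
    obtain ⟨k, β, rfl⟩ : ∃ k β', β = Fin.cons k β' := ⟨_, _, (Fin.cons_self_tail β).symm⟩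
    obtain ⟨c, t, rfl⟩ : ∃ c t, b = Fin.cons c t := ⟨_, _, (Fin.cons_self_tail b).symm⟩
    have hc : c ∈ gr k := hb 0
    have ht : ∀ j, t j ∈ gr (β j) := fun j => hb j.succ
    have hsign : ∀ L, φ (barSign A c :: L) = (k + 1).negOnePow • φ (c :: L) := fun L => by
      rw [barSign_apply hc, hφ.cons_units_smul]
    have hadd : ∀ (e : ℤ) (v : V), (k + 1 + e).negOnePow • v =
        e.negOnePow • (k + 1).negOnePow • v := fun e v => by
      rw [Int.negOnePow_add, mul_comm, mul_smul]
    -- the terms in which the first letter is multiplied with the second one, and the others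
    have hmerge : ∑ j : Fin (q + 1 - 1), (eps (Fin.cons k β : Fin (q + 1) → ℤ) (j + 1)).negOnePow •
        φ (List.ofFn (merge (Fin.cons c t : Fin (q + 1) → A) j)) =
          mergeHead φ (barSign A c) (List.ofFn t) +
          ∑ j : Fin (q - 1), (eps β (j + 1)).negOnePow •
            φ (barSign A c :: List.ofFn (merge t j)) := by
      cases q with
      | zero => simp [mergeHead]
      | succ q =>
        obtain ⟨e, t, rfl⟩ : ∃ e t', t = Fin.cons e t' := ⟨_, _, (Fin.cons_self_tail t).symm⟩
        refine (Fin.sum_univ_succ _).trans ?_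
        congr 1
        · rw [merge_cons_cons_zero, eps_cons_succ, List.ofFn_cons, List.ofFn_cons, mergeHead,
            barSign_apply hc, smul_mul_assoc, hφ.cons_units_smul]
          simp
        · refine Finset.sum_congr rfl fun j _ => ?_
          rw [merge_cons_succ, List.ofFn_cons, eps_cons_succ, hsign, hadd]
          rfl
    rw [hmerge, List.ofFn_cons, barD, ← ih (hφ.cons _) ht, Fin.sum_univ_succ]
    simp only [Fin.val_zero, eps_zero, Int.negOnePow_zero, one_smul, Fin.cons_zero,
      Fin.update_cons_zero, List.ofFn_cons, Fin.cons_succ, Fin.val_succ, eps_cons_succ,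
      ← Fin.cons_update, hsign, hadd]
    abel

theorem lastMul_ofFn {φ : List A → A} (hφ : MultiAdd φ) {q : ℕ}
    {β : Fin (q + 1) → ℤ} {b : Fin (q + 1) → A} (hb : ∀ j, b j ∈ gr (β j)) :
    (eps β q).negOnePow • (φ (List.ofFn (Fin.init b)) * b (Fin.last q)) =
    lastMul (barSign A) φ (List.ofFn b) := by
  induction q generalizing φ with
  | zero => simp [lastMul]
  | succ q ih =>
    obtain ⟨k, β, rfl⟩ : ∃ k β', β = Fin.cons k β' := ⟨_, _, (Fin.cons_self_tail β).symm⟩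
    obtain ⟨c, t, rfl⟩ : ∃ c t, b = Fin.cons c t := ⟨_, _, (Fin.cons_self_tail b).symm⟩
    have hc : c ∈ gr k := hb 0
    have ht : ∀ j, t j ∈ gr (β j) := fun j => hb j.succ
    have hsign : ∀ L, φ (barSign A c :: L) = (k + 1).negOnePow • φ (c :: L) := fun L => by
      rw [barSign_apply hc, hφ.cons_units_smul]
    have hne : List.ofFn t ≠ [] := by simp
    have hi : (Fin.init (Fin.cons c t : Fin (q + 2) → A) : Fin (q + 1) → A) =
        Fin.cons c (Fin.init t) := by
      funext j
      refine Fin.cases ?_ (fun j => ?_) j <;> rfl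
    have hl : (Fin.cons c t : Fin (q + 2) → A) (Fin.last (q + 1)) = t (Fin.last q) := rfl
    rw [List.ofFn_cons, lastMul, ← ih (hφ.cons _) ht, if_neg hne, zero_add, hi, hl, List.ofFn_cons,
      eps_cons_succ, hsign, Int.negOnePow_add, mul_comm, mul_smul, smul_mul_assoc]

end Tuples

section OpE

variable {A : Type u} [HirschAlgebra A]

/-- The operation `E_{1,q}(a; b₁, …, b_q)` as a function of the word `[b₁, …, b_q]`. -/
def opE (a : A) (L : List A) : A := E 1 L.length (Sum.elim (fun _ => a) L.get)

theorem opE_eq (a : A) (L : List A) {n : ℕ} (h : L.length = n) :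
    opE a L = E 1 n (Sum.elim (fun _ => a) fun k => L.get (k.cast h.symm)) := by
  subst h
  rfl

theorem opE_ofFn (a : A) {q : ℕ} (b : Fin q → A) :
    opE a (List.ofFn b) = E 1 q (Sum.elim (fun _ => a) b) := by
  rw [opE_eq a _ (List.length_ofFn)]
  simp

@[simp] theorem opE_nil (a : A) : opE a [] = a := by
  exact E_one_zero _ _

theorem opE_multiAdd (a : A) : MultiAdd (opE a) := by
  intro L₁ L₂ b c
  have key : ∀ e : A, opE a (L₁ ++ e :: L₂) =
      E 1 (L₁ ++ 0 :: L₂).length (Function.update (Sum.elim (fun _ => a) (L₁ ++ 0 :: L₂).get)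
        (Sum.inr ⟨L₁.length, by simp⟩) e) := by
    intro e
    rw [opE_eq a (L₁ ++ e :: L₂) (n := (L₁ ++ 0 :: L₂).length) (by simp)]
    congr 1
    funext k
    rcases k with k | ⟨k, hk⟩
    · simp
    · rcases lt_trichotomy k L₁.length with h | rfl | h
      · simp [Function.update, h, h.ne, List.getElem_append_left]
      · simp
      · obtain ⟨m, rfl⟩ := Nat.exists_eq_add_of_lt h
        simp [Function.update, List.getElem_append_right, Nat.add_assoc]
  rw [key, key, key, MultilinearMap.map_update_add]

theorem opE_add (a a' : A) (L : List A) : opE (a + a') L = opE a L + opE a' L := by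
  have key : ∀ e : A, opE e L = E 1 L.length
      (Function.update (Sum.elim (fun _ => 0) L.get) (Sum.inl 0) e) := by
    intro e
    rw [opE]
    congr 1
    funext k
    rcases k with k | k
    · simp [Subsingleton.elim k 0]
    · simp
  rw [key, key, key, MultilinearMap.map_update_add]

theorem opE_zero (L : List A) : opE (0 : A) L = 0 := by
  have h := opE_add (0 : A) 0 L
  rwa [add_zero, left_eq_add] at h

theorem E_of_eq_one {p q : ℕ} (hp : p = 0) (hq : q = 1) (z : Fin p ⊕ Fin q → A) :
    E p q z = z (Sum.inr ⟨0, by omega⟩) := by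
  subst hp hq
  have h : z = Sum.elim (fun i => z (Sum.inl i)) (fun j => z (Sum.inr j)) := by
    funext k
    rcases k with k | k <;> rfl
  rw [h, E_zero_one]
  rfl

theorem E_of_ne_one {p q : ℕ} (hp : p = 0) (hq : q ≠ 1) : (E p q : MultilinearMap ℤ _ A) = 0 := by
  subst hp
  rcases Nat.eq_zero_or_pos q with rfl | h
  · exact E_zero_zero
  · exact E_right_zero q (by omega)

/-- The terms `E_{0,j} * E_{1,q-j}` in the Hirsch relation. -/
theorem sum_E_zero_mul (a : A) {q : ℕ} (b : Fin q → A) (s : ℕ → ℤˣ) :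
    ∑ j : Fin (q + 1), (if (j : ℕ) = 0 then 0 else
      s j • (E 0 j (Sum.elim (takeFst (fun _ : Fin 1 => a) 0) (takeFst b j)) *
        E (1 - 0) (q - j) (Sum.elim (dropFst (fun _ : Fin 1 => a) 0) (dropFst b j)))) =
    s 1 • firstMul id (opE a) (List.ofFn b) := by
  cases q with
  | zero => simp [firstMul]
  | succ q =>
    obtain ⟨c, t, rfl⟩ : ∃ c t', b = Fin.cons c t' := ⟨_, _, (Fin.cons_self_tail b).symm⟩
    rw [Finset.sum_eq_single 1]
    · rw [if_neg (by simp), List.ofFn_cons, firstMul, opE_ofFn]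
      have h₁ : E 0 ((1 : Fin (q + 2)) : ℕ) (Sum.elim (takeFst (fun _ : Fin 1 => a) 0)
          (takeFst (Fin.cons c t : Fin (q + 1) → A) 1)) = c :=
        E_zero_one _ _
      rw [h₁]
      congr 3
      funext k
      rcases k with k | k
      · rfl
      · obtain ⟨k, hk⟩ := k
        have hk' : k < q := by simpa using hk
        have h : (⟨1 + k, by omega⟩ : Fin (q + 1)) = Fin.succ ⟨k, hk'⟩ :=
          Fin.ext (Nat.add_comm _ _)
        exact congrArg (Fin.cons c t : Fin (q + 1) → A) h
    · intro j _ hj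
      rw [E_of_ne_one rfl fun h => hj (Fin.ext h)]
      simp
    · simp

/-- The terms `E_{1,j} * E_{0,q-j}` in the Hirsch relation. -/
theorem sum_E_one_mul (a : A) {q : ℕ} (b : Fin (q + 1) → A) (s : ℕ → ℤˣ) :
    ∑ j : Fin (q + 2),
      s j • (E 1 j (Sum.elim (takeFst (fun _ : Fin 1 => a) 1) (takeFst b j)) *
        E (1 - 1) (q + 1 - j) (Sum.elim (dropFst (fun _ : Fin 1 => a) 1) (dropFst b j))) =
    s q • (opE a (List.ofFn (Fin.init b)) * b (Fin.last q)) := by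
  rw [Finset.sum_eq_single (Fin.castSucc (Fin.last q))]
  · rw [E_of_eq_one (p := 1 - 1) (q := q + 1 - (Fin.castSucc (Fin.last q) : Fin (q + 2))) rfl
      (by simp), opE_ofFn]
    rfl
  · intro j _ hj
    rw [E_of_ne_one (p := 1 - 1) (q := q + 1 - j) rfl]
    · simp
    · intro h
      exact hj (Fin.ext (by simp; omega))
  · simp

theorem eps_one_left (α : ℤ) : eps (fun _ : Fin 1 => α) 1 = α + 1 := by simp [eps]

/-- The Hirsch relation for `E_{1,q}(a; b₁, …, b_q)`, with separate signs for the first and the last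
letter. -/
theorem d_opE_ofFn {a : A} {α : ℤ} (ha : a ∈ gr α) {q : ℕ} {β : Fin q → ℤ} {b : Fin q → A}
    (hb : ∀ j, b j ∈ gr (β j)) :
    d (opE a (List.ofFn b)) = opE (d a) (List.ofFn b) +
      (α + 1).negOnePow • barD d (barSign A) (opE a) (List.ofFn b) -
      ((α + 2) * eps β 1).negOnePow • firstMul id (opE a) (List.ofFn b) -
      (α + 1).negOnePow • lastMul (barSign A) (opE a) (List.ofFn b) := by
  have h₁ : ∑ i : Fin 1, (eps (fun _ : Fin 1 => α) i).negOnePow •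
      E 1 q (Sum.elim (Function.update (fun _ => a) i (d a)) b) = opE (d a) (List.ofFn b) := by
    rw [opE_ofFn, Fin.sum_univ_one, Fin.val_zero, eps_zero, Int.negOnePow_zero, one_smul]
    congr 2
    funext k
    simp [Subsingleton.elim k 0]
  have h₂ : ∑ j : Fin q, (α + 1 + eps β j).negOnePow •
        E 1 q (Sum.elim (fun _ => a) (Function.update b j (d (b j)))) +
      ∑ j : Fin (q - 1), (α + 1 + eps β (j + 1)).negOnePow •
        E 1 (q - 1) (Sum.elim (fun _ => a) (merge b j)) =
      (α + 1).negOnePow • barD d (barSign A) (opE a) (List.ofFn b) := by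
    rw [← barD_ofFn (opE_multiAdd a) hb]
    simp only [opE_ofFn, Int.negOnePow_add (α + 1), mul_smul, smul_add, Finset.smul_sum]
  have h₃ := sum_E_zero_mul a b fun j => (0 + eps β j + (0 + (α + 1)) * eps β j + 1).negOnePow
  have h₄ : ∑ j : Fin (q + 1),
      (α + 1 + eps β j + (α + 1 + (α + 1)) * eps β j + 1).negOnePow •
        (E 1 j (Sum.elim (takeFst (fun _ : Fin 1 => a) 1) (takeFst b j)) *
          E (1 - 1) (q - j) (Sum.elim (dropFst (fun _ : Fin 1 => a) 1) (dropFst b j))) =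
      -((α + 1).negOnePow • lastMul (barSign A) (opE a) (List.ofFn b)) := by
    cases q with
    | zero =>
      rw [Fin.sum_univ_one, E_of_ne_one (p := 1 - 1) rfl (by simp)]
      simp [lastMul]
    | succ q =>
      rw [sum_E_one_mul a b fun j => (α + 1 + eps β j + (α + 1 + (α + 1)) * eps β j + 1).negOnePow,
        ← lastMul_ofFn (opE_multiAdd a) hb, ← two_mul, mul_assoc, Int.negOnePow_succ,
        Int.negOnePow_add, Int.negOnePow_two_mul, mul_one, Int.negOnePow_add, Units.neg_smul,
        mul_smul]
  rw [opE_ofFn, d_E (fun _ => ha) hb]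
  have h₅ : ∀ f : Fin (1 + 1) → A, ∑ i, f i = f 0 + f 1 := Fin.sum_univ_two
  have h₆ : ∀ f : Fin (1 - 1) → A, ∑ i, f i = 0 := Fin.sum_univ_zero
  rw [h₅, h₆]
  simp only [Fin.val_zero, Fin.val_one, one_ne_zero, false_and, if_false, true_and, eps_one_left,
    eps_zero, add_zero]
  rw [h₁, add_assoc (opE (d a) (List.ofFn b)), h₂]
  have h₇ : 0 + eps β 1 + (0 + (α + 1)) * eps β 1 + 1 = (α + 2) * eps β 1 + 1 := by ring
  rw [h₇, Int.negOnePow_succ, Units.neg_smul] at h₃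
  refine (congrArg₂ (fun u v => opE (d a) (List.ofFn b) + (α + 1).negOnePow •
    barD d (barSign A) (opE a) (List.ofFn b) + (u + v)) h₃ h₄).trans ?_
  abel

end OpE

section OpEList

variable {A : Type u} [HirschAlgebra A]

theorem exists_degrees {P : ℤ → Prop} {L : List A} (hL : ∀ b ∈ L, ∃ k, P k ∧ b ∈ gr k) :
    ∃ (q : ℕ) (β : Fin q → ℤ) (b : Fin q → A),
      (∀ j, P (β j)) ∧ (∀ j, b j ∈ gr (β j)) ∧ List.ofFn b = L := by
  choose β hβ using fun j : Fin L.length => hL (L.get j) (L.get_mem j)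
  exact ⟨L.length, β, L.get, fun j => (hβ j).1, fun j => (hβ j).2, List.ofFn_get L⟩

/-- The sign of the term with the first letter in the Hirsch relation. -/
theorem firstMul_id_ofFn {φ : List A → A} {q : ℕ} {β : Fin q → ℤ} {b : Fin q → A}
    (hb : ∀ j, b j ∈ gr (β j)) {α : ℤ} (h : Odd α ∨ ∀ j, Odd (β j)) :
    (α * eps β 1).negOnePow • firstMul id φ (List.ofFn b) =
      firstMul (barSign A) φ (List.ofFn b) := by
  cases q with
  | zero => simp [firstMul]
  | succ q =>
    obtain ⟨k, β, rfl⟩ : ∃ k β', β = Fin.cons k β' := ⟨_, _, (Fin.cons_self_tail β).symm⟩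
    obtain ⟨c, t, rfl⟩ : ∃ c t, b = Fin.cons c t := ⟨_, _, (Fin.cons_self_tail b).symm⟩
    have hc : c ∈ gr k := hb 0
    have he : (α * (k + 1)).negOnePow = (k + 1).negOnePow := by
      rcases h with h | h
      · obtain ⟨n, rfl⟩ := h
        rw [show (2 * n + 1) * (k + 1) = 2 * (n * (k + 1)) + (k + 1) by ring,
          Int.negOnePow_add, Int.negOnePow_two_mul, one_mul]
      · have hk : Odd k := h 0
        rw [Int.negOnePow_even _ (hk.add_one.mul_left α), Int.negOnePow_even _ hk.add_one]
    rw [List.ofFn_cons, firstMul, firstMul, barSign_apply hc, smul_mul_assoc, eps_cons_succ k β 0,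
      eps_zero, add_zero, he]
    rfl

/-- The Hirsch relation for `E_{1,q}(a; b₁, …, b_q)` with `a` of odd degree. -/
theorem d_opE_of_odd {a : A} {α : ℤ} (hα : Odd α) (ha : a ∈ gr α) {L : List A}
    (hL : ∀ b ∈ L, ∃ k, True ∧ b ∈ gr k) :
    d (opE a L) = opE (d a) L + barD d (barSign A) (opE a) L - firstMul (barSign A) (opE a) L -
      lastMul (barSign A) (opE a) L := by
  obtain ⟨q, β, b, -, hb, rfl⟩ := exists_degrees hL
  rw [d_opE_ofFn ha hb, firstMul_id_ofFn hb (Or.inl (hα.add_even even_two)),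
    Int.negOnePow_even _ hα.add_one, one_smul, one_smul]

/-- The Hirsch relation for `E_{1,q}(a; b₁, …, b_q)` with `a` of even degree and `b₁, …, b_q` of odd
degrees. -/
theorem d_opE_of_even {a : A} {α : ℤ} (hα : Even α) (ha : a ∈ gr α) {L : List A}
    (hL : ∀ b ∈ L, ∃ k, Odd k ∧ b ∈ gr k) :
    d (opE a L) = opE (d a) L - barD d (barSign A) (opE a) L - firstMul (barSign A) (opE a) L +
      lastMul (barSign A) (opE a) L := by
  obtain ⟨q, β, b, hβ, hb, rfl⟩ := exists_degrees hL
  rw [d_opE_ofFn ha hb, firstMul_id_ofFn hb (Or.inr hβ), Int.negOnePow_odd _ hα.add_one,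
    Units.neg_smul, Units.neg_smul, one_smul, one_smul]
  abel

/-- A functional on words is homogeneous of degree `δ` if letters of degree `k` count as having
degree `k - 1`. -/
def HasDegree (φ : List A → A) (δ : ℤ) : Prop :=
  ∀ (q : ℕ) (β : Fin q → ℤ) (b : Fin q → A), (∀ j, b j ∈ gr (β j)) →
    φ (List.ofFn b) ∈ gr (δ + ∑ j, (β j - 1))

theorem HasDegree.cons {φ : List A → A} {δ : ℤ} (hφ : HasDegree φ δ) {k : ℤ} {c : A}
    (hc : c ∈ gr k) : HasDegree (fun L => φ (c :: L)) (δ + (k - 1)) := by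
  intro q β b hb
  have h := hφ _ (Fin.cons k β) (Fin.cons c b) fun j => by
    refine Fin.cases ?_ (fun j => ?_) j
    · exact hc
    · exact hb j
  rw [Fin.sum_univ_succ] at h
  simp only [List.ofFn_cons, Fin.cons_zero, Fin.cons_succ] at h
  rwa [add_assoc]

theorem HasDegree.nil {φ : List A → A} {δ : ℤ} (hφ : HasDegree φ δ) : φ [] ∈ gr δ := by
  have h := hφ 0 Fin.elim0 Fin.elim0 fun j => j.elim0
  simpa using h

theorem opE_hasDegree {a : A} {α : ℤ} (ha : a ∈ gr α) : HasDegree (opE a) α := by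
  intro q β b hb
  have h := E_mem (a := fun _ : Fin 1 => a) (fun _ => ha) hb
  rw [opE_ofFn]
  convert h using 2
  simp [Finset.sum_sub_distrib]
  ring

end OpEList

/-! ### Graded series -/

section Graded

variable {A : Type u} [DGAlgebra A]

/-- The coefficient at `(m, j)` has degree `2 * (m + j) + ε`. -/
def SerDegree (ε : ℤ) (x : Ser (ℕ × ℕ) A) : Prop :=
  ∀ p : ℕ × ℕ, x p ∈ gr (2 * ((p.1 + p.2 : ℕ) : ℤ) + ε)

/-- All coefficients of a series have odd degree. -/
def IsOdd {Γ : Type*} (x : Ser Γ A) : Prop := ∀ p, ∃ k : ℤ, Odd k ∧ x p ∈ gr k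

/-- All coefficients of a series have even degree. -/
def IsEven {Γ : Type*} (x : Ser Γ A) : Prop := ∀ p, ∃ k : ℤ, Even k ∧ x p ∈ gr k

theorem SerDegree.isOdd {x : Ser (ℕ × ℕ) A} (hx : SerDegree 1 x) : IsOdd x :=
  fun p => ⟨_, ⟨_, rfl⟩, hx p⟩

theorem SerDegree.isEven {x : Ser (ℕ × ℕ) A} (hx : SerDegree 0 x) : IsEven x :=
  fun p => ⟨_, ⟨((p.1 + p.2 : ℕ) : ℤ), by ring⟩, hx p⟩

theorem IsOdd.barSign {Γ : Type*} {x : Ser Γ A} (hx : IsOdd x) (p : Γ) :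
    Hirsch.barSign A (x p) = x p := by
  obtain ⟨k, hk, h⟩ := hx p
  exact barSign_of_odd hk h

theorem IsEven.barSign {Γ : Type*} {x : Ser Γ A} (hx : IsEven x) (p : Γ) :
    Hirsch.barSign A (x p) = -x p := by
  obtain ⟨k, hk, h⟩ := hx p
  exact barSign_of_even hk h

/-- The differential applied to all coefficients of a series. -/
def dSer {Γ : Type*} : Ser Γ A →+ Ser Γ A := Ser.map (d : A →ₗ[ℤ] A).toAddMonoidHom

@[simp] theorem dSer_apply {Γ : Type*} (x : Ser Γ A) (p : Γ) : dSer x p = d (x p) := rfl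

theorem dSer_dSer {Γ : Type*} (x : Ser Γ A) : dSer (dSer x) = 0 := Ser.ext' fun p => d_d (x p)

variable {Γ : Type*} [AddCommMonoid Γ] [Finset.HasAntidiagonal Γ]

theorem dSer_mul_of_isOdd {x : Ser Γ A} (hx : IsOdd x) (y : Ser Γ A) :
    dSer (x * y) = dSer x * y - x * dSer y := by
  refine Ser.ext' fun p => ?_
  simp only [dSer_apply, Ser.mul_apply, map_sum, Ser.sub_apply, ← Finset.sum_sub_distrib]
  refine Finset.sum_congr rfl fun pq _ => ?_
  obtain ⟨k, hk, h⟩ := hx pq.1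
  rw [leibniz _ h, Int.negOnePow_odd _ hk, Units.neg_smul, one_smul, sub_eq_add_neg]

theorem dSer_mul_of_isEven {x : Ser Γ A} (hx : IsEven x) (y : Ser Γ A) :
    dSer (x * y) = dSer x * y + x * dSer y := by
  refine Ser.ext' fun p => ?_
  simp only [dSer_apply, Ser.mul_apply, map_sum, Ser.add_apply, ← Finset.sum_add_distrib]
  refine Finset.sum_congr rfl fun pq _ => ?_
  obtain ⟨k, hk, h⟩ := hx pq.1
  rw [leibniz _ h, Int.negOnePow_even _ hk, one_smul]

end Graded

section DWordSer

variable {A : Type u} [HirschAlgebra A]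

theorem wordSum_mem {φ : List A → A} {δ : ℤ} (hφ : HasDegree φ δ) {x : Ser (ℕ × ℕ) A}
    {γ : ℕ × ℕ}
    (hx : ∀ p : ℕ × ℕ, p.1 + p.2 ≤ γ.1 + γ.2 → x p ∈ gr (2 * ((p.1 + p.2 : ℕ) : ℤ) + 1)) :
    wordSum x φ γ ∈ gr (2 * ((γ.1 + γ.2 : ℕ) : ℤ) + δ) := by
  induction γ using weight_induction generalizing φ δ with
  | h γ ih =>
    rw [wordSum_eq]
    refine add_mem ?_ (sum_mem fun pq hpq => ?_)
    · split_ifs with h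
      · subst h
        simpa using hφ.nil
      · exact zero_mem _
    · have hw := weight_lt hpq
      have h := ih _ hw (hφ.cons (hx _ (weight_fst_le (mem_of_filter hpq))))
        fun p hp => hx p (hp.trans hw.le)
      convert h using 2
      rw [← mem_antidiagonal.1 (mem_of_filter hpq)]
      simp only [Prod.fst_add, Prod.snd_add]
      push_cast
      ring

theorem wordSum₂_mem {φ : List A → A} {δ ε : ℤ} (hφ : HasDegree φ δ) {y h x : Ser (ℕ × ℕ) A}
    (hy : SerDegree 1 y) (hx : SerDegree 1 x) {γ : ℕ × ℕ}
    (hh : ∀ p : ℕ × ℕ, p.1 + p.2 ≤ γ.1 + γ.2 → h p ∈ gr (2 * ((p.1 + p.2 : ℕ) : ℤ) + ε)) :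
    wordSum₂ y h x φ γ ∈ gr (2 * ((γ.1 + γ.2 : ℕ) : ℤ) + (δ + ε - 1)) := by
  induction γ using weight_induction generalizing φ δ with
  | h γ ih =>
    rw [wordSum₂_eq]
    refine add_mem (sum_mem fun pq hpq => ?_) (sum_mem fun pq hpq => ?_)
    · have h := wordSum_mem (hφ.cons (hh _ (weight_fst_le hpq))) (x := x) (γ := pq.2)
        fun p _ => hx p
      convert h using 2
      rw [← mem_antidiagonal.1 hpq]
      simp only [Prod.fst_add, Prod.snd_add]
      push_cast
      ring
    · have hw := weight_lt hpq
      have h := ih _ hw (hφ.cons (hy pq.1)) fun p hp => hh p (hp.trans hw.le)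
      convert h using 2
      rw [← mem_antidiagonal.1 (mem_of_filter hpq)]
      simp only [Prod.fst_add, Prod.snd_add]
      push_cast
      ring

variable {x y h : Ser (ℕ × ℕ) A}

theorem homogeneous_of_odd (hx : IsOdd x) (p : ℕ × ℕ) : ∃ k, True ∧ x p ∈ gr k :=
  (hx p).imp fun _ h => ⟨trivial, h.2⟩

theorem homogeneous_of_even (hx : IsEven x) (p : ℕ × ℕ) : ∃ k, True ∧ x p ∈ gr k :=
  (hx p).imp fun _ h => ⟨trivial, h.2⟩

/-- For a cocycle `a` of odd degree, the vector field `x ↦ ∑ l, E_{1,l}(a; x, …, x)` is tangent to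
the twisting elements. -/
theorem dSer_wordSer_of_odd {a : A} {α : ℤ} (hα : Odd α) (ha : a ∈ cocycles A α) (hx0 : x 0 = 0)
    (hx : IsOdd x) :
    dSer (wordSer x (opE a)) = wordSer₂ x (dSer x + x * x) x (opE a) -
      x * wordSer x (opE a) - wordSer x (opE a) * x := by
  have hda : d a = 0 := ha.2
  rw [← wordSer_firstMul hx0 hx.barSign, ← wordSer_lastMul (opE_multiAdd a) hx0 hx.barSign]
  refine Ser.ext' fun γ => ?_
  rw [dSer_apply, wordSer_apply]
  refine (map_wordSum (d : A →ₗ[ℤ] A).toAddMonoidHom x (opE a) γ).trans ?_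
  refine (wordSum_congr_right (P := fun b => ∃ k, True ∧ b ∈ gr k) (homogeneous_of_odd hx)
    fun L hL => d_opE_of_odd hα ha.1 hL).trans ?_
  simp only [wordSum_sub, hda, opE_zero, zero_add, Ser.sub_apply]
  exact congrArg (fun z => z - _ - _)
    (wordSum_barD (D := (d : A →ₗ[ℤ] A).toAddMonoidHom) (opE_multiAdd a) hx0 hx.barSign γ)

/-- For `b` of even degree, the vector field of `d b` is an infinitesimal gauge transformation at
each twisting element `x`. -/
theorem dSer_wordSer_of_even {b : A} {β : ℤ} (hβ : Even β) (hb : b ∈ gr β) (hx0 : x 0 = 0)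
    (hx : IsOdd x) (hc : dSer x + x * x = 0) :
    dSer (wordSer x (opE b)) = wordSer x (opE (d b)) - x * wordSer x (opE b) +
      wordSer x (opE b) * x := by
  rw [← wordSer_firstMul hx0 hx.barSign, ← wordSer_lastMul (opE_multiAdd b) hx0 hx.barSign]
  refine Ser.ext' fun γ => ?_
  rw [dSer_apply, wordSer_apply]
  refine (map_wordSum (d : A →ₗ[ℤ] A).toAddMonoidHom x (opE b) γ).trans ?_
  refine (wordSum_congr_right (P := fun b => ∃ k, Odd k ∧ b ∈ gr k) hx
    fun L hL => d_opE_of_even hβ hb hL).trans ?_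
  simp only [wordSum_sub, wordSum_add, Ser.sub_apply, Ser.add_apply, wordSer_apply]
  have h₀ : wordSum x (barD d (barSign A) (opE b)) γ = 0 :=
    wordSum_barD_of_twisting (D := (d : A →ₗ[ℤ] A).toAddMonoidHom) (opE_multiAdd b) hx0
      hx.barSign hc γ
  rw [h₀, sub_zero]

/-- The derivative of the vector field of a cocycle `a` of odd degree along a homotopy `h` between
twisting elements. -/
theorem dSer_wordSer₂ {a : A} {α : ℤ} (hα : Odd α) (ha : a ∈ cocycles A α) (hy0 : y 0 = 0)
    (hx0 : x 0 = 0) (hy : IsOdd y) (hx : IsOdd x) (hh : IsEven h) (hcy : dSer y + y * y = 0)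
    (hcx : dSer x + x * x = 0) :
    dSer (wordSer₂ y h x (opE a)) = wordSer₂ y (dSer h + y * h - h * x) x (opE a) -
      (y * wordSer₂ y h x (opE a) - h * wordSer x (opE a)) -
      (wordSer y (opE a) * h - wordSer₂ y h x (opE a) * x) := by
  have hda : d a = 0 := ha.2
  rw [← wordSer₂_firstMul hy0 hy.barSign hh.barSign,
    ← wordSer₂_lastMul (opE_multiAdd a) hy0 hx0 hy.barSign hx.barSign hh.barSign]
  refine Ser.ext' fun γ => ?_
  rw [dSer_apply, wordSer₂_apply]
  refine (map_wordSum₂ (d : A →ₗ[ℤ] A).toAddMonoidHom y h x (opE a) γ).trans ?_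
  refine (wordSum₂_congr (P := fun b => ∃ k, True ∧ b ∈ gr k) (fun _ _ => rfl)
    (homogeneous_of_odd hy) (homogeneous_of_even hh) (homogeneous_of_odd hx)
    fun L hL => d_opE_of_odd hα ha.1 hL).trans ?_
  simp only [wordSum₂_sub, hda, opE_zero, zero_add, Ser.sub_apply]
  exact congrArg (fun z => z - _ - _)
    (wordSum₂_barD (D := (d : A →ₗ[ℤ] A).toAddMonoidHom) (opE_multiAdd a) hy0 hx0 hy.barSign
      hx.barSign hh.barSign hcy hcx γ)

end DWordSer

/-! ### Differential equations for series in two variables -/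

section Causal

variable {V W : Type*}

/-- The coefficients of `Φ x` up to a given total degree are determined by the coefficients of `x`
up to this total degree. -/
def Causal (Φ : Ser (ℕ × ℕ) V → Ser (ℕ × ℕ) W) : Prop :=
  ∀ (x y : Ser (ℕ × ℕ) V) (γ : ℕ × ℕ),
    (∀ p : ℕ × ℕ, p.1 + p.2 ≤ γ.1 + γ.2 → x p = y p) → Φ x γ = Φ y γ

/-- The coefficients of `shift r (Φ x)` of a given total degree are determined by the coefficients
of `x` of smaller total degree. -/
theorem Causal.shift_congr [AddCommGroup W] {Φ : Ser (ℕ × ℕ) V → Ser (ℕ × ℕ) W}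
    (hΦ : Causal Φ) (r : ℕ) {x y : Ser (ℕ × ℕ) V} {γ : ℕ × ℕ}
    (h : ∀ p : ℕ × ℕ, p.1 + p.2 < γ.1 + γ.2 → x p = y p) :
    Ser.shift r (Φ x) γ = Ser.shift r (Φ y) γ := by
  by_cases hγ : (1, r) ≤ γ
  · obtain ⟨δ, rfl⟩ := exists_add_of_le hγ
    rw [Ser.shift_add_apply, Ser.shift_add_apply]
    refine hΦ x y δ fun p hp => h p ?_
    simp only [Prod.fst_add, Prod.snd_add]
    omega
  · rw [Ser.shift_apply, Ser.shift_apply, if_neg hγ, if_neg hγ]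

variable [AddCommGroup V]

/-- Recursion on a weight: a map of series has a fixed point if each coefficient of the image is
determined by the coefficients of smaller weight. -/
theorem exists_fixed_point {Γ : Type*} (w : Γ → ℕ) (T : Ser Γ V → Ser Γ V)
    (hT : ∀ (x y : Ser Γ V) (γ : Γ), (∀ p, w p < w γ → x p = y p) → T x γ = T y γ) :
    ∃ x, T x = x := by
  let F : ∀ γ : Γ, (∀ p : Γ, w p < w γ → V) → V := fun γ ih =>
    T ⟨fun p => if hp : w p < w γ then ih p hp else 0⟩ γ
  let x : Ser Γ V := ⟨(measure w).wf.fix F⟩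
  refine ⟨x, Ser.ext' fun γ => ?_⟩
  have h : x γ = F γ fun p _ => x p := (measure w).wf.fix_eq F γ
  rw [h]
  refine hT _ _ γ fun p hp => ?_
  simp [hp]

/-- The coefficient at `(0, k)` in terms of the value at `s = 1`. -/
theorem evalZero_eq (x : Ser (ℕ × ℕ) V) (k : ℕ) :
    x (0, k) = Ser.evalOne x k - ∑ p ∈ (antidiagonal k).filter (·.1 ≠ 0), x p := by
  rw [Ser.evalOne_apply, eq_sub_iff_add_eq, add_comm,
    ← Finset.sum_filter_add_sum_filter_not (antidiagonal k) (·.1 ≠ 0)]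
  congr 1
  rw [Finset.sum_eq_single (0, k)]
  · rintro ⟨a, b⟩ h hne
    simp only [Finset.mem_filter, mem_antidiagonal, not_not] at h
    exact absurd (Prod.ext h.2 (by simp; omega)) hne
  · simp

theorem nsmul_right_injective_of_rat [Module ℚ V] {m : ℕ} (hm : m ≠ 0) {v w : V}
    (h : m • v = m • w) : v = w := by
  have hm' : (m : ℚ) ≠ 0 := Nat.cast_ne_zero.2 hm
  rw [← Nat.cast_smul_eq_nsmul ℚ, ← Nat.cast_smul_eq_nsmul ℚ] at h
  exact smul_right_injective V hm' h

variable [Module ℚ V] {Φ : Ser (ℕ × ℕ) V → Ser (ℕ × ℕ) V} {r : ℕ}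

theorem Causal.eq_of_forall_lt (hΦ : Causal Φ) {x y : Ser (ℕ × ℕ) V}
    (hx : Ser.euler x = Ser.shift r (Φ x)) (hy : Ser.euler y = Ser.shift r (Φ y)) {γ : ℕ × ℕ}
    (hγ : γ.1 ≠ 0) (h : ∀ p : ℕ × ℕ, p.1 + p.2 < γ.1 + γ.2 → x p = y p) : x γ = y γ := by
  refine nsmul_right_injective_of_rat hγ ?_
  rw [← Ser.euler_apply, ← Ser.euler_apply, hx, hy]
  exact hΦ.shift_congr r h

/-- Solutions are determined up to a given total degree by their values at `s = 1`, or by their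
values at `s = 0`, up to this total degree. -/
theorem Causal.eq_of_lt (hΦ : Causal Φ) {x y : Ser (ℕ × ℕ) V}
    (hx : Ser.euler x = Ser.shift r (Φ x)) (hy : Ser.euler y = Ser.shift r (Φ y)) {k : ℕ}
    (h : (∀ j < k, Ser.evalOne x j = Ser.evalOne y j) ∨
      ∀ j < k, Ser.evalZero x j = Ser.evalZero y j)
    (γ : ℕ × ℕ) (hγ : γ.1 + γ.2 < k) : x γ = y γ := by
  induction γ using weight_induction with
  | h γ ih =>
    have hlt : ∀ p : ℕ × ℕ, p.1 + p.2 < γ.1 + γ.2 → x p = y p := fun p hp => ih p hp (hp.trans hγ)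
    by_cases h0 : γ.1 = 0
    · obtain ⟨m, j⟩ := γ
      obtain rfl : m = 0 := h0
      rcases h with h | h
      · rw [evalZero_eq, evalZero_eq, h j (by simpa using hγ)]
        congr 1
        refine Finset.sum_congr rfl fun p hp => ?_
        obtain ⟨hp, hp0⟩ := Finset.mem_filter.1 hp
        rw [mem_antidiagonal] at hp
        exact hΦ.eq_of_forall_lt hx hy hp0 fun q hq => hlt q (by simpa [hp] using hq)
      · exact h j (by simpa using hγ)
    · exact hΦ.eq_of_forall_lt hx hy h0 hlt

theorem Causal.unique (hΦ : Causal Φ) {x y : Ser (ℕ × ℕ) V}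
    (hx : Ser.euler x = Ser.shift r (Φ x)) (hy : Ser.euler y = Ser.shift r (Φ y))
    (h : Ser.evalOne x = Ser.evalOne y ∨ Ser.evalZero x = Ser.evalZero y) : x = y := by
  refine Ser.ext' fun p => hΦ.eq_of_lt hx hy (k := p.1 + p.2 + 1) ?_ p (Nat.lt_succ_self _)
  rcases h with h | h
  · exact Or.inl fun j _ => by rw [h]
  · exact Or.inr fun j _ => by rw [h]

/-- A homogeneous linear equation with vanishing boundary value has only the zero solution. -/
theorem Causal.eq_zero (hΦ : Causal Φ) (h0 : Φ 0 = 0) {x : Ser (ℕ × ℕ) V}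
    (hx : Ser.euler x = Ser.shift r (Φ x)) (h : Ser.evalOne x = 0 ∨ Ser.evalZero x = 0) : x = 0 :=
  hΦ.unique hx (by rw [h0, map_zero, map_zero]) (by simpa using h)

theorem Causal.exists_of_evalOne (hΦ : Causal Φ) (r : ℕ) (b : Ser ℕ V) :
    ∃ x, Ser.euler x = Ser.shift r (Φ x) ∧ Ser.evalOne x = b := by
  obtain ⟨x, hx⟩ := exists_fixed_point (fun p : ℕ × ℕ => p.1 + p.2)
    (fun x : Ser (ℕ × ℕ) V => (⟨fun p =>
      if p.1 = 0 then b p.2 - ∑ q ∈ (antidiagonal p.2).filter (·.1 ≠ 0),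
        (q.1 : ℚ)⁻¹ • Ser.shift r (Φ x) q
      else (p.1 : ℚ)⁻¹ • Ser.shift r (Φ x) p⟩ : Ser (ℕ × ℕ) V)) (by
    rintro x y ⟨m, j⟩ h
    simp only
    split_ifs with hm
    · subst hm
      congr 1
      refine Finset.sum_congr rfl fun q hq => ?_
      have hq' := mem_antidiagonal.1 (Finset.mem_filter.1 hq).1
      rw [hΦ.shift_congr r fun p hp => h p (by simpa [hq'] using hp)]
    · rw [hΦ.shift_congr r h])
  have hpos : ∀ p : ℕ × ℕ, p.1 ≠ 0 → x p = (p.1 : ℚ)⁻¹ • Ser.shift r (Φ x) p := by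
    intro p hp
    conv_lhs => rw [← hx]
    simp [hp]
  refine ⟨x, Ser.ext' fun p => ?_, Ser.ext' fun k => ?_⟩
  · by_cases hp : p.1 = 0
    · rw [Ser.euler_apply, hp, zero_smul, Ser.shift_apply, if_neg]
      intro h
      have : 1 ≤ p.1 := h.1
      omega
    · rw [Ser.euler_apply, hpos p hp, ← Nat.cast_smul_eq_nsmul ℚ, smul_smul,
        mul_inv_cancel₀ (Nat.cast_ne_zero.2 hp), one_smul]
  · have h := evalZero_eq x k
    conv_lhs at h => rw [← hx]
    simp only [if_true] at h
    rw [Finset.sum_congr rfl fun q hq => (hpos q (Finset.mem_filter.1 hq).2).symm] at h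
    exact (sub_left_injective h).symm

theorem Causal.exists_of_evalZero (hΦ : Causal Φ) (r : ℕ) (b : Ser ℕ V) :
    ∃ x, Ser.euler x = Ser.shift r (Φ x) ∧ Ser.evalZero x = b := by
  obtain ⟨x, hx⟩ := exists_fixed_point (fun p : ℕ × ℕ => p.1 + p.2)
    (fun x : Ser (ℕ × ℕ) V => (⟨fun p =>
      if p.1 = 0 then b p.2 else (p.1 : ℚ)⁻¹ • Ser.shift r (Φ x) p⟩ : Ser (ℕ × ℕ) V)) (by
    rintro x y ⟨m, j⟩ h
    simp only
    split_ifs with hm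
    · rfl
    · rw [hΦ.shift_congr r h])
  refine ⟨x, Ser.ext' fun p => ?_, Ser.ext' fun k => ?_⟩
  · by_cases hp : p.1 = 0
    · rw [Ser.euler_apply, hp, zero_smul, Ser.shift_apply, if_neg]
      intro h
      have : 1 ≤ p.1 := h.1
      omega
    · have hpos : x p = (p.1 : ℚ)⁻¹ • Ser.shift r (Φ x) p := by
        conv_lhs => rw [← hx]
        simp [hp]
      rw [Ser.euler_apply, hpos, ← Nat.cast_smul_eq_nsmul ℚ, smul_smul,
        mul_inv_cancel₀ (Nat.cast_ne_zero.2 hp), one_smul]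
  · rw [Ser.evalZero_apply]
    conv_lhs => rw [← hx]
    simp

end Causal

theorem wordSer_causal {A V : Type*} [AddCommGroup A] [AddCommGroup V] (φ : List A → V) :
    Causal fun x : Ser (ℕ × ℕ) A => wordSer x φ :=
  fun _ _ _ h => wordSum_congr_left h

theorem wordSer₂_causal {A V : Type*} [AddCommGroup A] [AddCommGroup V] (φ : List A → V)
    (y x : Ser (ℕ × ℕ) A) : Causal fun h : Ser (ℕ × ℕ) A => wordSer₂ y h x φ :=
  fun _ _ _ h => wordSum₂_congr_middle h

theorem mul_causal {A : Type*} [NonUnitalRing A] (y : Ser (ℕ × ℕ) A) :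
    Causal fun x : Ser (ℕ × ℕ) A => y * x := by
  intro x x' γ h
  rw [Ser.mul_apply, Ser.mul_apply]
  exact Finset.sum_congr rfl fun pq hpq => by rw [h _ (weight_snd_le hpq)]

theorem Causal.sub {V W : Type*} [AddCommGroup W] {Φ Ψ : Ser (ℕ × ℕ) V → Ser (ℕ × ℕ) W}
    (hΦ : Causal Φ) (hΨ : Causal Ψ) : Causal fun x => Φ x - Ψ x := by
  intro x y γ h
  rw [Ser.sub_apply, Ser.sub_apply, hΦ x y γ h, hΨ x y γ h]

theorem Causal.const {V W : Type*} (w : Ser (ℕ × ℕ) W) : Causal fun _ : Ser (ℕ × ℕ) V => w :=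
  fun _ _ _ _ => rfl

/-! ### Twisting sequences and their homotopies as power series -/

section Twisting

variable {A : Type u} [DGAlgebra A]

theorem mem_gr_of_eq {k l : ℤ} {a : A} (ha : a ∈ gr k) (h : k = l) : a ∈ gr l := h ▸ ha

theorem isTwistingSequence_iff {x : Ser ℕ A} : IsTwistingSequence x.coeff ↔
    x 0 = 0 ∧ (∀ n : ℕ, x n ∈ gr (2 * n + 1 : ℤ)) ∧ dSer x + x * x = 0 :=
  ⟨fun h => ⟨h.zero, h.mem, Ser.ext' h.eqn⟩,
    fun h => ⟨h.1, h.2.1, fun n => congrArg (fun z : Ser ℕ A => z n) h.2.2⟩⟩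

/-- The series `h` is a homotopy from `x` to `y`. -/
structure IsHomotopy (h x y : Ser ℕ A) : Prop where
  zero : h 0 = 0
  mem : ∀ n : ℕ, h n ∈ gr (2 * n : ℤ)
  eqn : y - x + dSer h + (y * h - h * x) = 0

theorem homotopic_iff {x y : TS A} : Homotopic x y ↔ ∃ h, IsHomotopy h ⟨x.1⟩ ⟨y.1⟩ := by
  have key : ∀ (h : Ser ℕ A) (n : ℕ), ∑ ij ∈ antidiagonal n, (y.1 ij.2 * h ij.1 - h ij.1 * x.1 ij.2)
      = ((⟨y.1⟩ : Ser ℕ A) * h - h * ⟨x.1⟩) n := by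
    intro h n
    rw [Finset.sum_sub_distrib, Ser.sub_apply, Ser.mul_apply, Ser.mul_apply,
      ← Finset.HasAntidiagonal.map_swap_antidiagonal, Finset.sum_map]
    simp
  constructor
  · rintro ⟨h, h0, hm, he⟩
    refine ⟨⟨h⟩, h0, hm, Ser.ext' fun n => ?_⟩
    rw [Ser.add_apply, ← key]
    exact he n
  · rintro ⟨h, h0, hm, he⟩
    refine ⟨h.coeff, h0, hm, fun n => ?_⟩
    have h₁ := congrArg (fun z : Ser ℕ A => z n) he
    rw [key]
    exact h₁

/-- A twisting element in series in two variables, that is, a polynomial family of twisting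
sequences. -/
structure IsTwistingFamily (u : Ser (ℕ × ℕ) A) : Prop where
  zero : u 0 = 0
  degree : SerDegree 1 u
  eqn : dSer u + u * u = 0

theorem dSer_evalOne (u : Ser (ℕ × ℕ) A) : dSer (Ser.evalOne u) = Ser.evalOne (dSer u) :=
  Ser.ext' fun k => by
    rw [dSer_apply, Ser.evalOne_apply, map_sum]
    rfl

theorem dSer_evalZero (u : Ser (ℕ × ℕ) A) : dSer (Ser.evalZero u) = Ser.evalZero (dSer u) := rfl

theorem evalOne_mem {ε : ℤ} {u : Ser (ℕ × ℕ) A} (hu : SerDegree ε u) (n : ℕ) :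
    Ser.evalOne u n ∈ gr (2 * n + ε) := by
  rw [Ser.evalOne_apply]
  refine sum_mem fun p hp => ?_
  have h := hu p
  rwa [mem_antidiagonal.1 hp] at h

theorem evalZero_mem {ε : ℤ} {u : Ser (ℕ × ℕ) A} (hu : SerDegree ε u) (n : ℕ) :
    Ser.evalZero u n ∈ gr (2 * n + ε) := by
  have h := hu (0, n)
  simpa using h

theorem evalOne_zero (u : Ser (ℕ × ℕ) A) : Ser.evalOne u 0 = u 0 := by
  rw [Ser.evalOne_apply]
  simp
  rfl

theorem IsTwistingFamily.evalOne {u : Ser (ℕ × ℕ) A} (hu : IsTwistingFamily u) :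
    IsTwistingSequence (Ser.evalOne u).coeff := by
  refine isTwistingSequence_iff.2 ⟨by rw [evalOne_zero, hu.zero], evalOne_mem hu.degree, ?_⟩
  rw [dSer_evalOne, ← Ser.evalOne_mul, ← map_add, hu.eqn, map_zero]

theorem IsTwistingFamily.evalZero {u : Ser (ℕ × ℕ) A} (hu : IsTwistingFamily u) :
    IsTwistingSequence (Ser.evalZero u).coeff := by
  refine isTwistingSequence_iff.2 ⟨hu.zero, evalZero_mem hu.degree, ?_⟩
  rw [dSer_evalZero, ← Ser.evalZero_mul, ← map_add, hu.eqn, map_zero]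

end Twisting

/-! ### The flow of a cocycle -/

section Flow

variable {A : Type u} [HirschAlgebra A]

/-- The series `u` in `T` and `s` solves the differential equation
`du/ds = T ^ (r + 1) * ∑ l, E_{1,l}(a; u, …, u)`. Both sides are multiplied by `s`, and
`s * T ^ (r + 1)` is the monomial with exponent `(1, r)`. -/
def IsFlow (r : ℕ) (a : A) (u : Ser (ℕ × ℕ) A) : Prop :=
  Ser.euler u = Ser.shift r (wordSer u (opE a))

theorem rat_smul_mem [Module ℚ A] (q : ℚ) {k : ℤ} {a : A} (ha : a ∈ gr k) : q • a ∈ gr k := by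
  classical
  let e := LinearEquiv.ofBijective (DirectSum.coeLinearMap (gr : ℤ → Submodule ℤ A)) isInternal
  -- the projection to the component of degree `k` is additive, hence rational
  let π : A →+ A := ((gr k : Submodule ℤ A).subtype ∘ₗ
    DirectSum.component ℤ ℤ (fun k => (gr k : Submodule ℤ A)) k ∘ₗ
      e.symm.toLinearMap).toAddMonoidHom
  have h : π a = a := by
    have h₁ : e.symm a = DirectSum.lof ℤ ℤ (fun k => (gr k : Submodule ℤ A)) k ⟨a, ha⟩ := by
      rw [LinearEquiv.symm_apply_eq]
      exact (DirectSum.coeLinearMap_lof (gr : ℤ → Submodule ℤ A) k ⟨a, ha⟩).symm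
    change ((DirectSum.component ℤ ℤ (fun k => (gr k : Submodule ℤ A)) k (e.symm a) : gr k) : A) = a
    rw [h₁, DirectSum.component.lof_self]
  rw [← h, ← map_rat_smul π q a]
  exact SetLike.coe_mem _

variable [Module ℚ A] {r : ℕ} {a : A} {u : Ser (ℕ × ℕ) A}

/-- A solution of a differential equation is homogeneous if its boundary values are. -/
theorem serDegree_of_euler_eq {ε : ℤ} {Φ : Ser (ℕ × ℕ) A → Ser (ℕ × ℕ) A}
    (hu : Ser.euler u = Ser.shift r (Φ u))
    (hΦ : ∀ γ : ℕ × ℕ,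
      (∀ p : ℕ × ℕ, p.1 + p.2 ≤ γ.1 + γ.2 → u p ∈ gr (2 * ((p.1 + p.2 : ℕ) : ℤ) + ε)) →
        Φ u γ ∈ gr (2 * ((1 + r + (γ.1 + γ.2) : ℕ) : ℤ) + ε))
    (hb : (∀ n : ℕ, Ser.evalOne u n ∈ gr (2 * n + ε)) ∨
      ∀ n : ℕ, Ser.evalZero u n ∈ gr (2 * n + ε)) : SerDegree ε u := by
  intro γ
  induction γ using weight_induction with
  | h γ ih =>
    have hpos : ∀ p : ℕ × ℕ, p.1 + p.2 = γ.1 + γ.2 → p.1 ≠ 0 →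
        u p ∈ gr (2 * ((p.1 + p.2 : ℕ) : ℤ) + ε) := by
      intro p hp hp0
      have h : u p = (p.1 : ℚ)⁻¹ • Ser.shift r (Φ u) p := by
        rw [← hu, Ser.euler_apply, ← Nat.cast_smul_eq_nsmul ℚ, smul_smul,
          inv_mul_cancel₀ (Nat.cast_ne_zero.2 hp0), one_smul]
      rw [h]
      refine rat_smul_mem _ ?_
      by_cases hle : (1, r) ≤ p
      · obtain ⟨δ, rfl⟩ := exists_add_of_le hle
        rw [Ser.shift_add_apply]
        simp only [Prod.fst_add, Prod.snd_add] at hp ⊢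
        have h := hΦ δ fun q hq => ih q (by omega)
        exact mem_gr_of_eq h (by push_cast; ring)
      · rw [Ser.shift_apply, if_neg hle]
        exact zero_mem _
    by_cases h0 : γ.1 = 0
    · obtain ⟨m, k⟩ := γ
      obtain rfl : m = 0 := h0
      rcases hb with hb | hb
      · rw [evalZero_eq]
        refine sub_mem (by simpa using hb k) (sum_mem fun p hp => ?_)
        obtain ⟨hp, hp0⟩ := Finset.mem_filter.1 hp
        rw [mem_antidiagonal] at hp
        have h := hpos p (by simpa using hp) hp0
        simpa [hp] using h
      · simpa using hb k
    · exact hpos γ rfl h0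

theorem IsFlow.isTwistingFamily (hu : IsFlow r a u) (ha : a ∈ cocycles A (2 * (r + 1 : ℕ) + 1))
    (hb : IsTwistingSequence (Ser.evalOne u).coeff ∨ IsTwistingSequence (Ser.evalZero u).coeff) :
    IsTwistingFamily u := by
  have h0 : u 0 = 0 := by
    rcases hb with hb | hb
    · rw [← evalOne_zero]
      exact hb.zero
    · exact hb.zero
  have hdeg : SerDegree 1 u := by
    refine serDegree_of_euler_eq (Φ := fun u => wordSer u (opE a)) hu (fun γ hγ => ?_)
      (hb.imp (fun h => h.mem) fun h => h.mem)
    have h := wordSum_mem (opE_hasDegree ha.1) hγ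
    exact mem_gr_of_eq h (by push_cast; ring)
  refine ⟨h0, hdeg, ?_⟩
  have hα : Odd (2 * ((r + 1 : ℕ) : ℤ) + 1) := ⟨_, rfl⟩
  refine (wordSer₂_causal (opE a) u u).eq_zero (r := r) ?_ ?_ ?_
  · exact Ser.ext' fun γ => (opE_multiAdd a).wordSum₂_zero_middle u u γ
  · change Ser.euler (Ser.map _ u + u * u) = _
    rw [map_add, Ser.euler_mul, ← Ser.map_euler, hu, Ser.map_shift, Ser.shift_mul, Ser.mul_shift,
      ← map_add, ← map_add]
    congr 1
    have h := dSer_wordSer_of_odd hα ha h0 hdeg.isOdd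
    change dSer (wordSer u (opE a)) + _ = _
    rw [h]
    abel
  · refine hb.imp (fun h => ?_) fun h => ?_
    · rw [map_add, ← dSer_evalOne, Ser.evalOne_mul, (isTwistingSequence_iff.1 h).2.2]
    · rw [map_add, ← dSer_evalZero, Ser.evalZero_mul, (isTwistingSequence_iff.1 h).2.2]

/-- Flows of cohomologous cocycles carry homotopic twisting sequences to homotopic twisting
sequences. The homotopy `h` evolves according to
`dh/ds = T ^ (r + 1) * (∑ E_{1,i+1+j}(a; z, …, z, h, u, …, u) -
∑ E_{1,l}(b; z, …, z) * (1 + h))`. -/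
theorem IsFlow.exists_isHomotopy {a' b : A} {z : Ser (ℕ × ℕ) A} (hu : IsFlow r a u)
    (hz : IsFlow r a' z) (hut : IsTwistingFamily u) (hzt : IsTwistingFamily z)
    (ha : a ∈ cocycles A (2 * (r + 1 : ℕ) + 1)) (hb : b ∈ gr (2 * (r + 1 : ℕ)))
    (hab : a' = a + d b) {h₁ : Ser ℕ A} (hh₁ : IsHomotopy h₁ (Ser.evalOne u) (Ser.evalOne z)) :
    ∃ h₀, IsHomotopy h₀ (Ser.evalZero u) (Ser.evalZero z) := by
  obtain ⟨h, hh, hh1⟩ := Causal.exists_of_evalOne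
    (((wordSer₂_causal (opE a) z u).sub (Causal.const (wordSer z (opE b)))).sub
      (mul_causal (wordSer z (opE b)))) r h₁
  have hα : Odd (2 * ((r + 1 : ℕ) : ℤ) + 1) := ⟨_, rfl⟩
  have hβ : Even (2 * ((r + 1 : ℕ) : ℤ)) := even_two_mul _
  have hSdeg : ∀ γ : ℕ × ℕ, wordSum z (opE b) γ ∈
      gr (2 * ((γ.1 + γ.2 : ℕ) : ℤ) + 2 * (r + 1 : ℕ)) := fun γ =>
    wordSum_mem (opE_hasDegree hb) fun p _ => hzt.degree p
  have hdeg : SerDegree 0 h := by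
    refine serDegree_of_euler_eq (Φ := fun h => wordSer₂ z h u (opE a) - wordSer z (opE b) -
      wordSer z (opE b) * h) hh (fun γ hγ => ?_) (Or.inl fun n => ?_)
    · rw [Ser.sub_apply, Ser.sub_apply]
      refine sub_mem (sub_mem ?_ ?_) ?_
      · have h := wordSum₂_mem (opE_hasDegree ha.1) hzt.degree hut.degree hγ
        exact mem_gr_of_eq h (by push_cast; ring)
      · have h := hSdeg γ
        exact mem_gr_of_eq h (by push_cast; ring)
      · refine sum_mem fun p hp => ?_
        have h := mul_mem (hSdeg p.1) (hγ p.2 (weight_snd_le hp))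
        refine mem_gr_of_eq h ?_
        rw [← mem_antidiagonal.1 hp, Prod.fst_add, Prod.snd_add]
        push_cast
        ring
    · rw [hh1, add_zero]
      exact hh₁.mem n
  -- the defect of the homotopy relation satisfies a linear differential equation
  have hR : z - u + dSer h + (z * h - h * u) = 0 := by
    refine ((wordSer₂_causal (opE a) z u).sub (mul_causal (wordSer z (opE b)))).eq_zero
      (r := r) ?_ ?_ (Or.inl ?_)
    · rw [mul_zero, sub_zero]
      exact Ser.ext' fun γ => (opE_multiAdd a).wordSum₂_zero_middle z u γ
    · have hP : wordSer z (opE a) - wordSer u (opE a) = wordSer₂ z (z - u) u (opE a) :=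
        Ser.ext' fun γ => (opE_multiAdd a).wordSum_sub_wordSum z u γ (by rw [hzt.zero, hut.zero])
      have hsplit : wordSer₂ z (z - u + dSer h + (z * h - h * u)) u (opE a) =
          wordSer₂ z (z - u) u (opE a) + wordSer₂ z (dSer h + z * h - h * u) u (opE a) := by
        rw [add_assoc, ← add_sub_assoc]
        exact Ser.ext' fun γ => (opE_multiAdd a).wordSum₂_add_middle z _ _ u γ
      have hz' : Ser.euler z = Ser.shift r (wordSer z (opE a) + wordSer z (opE (d b))) := by
        rw [hz, hab]
        congr 1
        refine Ser.ext' fun γ => ?_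
        rw [Ser.add_apply, wordSer_apply, wordSer_apply, wordSer_apply, ← wordSum_add]
        congr 1
        funext L
        exact opE_add a (d b) L
      have hS : IsEven (wordSer z (opE b)) := fun γ =>
        ⟨_, (even_two_mul _).add hβ, hSdeg γ⟩
      have h₁ := dSer_wordSer₂ hα ha hzt.zero hut.zero hzt.degree.isOdd hut.degree.isOdd
        hdeg.isEven hzt.eqn hut.eqn
      have h₂ := dSer_wordSer_of_even hβ hb hzt.zero hzt.degree.isOdd hzt.eqn
      have h₃ := dSer_mul_of_isEven hS h
      have heuler : Ser.euler (dSer h) = Ser.shift r (dSer (wordSer₂ z h u (opE a) -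
          wordSer z (opE b) - wordSer z (opE b) * h)) := by
        rw [dSer, ← Ser.map_euler, hh, Ser.map_shift]
      rw [map_add, map_sub, map_add, map_sub, Ser.euler_mul, Ser.euler_mul, heuler, hh, hz', hu]
      simp only [Ser.shift_mul, Ser.mul_shift]
      simp only [← map_sub (Ser.shift r), ← map_add (Ser.shift r)]
      congr 1
      rw [hsplit, ← hP, map_sub, map_sub, h₁, h₃, h₂]
      simp only [mul_add, add_mul, mul_sub, sub_mul, mul_assoc]
      abel
    · simp only [map_add, map_sub, Ser.evalOne_mul, ← dSer_evalOne, hh1]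
      exact hh₁.eqn
  refine ⟨Ser.evalZero h, ?_, fun n => ?_, ?_⟩
  · have h0 : h 0 = 0 := by
      rw [← evalOne_zero, hh1]
      exact hh₁.zero
    exact h0
  · simpa using evalZero_mem hdeg n
  · rw [dSer_evalZero, ← Ser.evalZero_mul, ← Ser.evalZero_mul]
    simp only [← map_sub, ← map_add]
    rw [hR, map_zero]

end Flow

/-! ### Removing the leading terms of a twisting sequence -/

section Leading

variable {A : Type u} [DGAlgebra A] {x y h : Ser ℕ A} {n : ℕ}

theorem mul_apply_of_vanishing (hx : ∀ i < n, x i = 0) (hy : y 0 = 0) : (x * y) n = 0 := by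
  rw [Ser.mul_apply]
  refine Finset.sum_eq_zero fun ij hij => ?_
  rw [mem_antidiagonal] at hij
  by_cases hi : ij.1 < n
  · rw [hx _ hi, zero_mul]
  · rw [show ij.2 = 0 by omega, hy, mul_zero]

theorem mul_apply_of_vanishing' (hx : x 0 = 0) (hy : ∀ i < n, y i = 0) : (x * y) n = 0 := by
  rw [Ser.mul_apply]
  refine Finset.sum_eq_zero fun ij hij => ?_
  rw [mem_antidiagonal] at hij
  by_cases hi : ij.2 < n
  · rw [hy _ hi, mul_zero]
  · rw [show ij.1 = 0 by omega, hx, zero_mul]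

/-- The first nonzero term of a twisting sequence is a cocycle. -/
theorem leading_mem_cocycles (hx : IsTwistingSequence x.coeff) (h0 : ∀ i < n, x i = 0) :
    x n ∈ cocycles A (2 * n + 1) := by
  refine ⟨hx.mem n, ?_⟩
  have h : d (x n) + (x * x) n = 0 := hx.eqn n
  rwa [mul_apply_of_vanishing h0 hx.zero, add_zero] at h

/-- The leading terms of homotopic twisting sequences are cohomologous. -/
theorem IsHomotopy.leading (hh : IsHomotopy h x y) (hx : ∀ i < n, x i = 0)
    (hy : ∀ i < n, y i = 0) : y n = x n + d (-h n) := by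
  have e := congrArg (fun z : Ser ℕ A => z n) hh.eqn
  simp only [Ser.add_apply, Ser.sub_apply, Ser.zero_apply, dSer_apply,
    mul_apply_of_vanishing hy hh.zero, mul_apply_of_vanishing' hh.zero hx, sub_zero, add_zero] at e
  rw [map_neg]
  rw [sub_add_eq_add_sub, sub_eq_zero] at e
  rw [← e]
  abel

end Leading

section Step

variable {A : Type u} [HirschAlgebra A] [Module ℚ A]

theorem IsFlow.apply_of_le {r : ℕ} {a : A} {u : Ser (ℕ × ℕ) A} (hu : IsFlow r a u)
    {p : ℕ × ℕ} (hp0 : p.1 ≠ 0) (hp : p.1 + p.2 ≤ r + 1) :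
    u p = if p = (1, r) then a else 0 := by
  refine nsmul_right_injective_of_rat hp0 ?_
  rw [← Ser.euler_apply, hu]
  by_cases hle : (1, r) ≤ p
  · obtain ⟨δ, rfl⟩ := exists_add_of_le hle
    obtain ⟨m, j⟩ := δ
    simp only [Prod.fst_add, Prod.snd_add] at hp
    obtain rfl : m = 0 := by omega
    obtain rfl : j = 0 := by omega
    rw [Ser.shift_add_apply, ← Prod.zero_eq_mk, wordSer_apply, wordSum_zero_right]
    simp
  · rw [Ser.shift_apply, if_neg hle, if_neg, smul_zero]
    rintro rfl
    exact hle le_rfl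

theorem IsFlow.evalZero_of_le {r : ℕ} {a : A} {u : Ser (ℕ × ℕ) A} (hu : IsFlow r a u) {k : ℕ}
    (hk : k ≤ r) : Ser.evalZero u k = Ser.evalOne u k := by
  rw [Ser.evalZero_apply, evalZero_eq, sub_eq_self]
  refine Finset.sum_eq_zero fun p hp => ?_
  obtain ⟨hp, hp0⟩ := Finset.mem_filter.1 hp
  rw [mem_antidiagonal] at hp
  rw [hu.apply_of_le hp0 (by omega), if_neg]
  rintro rfl
  simp at hp
  omega

theorem IsFlow.evalZero_succ {r : ℕ} {a : A} {u : Ser (ℕ × ℕ) A} (hu : IsFlow r a u) :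
    Ser.evalZero u (r + 1) = Ser.evalOne u (r + 1) - a := by
  rw [Ser.evalZero_apply, evalZero_eq, Finset.sum_eq_single (1, r)]
  · rw [hu.apply_of_le (by simp) (by simp [add_comm]), if_pos rfl]
  · intro p hp hne
    obtain ⟨hp, hp0⟩ := Finset.mem_filter.1 hp
    rw [mem_antidiagonal] at hp
    rw [hu.apply_of_le hp0 hp.le, if_neg hne]
  · simp [add_comm]

/-- The solution of the flow equation with a given value at `s = 1`. -/
def flow (r : ℕ) (a : A) (x : Ser ℕ A) : Ser (ℕ × ℕ) A :=
  ((wordSer_causal (opE a)).exists_of_evalOne r x).choose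

theorem flow_isFlow (r : ℕ) (a : A) (x : Ser ℕ A) : IsFlow r a (flow r a x) :=
  ((wordSer_causal (opE a)).exists_of_evalOne r x).choose_spec.1

@[simp] theorem evalOne_flow (r : ℕ) (a : A) (x : Ser ℕ A) : Ser.evalOne (flow r a x) = x :=
  ((wordSer_causal (opE a)).exists_of_evalOne r x).choose_spec.2

theorem IsFlow.eq_flow {r : ℕ} {a : A} {u : Ser (ℕ × ℕ) A} (hu : IsFlow r a u) :
    flow r a (Ser.evalOne u) = u :=
  (wordSer_causal (opE a)).unique (flow_isFlow r a _) hu (Or.inl (evalOne_flow r a _))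

/-- Flow back from `s = 1` to `s = 0` along the vector field of the term `x (r + 1)`, which removes
this term if all terms before it are zero. -/
def step (r : ℕ) (x : Ser ℕ A) : Ser ℕ A := Ser.evalZero (flow r (x (r + 1)) x)

theorem IsFlow.step_eq {r : ℕ} {x : Ser ℕ A} {u : Ser (ℕ × ℕ) A} (hu : IsFlow r (x (r + 1)) u)
    (hx : Ser.evalOne u = x) : step r x = Ser.evalZero u := by
  have h := hu.eq_flow
  rw [hx] at h
  rw [step, h]

theorem step_of_le {r : ℕ} (x : Ser ℕ A) {k : ℕ} (hk : k ≤ r) : step r x k = x k := by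
  rw [step, (flow_isFlow r _ x).evalZero_of_le hk, evalOne_flow]

theorem step_succ (r : ℕ) (x : Ser ℕ A) : step r x (r + 1) = 0 := by
  rw [step, (flow_isFlow r _ x).evalZero_succ, evalOne_flow, sub_self]

theorem step_eq_self {r : ℕ} {x : Ser ℕ A} (hx : x (r + 1) = 0) : step r x = x := by
  let u : Ser (ℕ × ℕ) A := ⟨fun p => if p.1 = 0 then x p.2 else 0⟩
  have hu : IsFlow r (x (r + 1)) u := by
    have h : wordSer u (opE (x (r + 1))) = 0 := Ser.ext' fun γ => by
      rw [wordSer_apply, hx]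
      exact (congrArg (wordSum u · γ) (funext opE_zero)).trans (wordSum_zero u γ)
    rw [IsFlow, h, map_zero]
    refine Ser.ext' fun p => ?_
    by_cases hp : p.1 = 0 <;> simp [u, hp]
  have h1 : Ser.evalOne u = x := by
    refine Ser.ext' fun k => ?_
    have h := evalZero_eq u k
    rw [Finset.sum_eq_zero, sub_zero] at h
    · rw [← h]
      simp [u]
    · intro p hp
      simp [u, (Finset.mem_filter.1 hp).2]
  rw [hu.step_eq h1]
  exact Ser.ext' fun k => by simp [u]

/-- If two series agree below `k`, then a step does not change the difference of their terms at
`k`. -/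
theorem step_sub_step {r k : ℕ} (hk : r + 1 < k) {x y : Ser ℕ A} (h : ∀ i < k, x i = y i) :
    (∀ i < k, step r x i = step r y i) ∧ step r x k - step r y k = x k - y k := by
  have hx := flow_isFlow r (x (r + 1)) x
  have hy : IsFlow r (x (r + 1)) (flow r (y (r + 1)) y) := by
    rw [h _ hk]
    exact flow_isFlow _ _ _
  have hlt := (wordSer_causal (opE (x (r + 1)))).eq_of_lt hx hy (k := k)
    (Or.inl fun j hj => by rw [evalOne_flow, evalOne_flow, h j hj])
  refine ⟨fun i hi => hlt (0, i) (by simpa using hi), ?_⟩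
  rw [step, step, Ser.evalZero_apply, Ser.evalZero_apply, evalZero_eq, evalZero_eq, evalOne_flow,
    evalOne_flow, sub_sub_sub_comm, sub_eq_self, sub_eq_zero]
  refine Finset.sum_congr rfl fun p hp => ?_
  obtain ⟨hp, hp0⟩ := Finset.mem_filter.1 hp
  rw [mem_antidiagonal] at hp
  exact (wordSer_causal (opE (x (r + 1)))).eq_of_forall_lt hx hy hp0 fun q hq => hlt q (hp ▸ hq)

theorem isTwistingSequence_step {r : ℕ} {x : Ser ℕ A} (hx : IsTwistingSequence x.coeff)
    (h0 : ∀ i ≤ r, x i = 0) : IsTwistingSequence (step r x).coeff := by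
  refine ((flow_isFlow r _ x).isTwistingFamily ?_ (Or.inl ?_)).evalZero
  · exact leading_mem_cocycles hx fun i hi => h0 i (Nat.lt_succ_iff.1 hi)
  · rwa [evalOne_flow]

theorem exists_isHomotopy_step {r : ℕ} {h x y : Ser ℕ A} (hx : IsTwistingSequence x.coeff)
    (hy : IsTwistingSequence y.coeff) (hx0 : ∀ i ≤ r, x i = 0) (hy0 : ∀ i ≤ r, y i = 0)
    (hh : IsHomotopy h x y) : ∃ h', IsHomotopy h' (step r x) (step r y) := by
  have hx0' : ∀ i < r + 1, x i = 0 := fun i hi => hx0 i (Nat.lt_succ_iff.1 hi)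
  have hy0' : ∀ i < r + 1, y i = 0 := fun i hi => hy0 i (Nat.lt_succ_iff.1 hi)
  have ha := leading_mem_cocycles hx hx0'
  have hb := leading_mem_cocycles hy hy0'
  refine (flow_isFlow r _ x).exists_isHomotopy (flow_isFlow r _ y)
    ((flow_isFlow r _ x).isTwistingFamily ha (Or.inl ?_))
    ((flow_isFlow r _ y).isTwistingFamily hb (Or.inl ?_)) ha (neg_mem (hh.mem (r + 1)))
    (hh.leading hx0' hy0') (h₁ := h) ?_
  · rwa [evalOne_flow]
  · rwa [evalOne_flow]
  · rwa [evalOne_flow, evalOne_flow]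

/-- The series that arises from `x` by removing the terms at `1, …, r` one after the other. -/
def stage : ℕ → Ser ℕ A → Ser ℕ A
  | 0, x => x
  | r + 1, x => step r (stage r x)

theorem stage_spec {x : Ser ℕ A} (hx : IsTwistingSequence x.coeff) (r : ℕ) :
    IsTwistingSequence (stage r x).coeff ∧ ∀ i ≤ r, stage r x i = 0 := by
  induction r with
  | zero =>
    refine ⟨hx, fun i hi => ?_⟩
    obtain rfl := Nat.le_zero.1 hi
    exact hx.zero
  | succ r ih =>
    refine ⟨isTwistingSequence_step ih.1 ih.2, fun i hi => ?_⟩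
    rcases Nat.lt_or_eq_of_le hi with h | rfl
    · exact (step_of_le _ (Nat.lt_succ_iff.1 h)).trans (ih.2 i (Nat.lt_succ_iff.1 h))
    · exact step_succ r _

theorem exists_isHomotopy_stage {h x y : Ser ℕ A} (hx : IsTwistingSequence x.coeff)
    (hy : IsTwistingSequence y.coeff) (hh : IsHomotopy h x y) (r : ℕ) :
    ∃ h', IsHomotopy h' (stage r x) (stage r y) := by
  induction r with
  | zero => exact ⟨h, hh⟩
  | succ r ih =>
    obtain ⟨h', hh'⟩ := ih
    have hx' := stage_spec hx r
    have hy' := stage_spec hy r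
    exact exists_isHomotopy_step hx'.1 hy'.1 hx'.2 hy'.2 hh'

theorem stage_eq_self {n : ℕ} {x : Ser ℕ A} (hx : ∀ i, 1 ≤ i → i ≤ n → x i = 0) {r : ℕ}
    (hr : r ≤ n) : stage r x = x := by
  induction r with
  | zero => rfl
  | succ r ih =>
    rw [stage, ih (by omega), step_eq_self (hx _ (by omega) hr)]

theorem stage_sub_stage {n : ℕ} {x y : Ser ℕ A} (h : ∀ i < n, x i = y i) {r : ℕ} (hr : r < n) :
    (∀ i < n, stage r x i = stage r y i) ∧ stage r x n - stage r y n = x n - y n := by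
  induction r with
  | zero => exact ⟨h, rfl⟩
  | succ r ih =>
    obtain ⟨h₁, h₂⟩ := ih (by omega)
    obtain ⟨h₃, h₄⟩ := step_sub_step hr h₁
    exact ⟨h₃, h₄.trans h₂⟩

/-- The leading term of a twisting sequence at `n`, after the terms at `1, …, n - 1` have been
removed. -/
def leading (n : ℕ) (x : Ser ℕ A) : A := stage (n - 1) x n

theorem stage_pred_eq_zero {x : Ser ℕ A} (hx : IsTwistingSequence x.coeff) {i n : ℕ} (hi : i < n) :
    stage (n - 1) x i = 0 :=
  (stage_spec hx (n - 1)).2 i (by omega)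

theorem leading_mem {x : Ser ℕ A} (hx : IsTwistingSequence x.coeff) (n : ℕ) :
    leading n x ∈ cocycles A (2 * n + 1) :=
  leading_mem_cocycles (stage_spec hx (n - 1)).1 fun _ hi => stage_pred_eq_zero hx hi

theorem leading_homotopic {h x y : Ser ℕ A} (hx : IsTwistingSequence x.coeff)
    (hy : IsTwistingSequence y.coeff) (hh : IsHomotopy h x y) (n : ℕ) :
    ∃ b ∈ (gr (2 * n : ℤ) : Submodule ℤ A), leading n y = leading n x + d b := by
  obtain ⟨h', hh'⟩ := exists_isHomotopy_stage hx hy hh (n - 1)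
  exact ⟨-h' n, neg_mem (hh'.mem n), hh'.leading (fun _ hi => stage_pred_eq_zero hx hi)
    fun _ hi => stage_pred_eq_zero hy hi⟩

theorem leading_eq {n : ℕ} {x : Ser ℕ A} (hx : ∀ i, 1 ≤ i → i < n → x i = 0) :
    leading n x = x n := by
  rw [leading, stage_eq_self (n := n - 1) (fun i h₁ h₂ => hx i h₁ (by omega)) le_rfl]

theorem leading_sub_leading {n : ℕ} (hn : 1 ≤ n) {x y : Ser ℕ A} (h : ∀ i < n, x i = y i) :
    leading n x - leading n y = x n - y n :=
  (stage_sub_stage h (by omega)).2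

end Step

section Naturality

variable {A B : Type u} [HirschAlgebra A] [HirschAlgebra B] (f : HirschHom A B)

/-- A map of Hirsch algebras, applied to all coefficients of a series. -/
def HirschHom.ser {Γ : Type*} : Ser Γ A →+ Ser Γ B := Ser.map f.lin.toAddMonoidHom

@[simp] theorem HirschHom.ser_apply {Γ : Type*} (x : Ser Γ A) (p : Γ) :
    f.ser x p = f.lin (x p) := rfl

theorem HirschHom.lin_opE (a : A) (L : List A) : f.lin (opE a L) = opE (f.lin a) (L.map f.lin) := by
  rw [opE_eq (f.lin a) (L.map f.lin) (n := L.length) (by simp)]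
  refine (f.map_E 1 L.length _).trans ?_
  congr 1
  funext k
  rcases k with k | k
  · rfl
  · simp
    rfl

theorem HirschHom.ser_wordSer (a : A) (u : Ser (ℕ × ℕ) A) :
    f.ser (wordSer u (opE a)) = wordSer (f.ser u) (opE (f.lin a)) := by
  refine Ser.ext' fun γ => ?_
  refine (map_wordSum f.lin.toAddMonoidHom u (opE a) γ).trans ?_
  rw [wordSer_apply]
  refine (congrArg (wordSum u · γ) (funext fun L => f.lin_opE a L)).trans ?_
  exact (wordSum_map f.lin u (opE (f.lin a)) γ).symm

theorem HirschHom.isFlow {r : ℕ} {a : A} {u : Ser (ℕ × ℕ) A} (hu : IsFlow r a u) :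
    IsFlow r (f.lin a) (f.ser u) := by
  rw [IsFlow, ← f.ser_wordSer, HirschHom.ser, ← Ser.map_euler, ← Ser.map_shift, hu]

variable [Module ℚ A] [Module ℚ B]

theorem HirschHom.ser_step (r : ℕ) (x : Ser ℕ A) : f.ser (step r x) = step r (f.ser x) := by
  have h := f.isFlow (flow_isFlow r (x (r + 1)) x)
  rw [IsFlow.step_eq (x := f.ser x) h]
  · rfl
  · refine Ser.ext' fun k => ?_
    conv_rhs => rw [← evalOne_flow r (x (r + 1)) x]
    rw [HirschHom.ser_apply, Ser.evalOne_apply, Ser.evalOne_apply, map_sum]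
    rfl

theorem HirschHom.ser_stage (r : ℕ) (x : Ser ℕ A) : f.ser (stage r x) = stage r (f.ser x) := by
  induction r with
  | zero => rfl
  | succ r ih => rw [stage, stage, f.ser_step, ih]

theorem HirschHom.lin_leading (n : ℕ) (x : Ser ℕ A) :
    f.lin (leading n x) = leading n (f.ser x) := by
  rw [leading, leading, ← f.ser_stage]
  rfl

end Naturality

/-! ### The Kraines construction -/

section Kraines

variable {A : Type u} [HirschAlgebra A]

/-- Concatenation of words makes the bar construction a ring. -/
instance : NonUnitalRing (Bar A) :=
  { (inferInstance : AddCommGroup (Bar A)), (inferInstance : NonUnitalSemiring (Bar A)) with }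

theorem word_eq_prod (n : ℕ) (b : Fin n → A) :
    word (A := A) n b = (List.ofFn fun i => letterWord (A := A) (b i)).prod := by
  have h := TensorAlgebra.toDirectSum_tensorPower_tprod (R := ℤ) b
  rw [TensorAlgebra.tprod_apply, map_list_prod, List.map_ofFn] at h
  refine h.symm.trans (congrArg (fun f => (List.ofFn f).prod) (funext fun i => ?_))
  exact TensorAlgebra.toDirectSum_ι (b i)

/-- The word `[b₁ | ⋯ | bₗ]` in the bar construction, as a function of the list of its letters. -/
def listWord (L : List A) : Bar A := (L.map (letterWord (A := A))).prod

@[simp] theorem listWord_nil : listWord ([] : List A) = 1 := rfl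

theorem listWord_cons (b : A) (L : List A) :
    listWord (b :: L) = letterWord (A := A) b * listWord L := by
  rw [listWord, List.map_cons, List.prod_cons, listWord]

theorem listWord_ofFn (n : ℕ) (b : Fin n → A) : listWord (List.ofFn b) = word (A := A) n b := by
  rw [word_eq_prod, listWord, List.map_ofFn]
  rfl

theorem letter_listWord (L : List A) :
    letter (A := A) (listWord L) = match L with | [b] => b | _ => 0 := by
  have key : ∀ (n : ℕ) (b : Fin n → A), n ≠ 1 → letter (A := A) (word (A := A) n b) = 0 := by
    intro n b hn
    have h : DirectSum.component ℤ ℕ (fun n => ⨂[ℤ]^n A) 1 (word (A := A) n b) = 0 := by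
      rw [DirectSum.component, word]
      exact DFinsupp.single_eq_of_ne hn.symm
    rw [letter, LinearMap.comp_apply, h, map_zero]
  have hL : listWord L = word (A := A) L.length L.get := by rw [← listWord_ofFn]; simp
  match L with
  | [] => rw [hL]; exact key 0 _ (by simp)
  | [b] =>
    rw [hL]
    have h : DirectSum.component ℤ ℕ (fun n => ⨂[ℤ]^n A) 1 (word (A := A) 1 [b].get) =
      PiTensorProduct.tprod ℤ [b].get :=
      DirectSum.component.lof_self ℤ (M := fun n => ⨂[ℤ]^n A) 1 _
    rw [letter, LinearMap.comp_apply]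
    erw [h]
    exact PiTensorProduct.subsingletonEquiv_apply_tprod ..
  | _ :: _ :: _ => rw [hL]; exact key _ _ (by simp)

/-- The functional `φ` applied to an initial part of a word, as a letter followed by the remaining
part of the word, summed over all initial parts. -/
def headWord (φ : List A → A) (L : List A) : Bar A :=
  ∑ l ∈ Finset.range (L.length + 1), letterWord (A := A) (φ (L.take l)) * listWord (L.drop l)

theorem headWord_nil (φ : List A → A) : headWord φ [] = letterWord (A := A) (φ []) := by
  simp [headWord]

theorem headWord_cons (φ : List A → A) (b : A) (L : List A) :
    headWord φ (b :: L) =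
      letterWord (A := A) (φ []) * listWord (b :: L) + headWord (fun L => φ (b :: L)) L := by
  rw [headWord, List.length_cons, Finset.sum_range_succ', add_comm]
  rfl

theorem leftMul_listWord (a : A) (L : List A) :
    leftMul a (listWord L) = ∑ i ∈ Finset.range (L.length + 1),
      listWord (L.take i) * headWord (opE a) (L.drop i) := by
  obtain ⟨n, b, rfl⟩ : ∃ (n : ℕ) (b : Fin n → A), L = List.ofFn b := ⟨_, L.get, by simp⟩
  have htake : ∀ i : Fin (n + 1), word (A := A) i (fun k => b ⟨k, by omega⟩) =
      listWord ((List.ofFn b).take i) := by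
    intro i
    rw [← listWord_ofFn]
    congr 1
    exact List.ext_getElem (by simp; omega) fun k h₁ h₂ => by simp
  have hmid : ∀ (i : Fin (n + 1)) (l : Fin (n + 1 - i)), word (A := A) 1 (fun _ => E 1 l
      (Sum.elim (fun _ => a) (fun k : Fin l => b ⟨i + k, by omega⟩))) =
      letterWord (A := A) (opE a (((List.ofFn b).drop i).take l)) := by
    intro i l
    rw [← opE_ofFn]
    change letterWord (A := A) _ = _
    congr 2
    exact List.ext_getElem (by simp; omega) fun k h₁ h₂ => by simp
  have hdrop : ∀ (i : Fin (n + 1)) (l : Fin (n + 1 - i)),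
      word (A := A) (n - i - l) (fun k => b ⟨i + l + k, by omega⟩) =
      listWord (((List.ofFn b).drop i).drop l) := by
    intro i l
    rw [← listWord_ofFn]
    congr 1
    exact List.ext_getElem (by simp; omega) fun k h₁ h₂ => by simp [add_assoc]
  rw [listWord_ofFn, leftMul_word, List.length_ofFn, ← Fin.sum_univ_eq_sum_range fun i =>
    listWord ((List.ofFn b).take i) * headWord (opE a) ((List.ofFn b).drop i)]
  refine Finset.sum_congr rfl fun i _ => ?_
  have hlen : ((List.ofFn b).drop i).length + 1 = n + 1 - i := by
    simp
    omega
  rw [headWord, hlen, ← Fin.sum_univ_eq_sum_range fun l =>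
    letterWord (A := A) (opE a (((List.ofFn b).drop i).take l)) *
      listWord (((List.ofFn b).drop i).drop l),
    Finset.mul_sum]
  refine Finset.sum_congr rfl fun l _ => ?_
  rw [htake, hmid, hdrop, mul_assoc]

/-- The block that is multiplied with `[a]` starts at the first letter or later. -/
theorem leftMul_listWord_cons (a b : A) (L : List A) :
    leftMul a (listWord (b :: L)) =
      headWord (opE a) (b :: L) + letterWord (A := A) b * leftMul a (listWord L) := by
  rw [leftMul_listWord, List.length_cons, Finset.sum_range_succ', add_comm, leftMul_listWord,
    Finset.mul_sum]
  congr 1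
  · simp
  · refine Finset.sum_congr rfl fun i _ => ?_
    rw [List.take_succ_cons, listWord_cons, mul_assoc, List.drop_succ_cons]

/-- In a word sum of `headWord φ` the initial part and the remaining part of a word vary
independently. -/
theorem wordSum_headWord {φ : List A → A} (hφ : MultiAdd φ) {u : Ser (ℕ × ℕ) A} (hu : u 0 = 0)
    (γ : ℕ × ℕ) : wordSum u (headWord φ) γ =
      (wordSer u (fun L => letterWord (A := A) (φ L)) * wordSer u listWord) γ := by
  induction γ using weight_induction generalizing φ with
  | h γ ih =>
    have hψ : MultiAdd fun L => letterWord (A := A) (φ L) := fun L₁ L₂ b c => by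
      beta_reduce
      rw [hφ, map_add]
    have key : ∀ pq ∈ (antidiagonal γ).filter (·.1 ≠ 0),
        wordSum u (fun L => headWord φ (u pq.1 :: L)) pq.2 =
          letterWord (A := A) (φ []) * wordSum u (fun L => listWord (u pq.1 :: L)) pq.2 +
          (wordSer u (fun L => letterWord (A := A) (φ (u pq.1 :: L))) *
            wordSer u listWord) pq.2 := by
      intro pq hpq
      simp only [headWord_cons, wordSum_add]
      rw [ih _ (weight_lt hpq) (hφ.cons _)]
      congr 1
      exact (map_wordSum (AddMonoidHom.mulLeft (letterWord (A := A) (φ []))) u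
        (fun L => listWord (u pq.1 :: L)) pq.2).symm
    rw [wordSer_mul_apply hψ hu, wordSum_eq, headWord_nil, Finset.sum_congr rfl key,
      Finset.sum_add_distrib, ← add_assoc]
    congr 1
    rw [wordSer_apply, wordSum_eq u listWord, mul_add, Finset.mul_sum]
    congr 1
    split_ifs <;> simp

section Flow

variable {r : ℕ} {a : A} {u : Ser (ℕ × ℕ) A}

theorem wordSer_listWord_apply (hu : u 0 = 0) (γ : ℕ × ℕ) :
    wordSer u listWord γ = (if γ = 0 then 1 else 0) +
      (Ser.map (letterWord (A := A)).toAddMonoidHom u * wordSer u listWord) γ := by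
  rw [wordSer_apply, wordSum_eq, Ser.mul_apply, listWord_nil]
  congr 1
  rw [← sum_filter_ne_zero γ fun p q => Ser.map (letterWord (A := A)).toAddMonoidHom u p *
    wordSer u listWord q]
  · refine Finset.sum_congr rfl fun pq _ => ?_
    simp only [listWord_cons]
    exact (map_wordSum (AddMonoidHom.mulLeft (letterWord (A := A) (u pq.1))) u listWord pq.2).symm
  · intro q
    rw [Ser.map_apply, hu, map_zero, zero_mul]

theorem map_leftMul_wordSer (a : A) (hu : u 0 = 0) :
    Ser.map (leftMul a).toAddMonoidHom (wordSer u listWord) =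
      Ser.map (letterWord (A := A)).toAddMonoidHom (wordSer u (opE a)) * wordSer u listWord +
      Ser.map (letterWord (A := A)).toAddMonoidHom u *
        Ser.map (leftMul a).toAddMonoidHom (wordSer u listWord) := by
  have hmap : ∀ γ, Ser.map (leftMul a).toAddMonoidHom (wordSer u listWord) γ =
      wordSum u (fun L => leftMul a (listWord L)) γ := fun γ =>
    map_wordSum (leftMul a).toAddMonoidHom u listWord γ
  refine Ser.ext' fun γ => ?_
  have h₁ : Ser.map (letterWord (A := A)).toAddMonoidHom (wordSer u (opE a)) =
      wordSer u (fun L => letterWord (A := A) (opE a L)) :=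
    Ser.ext' fun γ => map_wordSum (letterWord (A := A)).toAddMonoidHom u (opE a) γ
  rw [h₁, Ser.add_apply, ← wordSum_headWord (opE_multiAdd a) hu, hmap, wordSum_eq,
    wordSum_eq u (headWord _), add_assoc]
  congr 1
  · rw [leftMul_listWord]
    simp
  · rw [Ser.mul_apply, ← sum_filter_ne_zero γ fun p q =>
      Ser.map (letterWord (A := A)).toAddMonoidHom u p *
        Ser.map (leftMul a).toAddMonoidHom (wordSer u listWord) q, ← Finset.sum_add_distrib]
    · refine Finset.sum_congr rfl fun pq _ => ?_
      rw [hmap]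
      simp only [leftMul_listWord_cons, wordSum_add]
      congr 1
      exact (map_wordSum (AddMonoidHom.mulLeft (letterWord (A := A) (u pq.1))) u _ pq.2).symm
    · intro q
      rw [Ser.map_apply, hu, map_zero, zero_mul]

/-- The series `∑ l, [u | ⋯ | u]` of words in a flow evolves by left multiplication by `[a]`. -/
theorem IsFlow.euler_wordSer (hflow : IsFlow r a u) (hu : u 0 = 0) :
    Ser.euler (wordSer u listWord) =
      Ser.shift r (Ser.map (leftMul a).toAddMonoidHom (wordSer u listWord)) := by
  have h₁ : Ser.euler (wordSer u listWord) =
      Ser.shift r (Ser.map (letterWord (A := A)).toAddMonoidHom (wordSer u (opE a)) *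
        wordSer u listWord) +
      Ser.map (letterWord (A := A)).toAddMonoidHom u * Ser.euler (wordSer u listWord) := by
    rw [← Ser.shift_mul, ← Ser.map_shift, ← hflow, Ser.map_euler, ← Ser.euler_mul]
    refine Ser.ext' fun γ => ?_
    rw [Ser.euler_apply, Ser.euler_apply, wordSer_listWord_apply hu]
    split_ifs with h
    · simp [h]
    · rw [zero_add]
  have h₂ := congrArg (Ser.shift (V := Bar A) r) (map_leftMul_wordSer (u := u) a hu)
  rw [map_add, ← Ser.mul_shift r (Ser.map (letterWord (A := A)).toAddMonoidHom u)] at h₂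
  refine Ser.ext' fun γ => ?_
  -- both sides satisfy the same recursion on the total degree
  induction γ using weight_induction with
  | h γ ih =>
    rw [h₁, h₂, Ser.add_apply, Ser.add_apply, Ser.mul_apply, Ser.mul_apply]
    refine congrArg₂ (· + ·) rfl (Finset.sum_congr rfl fun pq hpq => ?_)
    by_cases hp : pq.1 = 0
    · rw [hp, Ser.map_apply, hu, map_zero, zero_mul, zero_mul]
    · rw [ih pq.2 (weight_lt (Finset.mem_filter.2 ⟨hpq, hp⟩))]

/-- For the flow of `a` that starts at zero, the series of words is
`∑ m, a_m / m! * (s * T ^ (r + 1)) ^ m`. -/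
theorem IsFlow.factorial_smul_wordSer (hflow : IsFlow r a u) (h0 : Ser.evalZero u = 0) (m j : ℕ) :
    m.factorial • wordSer u listWord (m, j) = if j = r * m then barPow a m else 0 := by
  have h0' : ∀ k, u (0, k) = 0 := fun k => congrArg (fun z : Ser ℕ A => z k) h0
  have hu : u 0 = 0 := h0' 0
  induction m generalizing j with
  | zero =>
    rw [Nat.factorial_zero, one_smul, wordSer_listWord_apply hu, Ser.mul_apply,
      Finset.sum_eq_zero, add_zero]
    · have h : barPow a 0 = 1 := by rw [barPow, word_eq_prod]; simp
      simp [h, Prod.ext_iff]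
    · rintro ⟨⟨m, p⟩, q⟩ hpq
      obtain rfl : m = 0 := by
        have h := congrArg Prod.fst (mem_antidiagonal.1 hpq)
        simp only [Prod.fst_add] at h
        omega
      rw [Ser.map_apply, h0', map_zero, zero_mul]
  | succ m ih =>
    have h := congrArg (fun z : Ser (ℕ × ℕ) (Bar A) => z (m + 1, j)) (hflow.euler_wordSer hu)
    simp only [Ser.euler_apply] at h
    rw [Nat.factorial_succ, mul_comm, mul_smul, h]
    by_cases hj : r ≤ j
    · obtain ⟨j, rfl⟩ := Nat.exists_eq_add_of_le hj
      have hp : (m + 1, r + j) = (1, r) + (m, j) := by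
        rw [Prod.mk_add_mk, add_comm 1 m]
      rw [hp, Ser.shift_add_apply, Ser.map_apply, ← map_nsmul, ih]
      simp only [mul_add, mul_one, add_comm r j, add_left_inj]
      split_ifs
      · rfl
      · exact map_zero _
    · rw [Ser.shift_apply, if_neg fun hle => hj hle.2, smul_zero, if_neg]
      rintro rfl
      exact hj (Nat.le_mul_of_pos_right r (Nat.succ_pos m))

theorem letter_wordSer (u : Ser (ℕ × ℕ) A) (hu : u 0 = 0) (γ : ℕ × ℕ) :
    letter (A := A) (wordSer u listWord γ) = u γ := by
  have h := map_wordSum (letter (A := A)).toAddMonoidHom u listWord γ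
  refine h.trans ?_
  have key : ∀ (b : A), (fun L => letter (A := A) (listWord (b :: L))) =
      fun L => if L = [] then b else 0 := by
    intro b
    funext L
    rw [letter_listWord]
    cases L <;> simp
  have hnil : letter (A := A) (listWord ([] : List A)) = 0 := letter_listWord []
  rw [wordSum_eq]
  change (if γ = 0 then letter (A := A) (listWord ([] : List A)) else 0) +
    ∑ pq ∈ (antidiagonal γ).filter (·.1 ≠ 0),
      wordSum u (fun L => letter (A := A) (listWord (u pq.1 :: L))) pq.2 = _
  simp only [key, wordSum_ite_nil, hnil, ite_self, zero_add]
  rw [sum_filter_ne_zero γ fun p q => if q = 0 then u p else 0,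
    sum_antidiagonal_ite' γ fun p => u p]
  simp [hu]

theorem isTwistingSequence_zero : IsTwistingSequence (0 : Ser ℕ A).coeff :=
  isTwistingSequence_iff.2 ⟨rfl, fun _ => zero_mem _, by rw [mul_zero, add_zero]; exact map_zero _⟩

variable [Module ℚ A]

/-- The Kraines construction is the value at `s = 1` of the flow of `a` that starts at zero. -/
theorem IsFlow.evalOne_eq_kraines (hflow : IsFlow r a u) (h0 : Ser.evalZero u = 0) :
    Ser.evalOne u = ⟨kraines (r + 1) a⟩ := by
  have hu : u 0 = 0 := congrArg (fun z : Ser ℕ A => z 0) h0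
  have key : ∀ m j, u (m, j) =
      if j = r * m then ((m.factorial : ℚ)⁻¹) • letter (A := A) (barPow a m) else 0 := by
    intro m j
    refine nsmul_right_injective_of_rat m.factorial_ne_zero ?_
    rw [← letter_wordSer u hu, ← map_nsmul, hflow.factorial_smul_wordSer h0]
    split_ifs
    · rw [← Nat.cast_smul_eq_nsmul ℚ, smul_smul,
        mul_inv_cancel₀ (Nat.cast_ne_zero.2 m.factorial_ne_zero), one_smul]
    · rw [map_zero, smul_zero]
  refine Ser.ext' fun k => ?_
  rw [Ser.evalOne_apply]
  change _ = kraines (r + 1) a k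
  rw [kraines]
  split_ifs with hk
  · obtain ⟨m, rfl⟩ := hk
    rw [Nat.mul_div_cancel_left m (Nat.succ_pos r), Finset.sum_eq_single (m, r * m)]
    · rw [key, if_pos rfl]
    · rintro ⟨i, j⟩ hij hne
      rw [key, if_neg]
      rintro rfl
      rw [mem_antidiagonal] at hij
      have h : (r + 1) * i = (r + 1) * m := by rw [← hij]; ring
      obtain rfl := Nat.eq_of_mul_eq_mul_left (Nat.succ_pos r) h
      exact hne rfl
    · intro h
      exact absurd (mem_antidiagonal.2 (by ring)) h
  · refine Finset.sum_eq_zero fun ⟨i, j⟩ hij => ?_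
    rw [key, if_neg]
    rintro rfl
    rw [mem_antidiagonal] at hij
    exact hk ⟨i, by rw [← hij]; ring⟩

theorem exists_flow_kraines (r : ℕ) (a : A) : ∃ u : Ser (ℕ × ℕ) A,
    IsFlow r a u ∧ Ser.evalZero u = 0 ∧ Ser.evalOne u = ⟨kraines (r + 1) a⟩ := by
  obtain ⟨u, hu, h0⟩ := (wordSer_causal (opE a)).exists_of_evalZero r 0
  exact ⟨u, hu, h0, IsFlow.evalOne_eq_kraines hu h0⟩

theorem isTwistingSequence_kraines (ha : a ∈ cocycles A (2 * (r + 1 : ℕ) + 1)) :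
    IsTwistingSequence (kraines (r + 1) a) := by
  obtain ⟨u, hu, h0, h1⟩ := exists_flow_kraines r a
  have h := (hu.isTwistingFamily ha (Or.inr (by rw [h0]; exact isTwistingSequence_zero))).evalOne
  rwa [h1] at h

theorem kraines_of_le {k : ℕ} (hk : k ≤ r) : kraines (r + 1) a k = 0 := by
  obtain ⟨u, hu, h0, h1⟩ := exists_flow_kraines r a
  have h := hu.evalZero_of_le hk
  rw [h0, h1] at h
  exact h.symm

theorem kraines_self : kraines (r + 1) a (r + 1) = a := by
  obtain ⟨u, hu, h0, h1⟩ := exists_flow_kraines r a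
  have h := hu.evalZero_succ
  rw [h0, h1] at h
  exact sub_eq_zero.1 h.symm

theorem step_kraines : step r ⟨kraines (r + 1) a⟩ = 0 := by
  obtain ⟨u, hu, h0, h1⟩ := exists_flow_kraines r a
  rw [← h0]
  refine IsFlow.step_eq ?_ h1
  change IsFlow r (kraines (r + 1) a (r + 1)) u
  rwa [kraines_self]

theorem leading_kraines (n m : ℕ) :
    leading m ⟨kraines (n + 1) a⟩ = if m = n + 1 then a else 0 := by
  have hle : ∀ i, 1 ≤ i → i ≤ n → (⟨kraines (n + 1) a⟩ : Ser ℕ A) i = 0 :=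
    fun i _ hi => kraines_of_le hi
  split_ifs with h
  · subst h
    rw [leading_eq fun i h₁ h₂ => hle i h₁ (by omega)]
    exact kraines_self
  · by_cases hm : m ≤ n
    · rw [leading_eq fun i h₁ h₂ => hle i h₁ (by omega)]
      exact kraines_of_le hm
    · have hst : ∀ r, stage (n + 1 + r) (⟨kraines (n + 1) a⟩ : Ser ℕ A) = 0 := by
        intro r
        induction r with
        | zero => rw [add_zero, stage, stage_eq_self hle le_rfl, step_kraines]
        | succ r ih => rw [← add_assoc, stage, ih, step_eq_self rfl]
      obtain ⟨k, rfl⟩ := Nat.exists_eq_add_of_le (show n + 2 ≤ m by omega)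
      rw [leading, show n + 2 + k - 1 = n + 1 + k by omega, hst]
      rfl

end Flow

end Kraines

/-! ### Cohomology of the rationalization -/

section Rational

open Rationalization

/-- The kernel of `M → M_ℚ` is the torsion of `M`. -/
theorem exists_zsmul_eq_zero_of_mk_eq_zero {M : Type*} [AddCommGroup M] {a : M}
    (h : mk 1 a = 0) : ∃ N : ℤ, N ≠ 0 ∧ N • a = 0 := by
  have h' : TensorProduct.mk ℤ ℚ M 1 a = 0 := h
  rw [IsLocalizedModule.eq_zero_iff (nonZeroDivisors ℤ)] at h'
  obtain ⟨N, hN⟩ := h'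
  exact ⟨N, nonZeroDivisors.coe_ne_zero N, hN⟩

theorem mk_zsmul {M : Type*} [AddCommGroup M] (q : ℚ) (N : ℤ) (a : M) :
    mk q (N • a) = mk (q * N) a := by
  rw [← mkHom_apply, map_zsmul, mkHom_apply, ← Int.cast_smul_eq_zsmul ℚ, smul_mk, mul_comm]

theorem tmul_zsmul {M : Type*} [AddCommGroup M] (q : ℚ) (N : ℤ) (a : M) :
    (N • a) ⊗ₜ[ℤ] q = a ⊗ₜ[ℤ] (q * N) := by
  rw [TensorProduct.smul_tmul, zsmul_eq_mul, mul_comm]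

theorem exists_eq_tmul {M : Type*} [AddCommGroup M] (z : M ⊗[ℤ] ℚ) :
    ∃ (a : M) (q : ℚ), z = a ⊗ₜ q := by
  obtain ⟨q, a, h⟩ := exists_mk' (M := M) (TensorProduct.comm ℤ M ℚ z)
  refine ⟨a, q, ?_⟩
  rw [← (TensorProduct.comm ℤ M ℚ).symm_apply_apply z]
  exact congrArg (TensorProduct.comm ℤ M ℚ).symm h

theorem eq_zero_of_tmul_one_eq_zero {M : Type*} [AddCommGroup M] [IsAddTorsionFree M] {a : M}
    (h : a ⊗ₜ[ℤ] (1 : ℚ) = 0) : a = 0 := by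
  have h' : mk 1 a = 0 := congrArg (TensorProduct.comm ℤ M ℚ) h
  obtain ⟨N, hN, h''⟩ := exists_zsmul_eq_zero_of_mk_eq_zero h'
  exact (smul_eq_zero.1 h'').resolve_left hN

variable {A B : Type u}

section Cohomology

theorem cls_eq_zero_iff [DGAlgebra A] {k : ℤ} {z : A} (hz : z ∈ cocycles A k) :
    cls z hz = 0 ↔ z ∈ coboundaries A k := by
  rw [cls, Submodule.Quotient.mk_eq_zero]
  rfl

theorem cls_eq_cls_iff [DGAlgebra A] {k : ℤ} {z w : A} (hz : z ∈ cocycles A k)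
    (hw : w ∈ cocycles A k) : cls z hz = cls w hw ↔ z - w ∈ coboundaries A k := by
  rw [cls, cls, Submodule.Quotient.eq]
  rfl

theorem mk_mem_cocycles [DGAlgebra A] (q : ℚ) {k : ℤ} {z : A} (hz : z ∈ cocycles A k) :
    mk q z ∈ cocycles (Rationalization A) k := by
  refine ⟨mk_mem q hz.1, ?_⟩
  have h : d z = 0 := hz.2
  change d (mk q z) = 0
  rw [d_mk, h, ← mkHom_apply, map_zero]

theorem mk_mem_coboundaries [DGAlgebra A] (q : ℚ) {k : ℤ} {z : A} (hz : z ∈ coboundaries A k) :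
    mk q z ∈ coboundaries (Rationalization A) k := by
  obtain ⟨w, hw, rfl⟩ := hz
  exact ⟨mk q w, mk_mem q hw, d_mk q w⟩

/-- The map `[z] ↦ [q ⊗ z]` in cohomology. -/
def cohomologyMk (A : Type u) [DGAlgebra A] (k : ℤ) (q : ℚ) :
    Cohomology A k →ₗ[ℤ] Cohomology (Rationalization A) k :=
  Submodule.mapQ _ _ ((mkHom q).restrict fun _ hz => mk_mem_cocycles q hz)
    fun _ hz => mk_mem_coboundaries q hz

theorem cohomologyMk_cls [DGAlgebra A] {k : ℤ} (q : ℚ) {z : A} (hz : z ∈ cocycles A k) :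
    cohomologyMk A k q (cls z hz) = cls (mk q z) (mk_mem_cocycles q hz) := rfl

theorem exists_cls [DGAlgebra A] {k : ℤ} (ζ : Cohomology A k) : ∃ z hz, ζ = cls z hz := by
  obtain ⟨⟨z, hz⟩, rfl⟩ := Submodule.Quotient.mk_surjective _ ζ
  exact ⟨z, hz, rfl⟩

/-- The comparison map `H^k(A) ⊗ ℚ → H^k(A_ℚ)`, `[z] ⊗ q ↦ [q ⊗ z]`. -/
def compare (A : Type u) [DGAlgebra A] (k : ℤ) :
    Cohomology A k ⊗[ℤ] ℚ →ₗ[ℤ] Cohomology (Rationalization A) k :=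
  TensorProduct.lift <| LinearMap.flip <| AddMonoidHom.toIntLinearMap <|
    AddMonoidHom.mk' (cohomologyMk A k) fun q r => by
      refine LinearMap.ext fun ζ => ?_
      obtain ⟨z, hz, rfl⟩ := exists_cls ζ
      rw [LinearMap.add_apply, cohomologyMk_cls, cohomologyMk_cls, cohomologyMk_cls]
      refine congrArg (Submodule.Quotient.mk (p := (coboundaries (Rationalization A) k).comap _)) ?_
      exact Subtype.ext (add_mk q r z)

theorem compare_cls_tmul [DGAlgebra A] {k : ℤ} {z : A} (hz : z ∈ cocycles A k) (q : ℚ) :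
    compare A k (cls z hz ⊗ₜ q) = cls (mk q z) (mk_mem_cocycles q hz) := rfl

theorem compare_injective (A : Type u) [DGAlgebra A] (k : ℤ) :
    Function.Injective (compare A k) := by
  rw [injective_iff_map_eq_zero]
  intro ζ h
  obtain ⟨ζ, q, rfl⟩ := exists_eq_tmul ζ
  obtain ⟨z, hz, rfl⟩ := exists_cls ζ
  rw [compare_cls_tmul, cls_eq_zero_iff] at h
  by_cases hq : q = 0
  · rw [hq, TensorProduct.tmul_zero]
  obtain ⟨w, hw, hwz⟩ := h
  obtain ⟨r, w, hw', rfl⟩ := exists_mk hw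
  rw [d_mk] at hwz
  -- clear denominators in `q ⊗ z = r ⊗ d w`
  have h₁ : mk 1 ((q.num * r.den) • z - (r.num * q.den) • d w) = 0 := by
    rw [← mkHom_apply, map_sub, mkHom_apply, mkHom_apply, mk_zsmul, mk_zsmul]
    have hq' : (1 : ℚ) * ((q.num * r.den : ℤ) : ℚ) = (q.den * r.den) * q := by
      push_cast
      nth_rewrite 3 [← Rat.num_div_den q]
      field_simp
    have hr' : (1 : ℚ) * ((r.num * q.den : ℤ) : ℚ) = (q.den * r.den) * r := by
      push_cast
      nth_rewrite 3 [← Rat.num_div_den r]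
      field_simp
    rw [hq', hr', ← smul_mk, ← smul_mk, hwz, sub_self]
  obtain ⟨N, hN, h₂⟩ := exists_zsmul_eq_zero_of_mk_eq_zero h₁
  have hM : N * (q.num * r.den) ≠ 0 := by
    simp [hN, hq]
  have h₃ : (N * (q.num * r.den)) • cls z hz = 0 := by
    have hz' : (N * (q.num * r.den)) • z ∈ cocycles A k := Submodule.smul_mem _ _ hz
    refine ((cls_eq_zero_iff hz').2 ⟨(N * (r.num * q.den)) • w, Submodule.smul_mem _ _ hw', ?_⟩ : _)
    rw [map_zsmul, mul_smul, mul_smul N, eq_comm, ← sub_eq_zero, ← smul_sub, h₂]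
  have hM' : ((N * (q.num * r.den) : ℤ) : ℚ) ≠ 0 := Int.cast_ne_zero.2 hM
  rw [← div_mul_cancel₀ q hM', ← tmul_zsmul, h₃, TensorProduct.zero_tmul]

theorem compare_surjective (A : Type u) [DGAlgebra A] (k : ℤ) :
    Function.Surjective (compare A k) := by
  intro ζ
  obtain ⟨z, hz, rfl⟩ := exists_cls ζ
  obtain ⟨q, a, ha, rfl⟩ := exists_mk hz.1
  by_cases hq : q = 0
  · refine ⟨0, ?_⟩
    rw [map_zero, eq_comm, cls_eq_zero_iff, hq]
    have h0 : mk 0 a = 0 := TensorProduct.zero_tmul _ _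
    rw [h0]
    exact zero_mem _
  have h : d (mk q a) = 0 := hz.2
  have h₁ : mk 1 (d a) = 0 := by
    rw [d_mk] at h
    rw [← inv_mul_cancel₀ hq, ← smul_mk, h, smul_zero]
  obtain ⟨N, hN, h₂⟩ := exists_zsmul_eq_zero_of_mk_eq_zero h₁
  have hz' : N • a ∈ cocycles A k := ⟨Submodule.smul_mem _ _ ha, by
    change d (N • a) = 0
    rw [map_zsmul, h₂]⟩
  refine ⟨cls (N • a) hz' ⊗ₜ (q / N), ?_⟩
  rw [compare_cls_tmul]
  have h₃ : mk (q / N) (N • a) = mk q a := by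
    rw [mk_zsmul, div_mul_cancel₀ q (Int.cast_ne_zero.2 hN)]
  exact (cls_eq_cls_iff _ _).2 (by rw [h₃, sub_self]; exact zero_mem _)

/-- Rational coefficients are flat: `H^k(A) ⊗ ℚ` is the cohomology of `A_ℚ`. -/
def compareEquiv (A : Type u) [DGAlgebra A] (k : ℤ) :
    Cohomology A k ⊗[ℤ] ℚ ≃ₗ[ℤ] Cohomology (Rationalization A) k :=
  LinearEquiv.ofBijective (compare A k) ⟨compare_injective A k, compare_surjective A k⟩

theorem compareEquiv_cls_tmul [DGAlgebra A] {k : ℤ} {z : A} (hz : z ∈ cocycles A k) (q : ℚ) :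
    compareEquiv A k (cls z hz ⊗ₜ q) = cls (mk q z) (mk_mem_cocycles q hz) := rfl

end Cohomology

variable [HirschAlgebra A] [HirschAlgebra B] (f : HirschHom A B)

/-- The rationalization `A_ℚ → B_ℚ` of a map of Hirsch algebras. -/
def ratHom : HirschHom (Rationalization A) (Rationalization B) where
  toFun := linExt (mkHom 1 ∘ₗ f.lin)
  map_zero' := map_zero _
  map_add' := map_add _
  map_mul' x y := by
    obtain ⟨q, a, rfl⟩ := exists_mk' x
    obtain ⟨r, b, rfl⟩ := exists_mk' y
    simp only [mk_mul_mk, linExt_mk, LinearMap.comp_apply, mkHom_apply, smul_mk, f.lin_mul, mul_one]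
  map_gr hz := by
    obtain ⟨q, a, ha, rfl⟩ := exists_mk hz
    rw [linExt_mk, LinearMap.comp_apply, mkHom_apply, smul_mk]
    exact mk_mem _ (f.lin_gr ha)
  map_d x := by
    obtain ⟨q, a, rfl⟩ := exists_mk' x
    change linExt (mkHom 1 ∘ₗ f.lin) (d (mk q a)) = d (linExt (mkHom 1 ∘ₗ f.lin) (mk q a))
    simp only [d_mk, linExt_mk, LinearMap.comp_apply, mkHom_apply, smul_mk, f.lin_d]
  map_E p q z := by
    obtain ⟨u, a, hu⟩ := exists_tuple' (fun i => z (Sum.inl i))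
    obtain ⟨v, b, hv⟩ := exists_tuple' (fun i => z (Sum.inr i))
    obtain rfl : z = Sum.elim (fun i => mk (u i) (a i)) (fun j => mk (v j) (b j)) := by
      rw [← hu, ← hv]
      ext (k | k) <;> rfl
    have h : (fun i => linExt (mkHom 1 ∘ₗ f.lin)
        (Sum.elim (fun i => mk (u i) (a i)) (fun j => mk (v j) (b j)) i)) =
        Sum.elim (fun i => mk (u i) (f.lin (a i))) (fun j => mk (v j) (f.lin (b j))) := by
      ext (k | k) <;> simp [linExt_mk, mkHom_apply, smul_mk]
    change linExt (mkHom 1 ∘ₗ f.lin) (ratE p q _) = ratE p q (fun i => linExt (mkHom 1 ∘ₗ f.lin)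
        (Sum.elim (fun i => mk (u i) (a i)) (fun j => mk (v j) (b j)) i))
    rw [h, ratE_mk, ratE_mk, linExt_mk, LinearMap.comp_apply, mkHom_apply, smul_mk, mul_one]
    congr 1
    refine (f.map_E p q _).trans ?_
    congr 1
    ext (k | k) <;> rfl

theorem ratHom_lin_mk (q : ℚ) (a : A) : (ratHom f).lin (mk q a) = mk q (f.lin a) := by
  change linExt (mkHom 1 ∘ₗ f.lin) (mk q a) = _
  rw [linExt_mk, LinearMap.comp_apply, mkHom_apply, smul_mk, mul_one]

theorem HirschHom.mapH_cls {k : ℤ} {z : A} (hz : z ∈ cocycles A k) :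
    f.mapH k (cls z hz) = cls (f.lin z) (f.lin_cocycles hz) := rfl

theorem compareEquiv_mapHQ (k : ℤ) (ζ : Cohomology A k ⊗[ℤ] ℚ) :
    compareEquiv B k (f.mapHQ k ζ) = (ratHom f).mapH k (compareEquiv A k ζ) := by
  obtain ⟨ζ, q, rfl⟩ := exists_eq_tmul ζ
  obtain ⟨z, hz, rfl⟩ := exists_cls ζ
  have h : f.mapHQ k (cls z hz ⊗ₜ q) = cls (f.lin z) (f.lin_cocycles hz) ⊗ₜ q := rfl
  rw [h, compareEquiv_cls_tmul, compareEquiv_cls_tmul, HirschHom.mapH_cls, cls_eq_cls_iff,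
    ratHom_lin_mk, sub_self]
  exact zero_mem _

end Rational

/-! ### Construction of homotopies -/

section Gauge

variable {A : Type u} [DGAlgebra A] {h x y z : Ser ℕ A} {n : ℕ}

theorem mul_apply_congr_left {h x y : Ser ℕ A} {n : ℕ} (h0 : h 0 = 0) (hxy : ∀ i < n, x i = y i) :
    (x * h) n = (y * h) n := by
  rw [Ser.mul_apply, Ser.mul_apply]
  refine Finset.sum_congr rfl fun ij hij => ?_
  rw [mem_antidiagonal] at hij
  by_cases hi : ij.1 < n
  · rw [hxy _ hi]
  · rw [show ij.2 = 0 by omega, h0, mul_zero, mul_zero]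

theorem mul_apply_congr_right {h x y : Ser ℕ A} {n : ℕ} (h0 : h 0 = 0) (hxy : ∀ i < n, x i = y i) :
    (h * x) n = (h * y) n := by
  rw [Ser.mul_apply, Ser.mul_apply]
  refine Finset.sum_congr rfl fun ij hij => ?_
  rw [mem_antidiagonal] at hij
  by_cases hi : ij.2 < n
  · rw [hxy _ hi]
  · rw [show ij.1 = 0 by omega, h0, zero_mul, zero_mul]

theorem mul_apply_mem {ε δ k : ℤ} (hx : ∀ n : ℕ, x n ∈ gr (2 * n + ε))
    (hy : ∀ n : ℕ, y n ∈ gr (2 * n + δ)) (hk : k = 2 * n + (ε + δ)) : (x * y) n ∈ gr k := by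
  rw [Ser.mul_apply]
  refine sum_mem fun ij hij => mem_gr_of_eq (mul_mem (hx ij.1) (hy ij.2)) ?_
  rw [mem_antidiagonal] at hij
  rw [hk, ← hij]
  push_cast
  ring

theorem IsTwistingSequence.isOdd (hx : IsTwistingSequence x.coeff) : IsOdd x :=
  fun n => ⟨_, ⟨_, rfl⟩, hx.mem n⟩

theorem isEven_of_mem (hm : ∀ n : ℕ, h n ∈ gr (2 * n : ℤ)) : IsEven h :=
  fun n => ⟨_, even_two_mul _, hm n⟩

/-- Homotopies compose according to `1 + h'' = (1 + h') * (1 + h)`. -/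
theorem IsHomotopy.trans {h' : Ser ℕ A} (h₁ : IsHomotopy h x y) (h₂ : IsHomotopy h' y z) :
    IsHomotopy (h' + h + h' * h) x z := by
  refine ⟨?_, fun n => ?_, ?_⟩
  · rw [Ser.add_apply, Ser.add_apply, h₁.zero, h₂.zero, add_zero, zero_add,
      mul_apply_of_vanishing (by simp) h₁.zero]
  · refine add_mem (add_mem (h₂.mem n) (h₁.mem n)) (mul_apply_mem (ε := 0) (δ := 0) ?_ ?_ (by ring))
    · simpa using h₂.mem
    · simpa using h₁.mem
  · rw [map_add, map_add, dSer_mul_of_isEven (isEven_of_mem h₂.mem)]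
    have e₁ : dSer h = -(y - x + (y * h - h * x)) := by
      rw [eq_neg_iff_add_eq_zero, ← h₁.eqn]
      abel
    have e₂ : dSer h' = -(z - y + (z * h' - h' * y)) := by
      rw [eq_neg_iff_add_eq_zero, ← h₂.eqn]
      abel
    rw [e₁, e₂]
    simp only [mul_add, add_mul, mul_sub, sub_mul, mul_neg, neg_mul, mul_assoc]
    abel

/-- A twisting sequence may be changed along an arbitrary homotopy. -/
theorem exists_isHomotopy (hx : IsTwistingSequence x.coeff) (h0 : h 0 = 0)
    (hm : ∀ n : ℕ, h n ∈ gr (2 * n : ℤ)) :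
    ∃ y : Ser ℕ A, IsTwistingSequence y.coeff ∧ IsHomotopy h x y := by
  obtain ⟨y, hy⟩ := exists_fixed_point (fun n : ℕ => n)
    (fun y : Ser ℕ A => x - dSer h - (y * h - h * x)) (fun y y' n hlt => by
      simp only [Ser.sub_apply]
      rw [mul_apply_congr_left h0 hlt])
  have heqn : y - x + dSer h + (y * h - h * x) = 0 := by
    nth_rewrite 1 [← hy]
    abel
  have hmem : ∀ n : ℕ, y n ∈ gr (2 * n + 1 : ℤ) := by
    intro n
    induction n using Nat.strong_induction_on with
    | _ n ih =>
      rw [← hy]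
      simp only [Ser.sub_apply, dSer_apply]
      refine sub_mem (sub_mem (hx.mem n) (d_mem (hm n))) (sub_mem ?_ ?_)
      · let y' : Ser ℕ A := ⟨fun i => if i < n then y i else 0⟩
        rw [mul_apply_congr_left (y := y') h0 fun i hi => by simp [y', hi]]
        refine mul_apply_mem (ε := 1) (δ := 0) (fun i => ?_) (by simpa using hm) (by ring)
        by_cases hi : i < n
        · simpa [y', hi] using ih i hi
        · simp [y', hi]
      · exact mul_apply_mem (ε := 0) (δ := 1) (by simpa using hm) hx.mem (by ring)
  have hyodd : IsOdd y := fun n => ⟨_, ⟨_, rfl⟩, hmem n⟩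
  -- the curvature `c` of `y` satisfies `c * (1 + h) = 0`
  have hc : dSer y + y * y + (dSer y + y * y) * h = 0 := by
    have e := congrArg dSer heqn
    rw [map_zero, map_add, map_add, map_sub, map_sub, dSer_dSer, dSer_mul_of_isOdd hyodd,
      dSer_mul_of_isEven (isEven_of_mem hm)] at e
    have e₁ : dSer x = -(x * x) := eq_neg_of_add_eq_zero_left (isTwistingSequence_iff.1 hx).2.2
    have e₂ : dSer h = x - y - (y * h - h * x) := by
      rw [← sub_eq_zero, ← heqn]
      abel
    rw [e₁, e₂] at e
    rw [← e]
    simp only [add_mul, mul_sub, sub_mul, mul_neg, mul_assoc]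
    abel
  have hc0 : dSer y + y * y = 0 := by
    refine Ser.ext' fun n => ?_
    induction n using Nat.strong_induction_on with
    | _ n ih =>
      have e := congrArg (fun z : Ser ℕ A => z n) hc
      simp only [Ser.add_apply _ ((dSer y + y * y) * h)] at e
      rw [mul_apply_of_vanishing ih h0, add_zero] at e
      exact e
  refine ⟨y, isTwistingSequence_iff.2 ⟨?_, hmem, hc0⟩, h0, hm, heqn⟩
  rw [← hy]
  simp only [Ser.sub_apply, dSer_apply]
  rw [hx.zero, h0, mul_apply_of_vanishing (by simp) h0, mul_apply_of_vanishing (by simp) hx.zero,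
    map_zero, sub_zero, sub_zero]

/-- The case of a homotopy with only one nonzero term. -/
theorem exists_isHomotopy_single (hx : IsTwistingSequence x.coeff) (hn : n ≠ 0) {w : A}
    (hw : w ∈ gr (2 * n : ℤ)) :
    ∃ h y : Ser ℕ A, IsTwistingSequence y.coeff ∧ IsHomotopy h x y ∧ (∀ i < n, y i = x i) ∧
      y n = x n - d w := by
  let h : Ser ℕ A := ⟨fun i => if i = n then w else 0⟩
  have hlt : ∀ i < n, h i = 0 := fun i hi => if_neg hi.ne
  have h0 : h 0 = 0 := hlt 0 (Nat.pos_of_ne_zero hn)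
  obtain ⟨y, hy, hh⟩ := exists_isHomotopy hx h0 fun i => by
    by_cases hi : i = n
    · subst hi
      simpa [h] using hw
    · simp [h, hi]
  have key : ∀ i ≤ n, y i = x i - d (h i) := by
    intro i hi
    have e := congrArg (fun z : Ser ℕ A => z i) hh.eqn
    simp only [Ser.add_apply, Ser.sub_apply, Ser.zero_apply, dSer_apply] at e
    rw [mul_apply_of_vanishing' hy.zero fun j hj => hlt j (by omega),
      mul_apply_of_vanishing (fun j hj => hlt j (by omega)) hx.zero, sub_zero, add_zero] at e
    rw [← sub_eq_zero, ← e]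
    abel
  refine ⟨h, y, hy, hh, fun i hi => ?_, ?_⟩
  · rw [key i hi.le, hlt i hi, map_zero, sub_zero]
  · rw [key n le_rfl]
    simp [h]

/-- Twisting sequences that agree in all degrees in which there is cohomology are homotopic: the
obstructions to the construction of a homotopy vanish. -/
theorem exists_isHomotopy_of_eq (hx : IsTwistingSequence x.coeff) (hy : IsTwistingSequence y.coeff)
    {N : ℕ} (hxy : ∀ i ≤ N, x i = y i)
    (hN : ∀ n : ℕ, N < n → cocycles A (2 * n + 1) ≤ coboundaries A (2 * n + 1)) :
    ∃ h, IsHomotopy h x y := by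
  classical
  -- the homotopy relation is `R h + d h = 0`, and `R h n` only depends on the terms of `h` before `n`
  let R : Ser ℕ A → Ser ℕ A := fun h => y - x + (y * h - h * x)
  let P : Ser ℕ A → ℕ → A → Prop := fun h n w => w ∈ gr (2 * n : ℤ) ∧ R h n + d w = 0
  obtain ⟨h, hh⟩ := exists_fixed_point (fun n : ℕ => n) (fun h : Ser ℕ A => (⟨fun n =>
      if hw : N < n ∧ ∃ w, P h n w then hw.2.choose else 0⟩ : Ser ℕ A)) (fun h h' n hlt => by
    have hP : P h n = P h' n := by
      funext w
      simp only [P, R, Ser.add_apply, Ser.sub_apply]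
      rw [mul_apply_congr_right hy.zero hlt, mul_apply_congr_left hx.zero hlt]
    simp only [hP])
  have hle : ∀ n ≤ N, h n = 0 := fun n hn => by
    rw [← hh]
    exact dif_neg fun hw => absurd hw.1 (not_lt.2 hn)
  have hspec : ∀ n, N < n → (∃ w, P h n w) → P h n (h n) := by
    intro n hn hw
    have e : h n = hw.choose := by
      conv_lhs => rw [← hh]
      exact dif_pos (⟨hn, hw⟩ : N < n ∧ ∃ w, P h n w)
    rw [e]
    exact hw.choose_spec
  have hm : ∀ n : ℕ, h n ∈ gr (2 * n : ℤ) := by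
    intro n
    by_cases hw : N < n ∧ ∃ w, P h n w
    · exact (hspec n hw.1 hw.2).1
    · rw [← hh]
      have e : (⟨fun n => if hw : N < n ∧ ∃ w, P h n w then hw.2.choose else 0⟩ : Ser ℕ A) n = 0 :=
        dif_neg hw
      rw [e]
      exact zero_mem _
  refine ⟨h, hle 0 (Nat.zero_le N), hm, ?_⟩
  -- the obstruction `R h n` is a cocycle if the homotopy relation holds before `n`
  have hdR : dSer (R h) + y * (R h + dSer h) + (R h + dSer h) * x = 0 := by
    have e₁ : dSer x = -(x * x) := eq_neg_of_add_eq_zero_left (isTwistingSequence_iff.1 hx).2.2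
    have e₂ : dSer y = -(y * y) := eq_neg_of_add_eq_zero_left (isTwistingSequence_iff.1 hy).2.2
    simp only [R, map_add, map_sub]
    rw [dSer_mul_of_isOdd hy.isOdd, dSer_mul_of_isEven (isEven_of_mem hm), e₁, e₂]
    simp only [mul_add, add_mul, mul_sub, sub_mul, neg_mul, mul_neg, mul_assoc]
    abel
  suffices hR : ∀ n, (R h + dSer h) n = 0 by
    refine Ser.ext' fun n => ?_
    rw [Ser.zero_apply, ← hR n]
    congr 1
    simp only [R]
    abel
  intro n
  induction n using Nat.strong_induction_on with
  | _ n ih =>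
    by_cases hn : N < n
    · refine (hspec n hn ?_).2
      have hcoc : R h n ∈ cocycles A (2 * n + 1) := by
        refine ⟨?_, ?_⟩
        · refine add_mem (sub_mem (hy.mem n) (hx.mem n)) (sub_mem ?_ ?_)
          · exact mul_apply_mem (ε := 1) (δ := 0) hy.mem (by simpa using hm) (by ring)
          · exact mul_apply_mem (ε := 0) (δ := 1) (by simpa using hm) hx.mem (by ring)
        · have e := congrArg (fun z : Ser ℕ A => z n) hdR
          simp only [Ser.add_apply _ ((R h + dSer h) * x), Ser.add_apply (dSer (R h))] at e
          rw [mul_apply_of_vanishing' hy.zero ih, mul_apply_of_vanishing ih hx.zero, add_zero,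
            add_zero] at e
          exact e
      obtain ⟨w, hw, e⟩ := hN n hn hcoc
      refine ⟨-w, neg_mem (mem_gr_of_eq hw (by ring)), ?_⟩
      rw [map_neg, e, add_neg_cancel]
    · rw [not_lt] at hn
      simp only [R, Ser.add_apply, Ser.sub_apply, dSer_apply]
      rw [hle n hn, hxy n hn, mul_apply_of_vanishing' hy.zero fun i hi => hle i (by omega),
        mul_apply_of_vanishing (fun i hi => hle i (by omega)) hx.zero]
      simp

end Gauge

/-! ### The characteristic classes -/

section CharClass

variable {A B : Type u} [HirschAlgebra A] [HirschAlgebra B]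

theorem HirschHom.isHomotopy (f : HirschHom A B) {h x y : Ser ℕ A} (hh : IsHomotopy h x y) :
    IsHomotopy (f.ser h) (f.ser x) (f.ser y) := by
  refine ⟨?_, fun n => f.lin_gr (hh.mem n), ?_⟩
  · rw [f.ser_apply, hh.zero, map_zero]
  · have hd : dSer (f.ser h) = f.ser (dSer h) := Ser.ext' fun n => (f.lin_d (h n)).symm
    have hmul : ∀ z w : Ser ℕ A, f.ser z * f.ser w = f.ser (z * w) := fun z w =>
      (Ser.map_mul f.lin.toAddMonoidHom f.lin_mul z w).symm
    rw [hd, hmul, hmul, ← map_sub, ← map_sub, ← map_add, ← map_add, hh.eqn, map_zero]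

/-- The image of a twisting sequence in the rationalization, as a power series. -/
def ratSer (x : TS A) : Ser ℕ (Rationalization A) := (Rationalization.incl A).ser ⟨x.1⟩

theorem ratSer_apply (x : TS A) (n : ℕ) : ratSer x n = Rationalization.mk 1 (x.1 n) := rfl

theorem isTwistingSequence_ratSer (x : TS A) : IsTwistingSequence (ratSer x).coeff :=
  ((Rationalization.incl A).mapTS x).2

/-- The class in `H^{2n+1}(A) ⊗ ℚ` of the leading term of a twisting sequence at `n`. -/
def leadingClass (n : ℕ) (x : TS A) : Cohomology A (2 * n + 1) ⊗[ℤ] ℚ :=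
  (compareEquiv A (2 * n + 1)).symm
    (cls (leading n (ratSer x)) (leading_mem (isTwistingSequence_ratSer x) n))

theorem leadingClass_eq_iff {n : ℕ} {x : TS A} {ζ : Cohomology A (2 * n + 1) ⊗[ℤ] ℚ} :
    leadingClass n x = ζ ↔
      cls (leading n (ratSer x)) (leading_mem (isTwistingSequence_ratSer x) n) =
        compareEquiv A (2 * n + 1) ζ :=
  LinearEquiv.symm_apply_eq _

theorem leadingClass_eq_of_mk {n : ℕ} {x : TS A} {z : A} (hz : z ∈ cocycles A (2 * n + 1))
    (h : leading n (ratSer x) = Rationalization.mk 1 z) : leadingClass n x = cls z hz ⊗ₜ 1 := by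
  rw [leadingClass_eq_iff, compareEquiv_cls_tmul, cls_eq_cls_iff, h, sub_self]
  exact zero_mem _

theorem leadingClass_eq_of_homotopic {n : ℕ} {x y : TS A} (h : Homotopic x y) :
    leadingClass n x = leadingClass n y := by
  obtain ⟨h, hh⟩ := homotopic_iff.1 h
  obtain ⟨b, hb, e⟩ := leading_homotopic (isTwistingSequence_ratSer x)
    (isTwistingSequence_ratSer y) ((Rationalization.incl A).isHomotopy hh) n
  rw [leadingClass, leadingClass, eq_comm]
  congr 1
  rw [cls_eq_cls_iff, e, add_sub_cancel_left]
  exact ⟨b, mem_gr_of_eq hb (by ring), rfl⟩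

/-- The characteristic class `ts(A) → H^{2n+1}(A) ⊗ ℚ`. -/
def charClass (A : Type u) [HirschAlgebra A] (n : ℕ) : HTS A → Cohomology A (2 * n + 1) ⊗[ℤ] ℚ :=
  Quot.lift (leadingClass n) fun _ _ h => leadingClass_eq_of_homotopic h

theorem charClass_cls (n : ℕ) (x : TS A) : charClass A n x.cls = leadingClass n x := rfl

theorem charClass_mapHTS (f : HirschHom A B) (n : ℕ) (ξ : HTS A) :
    charClass B n (f.mapHTS ξ) = f.mapHQ (2 * n + 1) (charClass A n ξ) := by
  obtain ⟨x, rfl⟩ := Quot.exists_rep ξ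
  change leadingClass n (f.mapTS x) = f.mapHQ (2 * n + 1) (leadingClass n x)
  rw [leadingClass_eq_iff, compareEquiv_mapHQ, leadingClass, LinearEquiv.apply_symm_apply,
    HirschHom.mapH_cls, cls_eq_cls_iff, (ratHom f).lin_leading]
  have h : ratSer (f.mapTS x) = (ratHom f).ser (ratSer x) := Ser.ext' fun k => by
    rw [HirschHom.ser_apply, ratSer_apply, ratSer_apply, ratHom_lin_mk]
    rfl
  rw [h, sub_self]
  exact zero_mem _

theorem charClass_of_vanishing {n : ℕ} {x : TS A} (hx : ∀ i, 1 ≤ i → i < n → x.1 i = 0)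
    (hn : x.1 n ∈ cocycles A (2 * n + 1)) : charClass A n x.cls = cls (x.1 n) hn ⊗ₜ 1 := by
  rw [charClass_cls]
  refine leadingClass_eq_of_mk hn ?_
  rw [leading_eq fun i h₁ h₂ => ?_, ratSer_apply]
  rw [ratSer_apply, hx i h₁ h₂]
  exact (Rationalization.mkHom 1).map_zero

theorem charClass_kraines [Module ℚ A] {r : ℕ} {a : A} (ha : a ∈ cocycles A (2 * (r + 1 : ℕ) + 1))
    {x : TS A} (hx : x.1 = kraines (r + 1) a) : charClass A (r + 1) x.cls = cls a ha ⊗ₜ 1 ∧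
      ∀ m, m ≠ r + 1 → charClass A m x.cls = 0 := by
  have h : ∀ m, leading m (ratSer x) = Rationalization.mk 1 (if m = r + 1 then a else 0) := by
    intro m
    rw [ratSer, hx, ← HirschHom.lin_leading, leading_kraines]
    rfl
  refine ⟨leadingClass_eq_of_mk ha (by rw [h, if_pos rfl]), fun m hm => ?_⟩
  rw [charClass_cls, leadingClass_eq_of_mk (zero_mem _) (by rw [h, if_neg hm]),
    (cls_eq_zero_iff _).2 (zero_mem _), TensorProduct.zero_tmul]

/-- Twisting sequences that agree below `n` and have the same class at `n` differ at `n` by a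
coboundary, if there is no torsion in cohomology. -/
theorem sub_mem_coboundaries [hA : ∀ k : ℤ, IsAddTorsionFree (Cohomology A k)] {n : ℕ} (hn : 1 ≤ n)
    {x y : TS A} (hxy : ∀ i < n, x.1 i = y.1 i)
    (hF : charClass A n x.cls = charClass A n y.cls) :
    x.1 n - y.1 n ∈ coboundaries A (2 * n + 1) := by
  have hmul : ∀ ij ∈ antidiagonal n, x.1 ij.1 * x.1 ij.2 = y.1 ij.1 * y.1 ij.2 := by
    intro ij hij
    rw [mem_antidiagonal] at hij
    rcases Nat.eq_zero_or_pos ij.1 with h | h₁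
    · rw [h, x.2.zero, y.2.zero, zero_mul, zero_mul]
    rcases Nat.eq_zero_or_pos ij.2 with h | h₂
    · rw [h, x.2.zero, y.2.zero, mul_zero, mul_zero]
    rw [hxy _ (by omega), hxy _ (by omega)]
  have hz : x.1 n - y.1 n ∈ cocycles A (2 * n + 1) := by
    refine ⟨sub_mem (x.2.mem n) (y.2.mem n), ?_⟩
    change d (x.1 n - y.1 n) = 0
    rw [map_sub, eq_neg_of_add_eq_zero_left (x.2.eqn n), eq_neg_of_add_eq_zero_left (y.2.eqn n),
      Finset.sum_congr rfl hmul, sub_self]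
  rw [charClass_cls, leadingClass_eq_iff, charClass_cls, leadingClass,
    LinearEquiv.apply_symm_apply, cls_eq_cls_iff, leading_sub_leading hn fun i hi => by
      rw [ratSer_apply, ratSer_apply, hxy i hi]] at hF
  have h : compareEquiv A (2 * n + 1) (cls _ hz ⊗ₜ 1) = 0 := by
    rw [compareEquiv_cls_tmul, cls_eq_zero_iff]
    have e : Rationalization.mk 1 (x.1 n - y.1 n) = ratSer x n - ratSer y n :=
      map_sub (Rationalization.mkHom 1) _ _
    rwa [e]
  rw [← cls_eq_zero_iff hz]
  exact eq_zero_of_tmul_one_eq_zero ((LinearEquiv.map_eq_zero_iff _).1 h)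

theorem Homotopic.trans {x y z : TS A} (h₁ : Homotopic x y) (h₂ : Homotopic y z) :
    Homotopic x z := by
  obtain ⟨h, hh⟩ := homotopic_iff.1 h₁
  obtain ⟨h', hh'⟩ := homotopic_iff.1 h₂
  exact homotopic_iff.2 ⟨_, hh.trans hh'⟩

theorem Homotopic.refl (x : TS A) : Homotopic x x :=
  homotopic_iff.2 ⟨0, rfl, fun _ => zero_mem _, by simp⟩

/-- Induction on `n`: once `x` and `y` agree below `n`, a homotopy with the single term `h n` makes
them agree at `n`. -/
theorem exists_homotopic_of_charClass_eq (hA : ∀ k : ℤ, IsAddTorsionFree (Cohomology A k)) (n : ℕ)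
    (x y : TS A) (hF : ∀ i, 1 ≤ i → i ≤ n → charClass A i x.cls = charClass A i y.cls) :
    ∃ x' : TS A, Homotopic x x' ∧ ∀ i ≤ n, x'.1 i = y.1 i := by
  induction n with
  | zero =>
    refine ⟨x, Homotopic.refl x, fun i hi => ?_⟩
    obtain rfl := Nat.le_zero.1 hi
    rw [x.2.zero, y.2.zero]
  | succ n ih =>
    obtain ⟨x', hx', hxy⟩ := ih fun i h₁ h₂ => hF i h₁ (by omega)
    have hF' : charClass A (n + 1) x'.cls = charClass A (n + 1) y.cls := by
      rw [← hF (n + 1) (by omega) le_rfl]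
      exact (leadingClass_eq_of_homotopic hx').symm
    obtain ⟨w, hw, e⟩ := sub_mem_coboundaries (by omega) (fun i hi => hxy i (by omega)) hF'
    obtain ⟨h, x'', hx'', hh, hlt, heq⟩ := exists_isHomotopy_single (x := ⟨x'.1⟩) (n := n + 1)
      x'.2 (by omega) (mem_gr_of_eq hw (by ring))
    refine ⟨⟨x''.coeff, hx''⟩, hx'.trans (homotopic_iff.2 ⟨h, hh⟩), fun i hi => ?_⟩
    rcases Nat.lt_or_eq_of_le hi with hi | rfl
    · exact (hlt i hi).trans (hxy i (by omega))
    · refine heq.trans ?_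
      rw [e]
      exact sub_sub_cancel _ _

theorem homotopic_of_charClass_eq (hA : ∀ k : ℤ, IsAddTorsionFree (Cohomology A k))
    (hb : ∃ N : ℕ, ∀ k : ℤ, (N : ℤ) < |k| → Subsingleton (Cohomology A k)) (x y : TS A)
    (hF : ∀ n, 1 ≤ n → charClass A n x.cls = charClass A n y.cls) : Homotopic x y := by
  obtain ⟨N, hN⟩ := hb
  obtain ⟨x', hx', hxy⟩ := exists_homotopic_of_charClass_eq hA N x y fun i hi _ => hF i hi
  obtain ⟨h, hh⟩ := exists_isHomotopy_of_eq (x := ⟨x'.1⟩) (y := ⟨y.1⟩) x'.2 y.2 hxy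
    fun n hn z hz => by
      have := hN (2 * n + 1) (by rw [abs_of_nonneg (by positivity)]; omega)
      exact (cls_eq_zero_iff hz).1 (Subsingleton.elim _ _)
  exact hx'.trans (homotopic_iff.2 ⟨h, hh⟩)

end CharClass

end Hirsch

end

theorem mainTheorem4 :
    ∃ F : ∀ (A : Type u) [Hirsch.HirschAlgebra A] (n : ℕ),
        Hirsch.HTS A → Hirsch.Cohomology A (2 * n + 1) ⊗[ℤ] ℚ,
      -- naturality
      (∀ (A B : Type u) [Hirsch.HirschAlgebra A] [Hirsch.HirschAlgebra B]
        (f : Hirsch.HirschHom A B) (n : ℕ), 1 ≤ n → ∀ ξ : Hirsch.HTS A,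
          F B n (f.mapHTS ξ) = f.mapHQ (2 * n + 1) (F A n ξ)) ∧
      -- (1) the value on a twisting sequence that starts in degree `2n+1`
      (∀ (A : Type u) [Hirsch.HirschAlgebra A] (n : ℕ), 1 ≤ n → ∀ x : Hirsch.TS A,
        (∀ i, 1 ≤ i → i < n → x.1 i = 0) →
          ∃ hx : x.1 n ∈ Hirsch.cocycles A (2 * n + 1),
            F A n x.cls = Hirsch.cls (x.1 n) hx ⊗ₜ[ℤ] 1) ∧
      -- (2) the values on the Kraines construction, in a Hirsch `ℚ`-algebra
      (∀ (A : Type u) [Hirsch.HirschAlgebra A] [Module ℚ A] (n : ℕ), 1 ≤ n →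
        ∀ (a : A) (ha : a ∈ Hirsch.cocycles A (2 * n + 1)),
          ∃ hK : Hirsch.IsTwistingSequence (Hirsch.kraines n a),
            F A n (Hirsch.TS.cls ⟨Hirsch.kraines n a, hK⟩) = Hirsch.cls a ha ⊗ₜ[ℤ] 1 ∧
            ∀ m : ℕ, 1 ≤ m → m ≠ n → F A m (Hirsch.TS.cls ⟨Hirsch.kraines n a, hK⟩) = 0) ∧
      -- (2), for a cocycle `a` of any Hirsch algebra `A`, with `K(a)` in the rationalization of `A`
      (∀ (A : Type u) [Hirsch.HirschAlgebra A] (n : ℕ), 1 ≤ n →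
        ∀ (a : A) (ha : a ∈ Hirsch.cocycles A (2 * n + 1)),
          ∃ hK : Hirsch.IsTwistingSequence
              (Hirsch.kraines n (Hirsch.Rationalization.mk 1 a)),
            F (Hirsch.Rationalization A) n (Hirsch.TS.cls ⟨_, hK⟩) =
              (Hirsch.Rationalization.incl A).mapHQ (2 * n + 1) (Hirsch.cls a ha ⊗ₜ[ℤ] 1) ∧
            ∀ m : ℕ, 1 ≤ m → m ≠ n →
              F (Hirsch.Rationalization A) m (Hirsch.TS.cls ⟨_, hK⟩) = 0) ∧
      -- (3), first part
      (∀ (A : Type u) [Hirsch.HirschAlgebra A],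
        (∀ k : ℤ, IsAddTorsionFree (Hirsch.Cohomology A k)) →
          ∀ (n : ℕ) (x y : Hirsch.TS A),
            (∀ i, 1 ≤ i → i ≤ n → F A i x.cls = F A i y.cls) →
              ∃ x' : Hirsch.TS A, Hirsch.Homotopic x x' ∧ ∀ i, 1 ≤ i → i ≤ n → x'.1 i = y.1 i) ∧
      -- (3), second part
      (∀ (A : Type u) [Hirsch.HirschAlgebra A],
        (∀ k : ℤ, IsAddTorsionFree (Hirsch.Cohomology A k)) →
          (∃ N : ℕ, ∀ k : ℤ, (N : ℤ) < |k| → Subsingleton (Hirsch.Cohomology A k)) →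
            ∀ x y : Hirsch.TS A, (∀ n, 1 ≤ n → F A n x.cls = F A n y.cls) →
              Hirsch.Homotopic x y) := by
  refine ⟨fun A _ n => Hirsch.charClass A n, ?_, ?_, ?_, ?_, ?_, ?_⟩
  · intro A B _ _ f n _ ξ
    exact Hirsch.charClass_mapHTS f n ξ
  · intro A _ n _ x hx
    have h : x.1 n ∈ Hirsch.cocycles A (2 * n + 1) := by
      refine Hirsch.leading_mem_cocycles (x := ⟨x.1⟩) x.2 fun i hi => ?_
      rcases Nat.eq_zero_or_pos i with rfl | h
      · exact x.2.zero
      · exact hx i h hi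
    exact ⟨h, Hirsch.charClass_of_vanishing hx h⟩
  · intro A _ _ n hn a ha
    obtain ⟨r, rfl⟩ := Nat.exists_eq_succ_of_ne_zero (Nat.one_le_iff_ne_zero.1 hn)
    have hK := Hirsch.isTwistingSequence_kraines ha
    have h := Hirsch.charClass_kraines (x := ⟨_, hK⟩) ha rfl
    exact ⟨hK, h.1, fun m _ hm => h.2 m hm⟩
  · intro A _ n hn a ha
    obtain ⟨r, rfl⟩ := Nat.exists_eq_succ_of_ne_zero (Nat.one_le_iff_ne_zero.1 hn)
    have ha' := Hirsch.mk_mem_cocycles 1 ha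
    have hK := Hirsch.isTwistingSequence_kraines ha'
    have h := Hirsch.charClass_kraines (x := ⟨_, hK⟩) ha' rfl
    exact ⟨hK, h.1, fun m _ hm => h.2 m hm⟩
  · intro A _ hA n x y hF
    obtain ⟨x', hx', h⟩ := Hirsch.exists_homotopic_of_charClass_eq hA n x y hF
    exact ⟨x', hx', fun i _ hi => h i hi⟩
  · intro A _ hA hb x y hF
    exact Hirsch.homotopic_of_charClass_eq hA hb x y hF
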